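/- For $\eta>0$, a subset $Y$ of a metric space is called $\eta$-separated if any two distinct points of $Y$ are at distance at least $\eta$, and $\eta$-Gromov if it is $\eta$-separated and not properly contained in any $\eta$-separated subset. A triangulation of a set $X\subset\mathbb{R}^2$ is a locally finite simplicial complex in $\mathbb{R}^2$ whose polyhedron (the union of its simplices) is $X$. A Delaunay triangulation of a point set $P\subset\mathbb{R}^2$ is a triangulation of the convex hull of $P$ with vertex set $P$ such that the circumdisk of each of its triangles contains no point of $P$ in its interior. A simplicial complex in $\mathbb{R}^2$ is an $\eta$-CDG (Chew–Delaunay–Gromov complex) if it is a subcomplex of a Delaunay triangulation of some $\eta$-Gromov subset of $\mathbb{R}^2$. **Theorem.** Let $\mathcal{F}$ be the family of all simplicial complexes in $\mathbb{R}^2$ that are $\eta$-CDGs for some $\eta>0$. Then $\mathcal{F}$ is a nonempty family of triangulations of subsets of $\mathbb{R}^2$, and it is $\left(\frac{\pi}{6},2\right)$-nondegenerate, extendable, and subdividable, that is: 1. All angles of all triangles of all $\mathcal{T}\in\mathcal{F}$ are $\geq\frac{\pi}{6}$. 2. For every $\mathcal{T}\in\mathcal{F}$, the ratio of the lengths of any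 two edges of $\mathcal{T}$ is at most $2$. 3. For every $\mathcal{T}\in\mathcal{F}$ there is a $\mathcal{T}_{\mathrm{ext}}\in\mathcal{F}$ that triangulates $\mathbb{R}^2$ and contains $\mathcal{T}$ as a subcomplex. 4. For every $\varepsilon>0$ and every $\mathcal{T}\in\mathcal{F}$ there is a subdivision $\tilde{\mathcal{T}}$ of $\mathcal{T}$ (a simplicial complex with the same polyhedron, each of whose simplices lies in a simplex of $\mathcal{T}$) such that $\tilde{\mathcal{T}}\in\mathcal{F}$ and all edges of $\tilde{\mathcal{T}}$ have length $<\varepsilon$. -/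

import Mathlib

noncomputable section

/-- The Euclidean plane. -/
abbrev Plane : Type := EuclideanSpace ℝ (Fin 2)

/-- Simplicial complexes in the plane. Their faces are the vertex sets of the (closed) simplices;
`T ≤ T'` means that `T` is a subcomplex of `T'`. -/
abbrev PlaneComplex : Type := Geometry.SimplicialComplex ℝ Plane

/-- Any two distinct points of `Y` are at distance at least `η`. -/
def EtaSeparated {X : Type*} [MetricSpace X] (η : ℝ) (Y : Set X) : Prop :=
  Y.Pairwise fun x y => η ≤ dist x y

/-- `Y` is `η`-Gromov: `η`-separated and not properly contained in any `η`-separated set. -/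
def IsGromovSet {X : Type*} [MetricSpace X] (η : ℝ) (Y : Set X) : Prop :=
  Maximal (EtaSeparated η) Y

/-- `T` triangulates `X`: a locally finite simplicial complex whose polyhedron is `X`. -/
structure Triangulates (T : PlaneComplex) (X : Set Plane) : Prop where
  locallyFinite : LocallyFinite fun s : T.faces => convexHull ℝ ((s : Finset Plane) : Set Plane)
  space_eq : T.space = X

/-- `ab` is an edge (a `1`-simplex) of `T`. -/
def HasEdge (T : PlaneComplex) (a b : Plane) : Prop :=
  a ≠ b ∧ ∃ s ∈ T.faces, (s : Set Plane) = {a, b}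

/-- `abc` is a triangle (a `2`-simplex) of `T`. -/
def HasTriangle (T : PlaneComplex) (a b c : Plane) : Prop :=
  a ≠ b ∧ b ≠ c ∧ a ≠ c ∧ ∃ s ∈ T.faces, (s : Set Plane) = {a, b, c}

/-- `T` is a Delaunay triangulation of the point set `P`: its vertex set is `P`, it triangulates
the convex hull of `P`, and the circumdisk of each triangle (the disk bounded by the unique circle
through its three vertices) contains no point of `P` in its interior. -/
structure IsDelaunayTriangulation (P : Set Plane) (T : PlaneComplex) : Prop where
  vertices_eq : T.vertices = P
  triangulates : Triangulates T (convexHull ℝ P)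
  empty_circumdisk : ∀ a b c : Plane, HasTriangle T a b c →
    ∀ S : EuclideanGeometry.Sphere Plane, a ∈ S → b ∈ S → c ∈ S →
      ∀ p ∈ P, p ∉ Metric.ball S.center S.radius

/-- `T` is an `η`-CDG (Chew-Delaunay-Gromov complex): a subcomplex of a Delaunay triangulation of
an `η`-Gromov subset of the plane. -/
def IsCDG (η : ℝ) (T : PlaneComplex) : Prop :=
  ∃ (P : Set Plane) (That : PlaneComplex),
    IsGromovSet η P ∧ IsDelaunayTriangulation P That ∧ T ≤ That

/-- The family of all CDG complexes in the plane (of any scale `η > 0`). -/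
def cdgFamily : Set PlaneComplex :=
  {T | ∃ η : ℝ, 0 < η ∧ IsCDG η T}

/-- `T'` is a subdivision of `T`: the polyhedra agree and each simplex of `T'` lies in a simplex
of `T`. -/
def IsSubdivision (T' T : PlaneComplex) : Prop :=
  T'.space = T.space ∧
    ∀ s' ∈ T'.faces, ∃ s ∈ T.faces, convexHull ℝ (s' : Set Plane) ⊆ convexHull ℝ (s : Set Plane)

/-- `F` is a family of triangulations of subsets of the plane that is
`(θ₀, σ₀)`-nondegenerate, extendable, and subdividable. -/
structure IsNondegExtSubdiv (θ₀ σ₀ : ℝ) (F : Set PlaneComplex) : Prop where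
  triangulation : ∀ T ∈ F, ∃ X : Set Plane, Triangulates T X
  angle_ge : ∀ T ∈ F, ∀ a b c : Plane, HasTriangle T a b c → θ₀ ≤ EuclideanGeometry.angle a b c
  ratio_le : ∀ T ∈ F, ∀ a b c d : Plane, HasEdge T a b → HasEdge T c d →
    dist a b / dist c d ≤ σ₀
  extendable : ∀ T ∈ F, ∃ Text ∈ F, Triangulates Text Set.univ ∧ T ≤ Text
  subdividable : ∀ ε : ℝ, 0 < ε → ∀ T ∈ F, ∃ T' ∈ F, IsSubdivision T' T ∧
    ∀ a b : Plane, HasEdge T' a b → dist a b < ε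

end

noncomputable section
open EuclideanGeometry

/-! Let `P` be `η`-Gromov with Delaunay triangulation `K`. Edges have length at least `η` by
separation. Circumradii are less than `η`: by maximality some point of `P` is closer than `η` to the
circumcentre, and it is not inside the disk. Hence edges are shorter than `2η`, and the law of sines
bounds angles below by `π/6` (`angle_ge_of_circumradius`). As `P` is relatively dense, its hull is
the plane, so `K` itself is the required extension. The hexagonal lattice shows that the family is
nonempty.

For subdivisions it suffices to halve the scale and iterate. Each triangle is cut into four by its
midlines, except that at an obtuse angle the parallelogram is divided by the median instead of the
midline, as the empty circle condition demands. The result is a Delaunay triangulation of an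
`η/2`-Gromov set, for three reasons.

Covering: a point of a triangle is within half the circumradius of a vertex or an edge midpoint
(`exists_dist_le_half_radius`).

Empty circles: by Delaunay's lemma (`power_nonneg_of_local`) only neighbouring pieces need checking.
Inside one triangle this is a linear inequality in the squared sides. Across half an edge of `K` it
depends on whether the angle at its end is obtuse on neither side (a homothety), on one side (the
hard inequality `obtuse_flip_ineq`) or on both.

Separation: pieces have edges at least `η/2`, the median being controlled by
`dist_sq_le_of_circumradius`, and in a Delaunay triangulation of the plane a lower bound for edges
is one for all distances between vertices (`etaSeparated_vertices`).

A subcomplex `T` of `K` is subdivided by those faces of the cut complex that lie in faces of `T`.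
Empty circles are expressed throughout by the power of a point, because the difference of two powers
is an affine function. -/

theorem dist_sq_plane (a b : Plane) : dist a b ^ 2 = (a 0 - b 0) ^ 2 + (a 1 - b 1) ^ 2 := by
  rw [EuclideanSpace.dist_eq, Real.sq_sqrt (by positivity)]
  simp [Fin.sum_univ_two, Real.dist_eq, sq_abs]

theorem plane_ext {x y : Plane} (h0 : x 0 = y 0) (h1 : x 1 = y 1) : x = y := by
  ext i
  fin_cases i <;> assumption

/-! ### Barycentric coordinates, affine functions and convex hulls -/

/-- Twice the signed area of the triangle `abc`. -/
def crossArea (a b c : Plane) : ℝ := (b 0 - a 0) * (c 1 - a 1) - (b 1 - a 1) * (c 0 - a 0)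

/-- The barycentric coordinate of `x` at the vertex `a` of the triangle `abc`. -/
def bary (a b c x : Plane) : ℝ := crossArea x b c / crossArea a b c

/-- Affine real functions on the plane. -/
def IsAff (g : Plane → ℝ) : Prop :=
  ∃ p q r : ℝ, ∀ x, g x = p * x 0 + q * x 1 + r

theorem crossArea_rotate (a b c : Plane) : crossArea b c a = crossArea a b c := by
  unfold crossArea; ring

theorem crossArea_swap (a b c : Plane) : crossArea a c b = -crossArea a b c := by
  unfold crossArea; ring

theorem crossArea_ne_zero_rotate {a b c : Plane} (h : crossArea a b c ≠ 0) :
    crossArea b c a ≠ 0 := by rwa [crossArea_rotate]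

theorem crossArea_ne_zero_swap {a b c : Plane} (h : crossArea a b c ≠ 0) :
    crossArea b a c ≠ 0 := by rw [← crossArea_rotate, crossArea_swap]; simpa

theorem crossArea_ne {a b c : Plane} (h : crossArea a b c ≠ 0) : a ≠ b := by
  rintro rfl; apply h; unfold crossArea; ring

theorem bary_swap (a b c x : Plane) : bary a c b x = bary a b c x := by
  rw [bary, bary, crossArea_swap, crossArea_swap a b c, neg_div_neg_eq]

theorem bary_self {a b c : Plane} (h : crossArea a b c ≠ 0) : bary a b c a = 1 := div_self h

theorem bary_fst (a b c : Plane) : bary a b c b = 0 := by simp [bary, crossArea]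

theorem bary_snd (a b c : Plane) : bary a b c c = 0 := by
  rw [← bary_swap, bary_fst]

theorem bary_sum {a b c : Plane} (h : crossArea a b c ≠ 0) (x : Plane) :
    bary a b c x + bary b c a x + bary c a b x = 1 := by
  rw [bary, bary, bary, crossArea_rotate a b c, crossArea_rotate b c a, crossArea_rotate a b c]
  field_simp
  unfold crossArea; ring

theorem bary_repr {a b c : Plane} (h : crossArea a b c ≠ 0) (x : Plane) :
    x = bary a b c x • a + bary b c a x • b + bary c a b x • c := by
  apply plane_ext <;>
  · simp only [PiLp.add_apply, PiLp.smul_apply, smul_eq_mul]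
    rw [bary, bary, bary, crossArea_rotate a b c, crossArea_rotate b c a, crossArea_rotate a b c]
    field_simp
    unfold crossArea; ring

theorem isAff_bary (a b c : Plane) : IsAff (bary a b c) := by
  refine ⟨(b 1 - c 1) / crossArea a b c, (c 0 - b 0) / crossArea a b c,
    (b 0 * c 1 - b 1 * c 0) / crossArea a b c, fun x => ?_⟩
  rw [bary]
  unfold crossArea
  ring

theorem IsAff.add {f g : Plane → ℝ} (hf : IsAff f) (hg : IsAff g) : IsAff fun x => f x + g x := by
  obtain ⟨p, q, r, hf⟩ := hf
  obtain ⟨p', q', r', hg⟩ := hg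
  exact ⟨p + p', q + q', r + r', fun x => by simp only [hf, hg]; ring⟩

theorem IsAff.const_mul {g : Plane → ℝ} (hg : IsAff g) (k : ℝ) : IsAff fun x => k * g x := by
  obtain ⟨p, q, r, hg⟩ := hg
  exact ⟨k * p, k * q, k * r, fun x => by simp only [hg]; ring⟩

theorem isAff_const (k : ℝ) : IsAff fun _ => k := ⟨0, 0, k, fun x => by ring⟩

theorem IsAff.sub {f g : Plane → ℝ} (hf : IsAff f) (hg : IsAff g) : IsAff fun x => f x - g x := by
  obtain ⟨p, q, r, hf⟩ := hf
  obtain ⟨p', q', r', hg⟩ := hg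
  exact ⟨p - p', q - q', r - r', fun x => by simp only [hf, hg]; ring⟩

theorem IsAff.comb {g : Plane → ℝ} (hg : IsAff g) {s t : ℝ} (h : s + t = 1) (x y : Plane) :
    g (s • x + t • y) = s * g x + t * g y := by
  obtain ⟨p, q, r, hg⟩ := hg
  obtain rfl : s = 1 - t := by linarith
  simp only [hg, PiLp.add_apply, PiLp.smul_apply, smul_eq_mul]
  ring

theorem IsAff.comb3 {g : Plane → ℝ} (hg : IsAff g) {s t r : ℝ} (h : s + t + r = 1)
    (x y z : Plane) : g (s • x + t • y + r • z) = s * g x + t * g y + r * g z := by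
  obtain ⟨p, q, k, hg⟩ := hg
  obtain rfl : s = 1 - t - r := by linarith
  simp only [hg, PiLp.add_apply, PiLp.smul_apply, smul_eq_mul]
  ring

theorem IsAff.add_smul_sub {g : Plane → ℝ} (hg : IsAff g) (x y : Plane) (t : ℝ) :
    g (x + t • (y - x)) = g x + t * (g y - g x) := by
  obtain ⟨p, q, r, hg⟩ := hg
  simp only [hg, PiLp.add_apply, PiLp.smul_apply, PiLp.sub_apply, smul_eq_mul]
  ring

theorem midpoint_apply_plane (x y : Plane) (i : Fin 2) :
    midpoint ℝ x y i = (x i + y i) / 2 := by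
  rw [midpoint_eq_smul_add]; simp; ring

theorem IsAff.midpoint {g : Plane → ℝ} (hg : IsAff g) (x y : Plane) :
    g (midpoint ℝ x y) = (g x + g y) / 2 := by
  obtain ⟨p, q, r, hg⟩ := hg
  simp only [hg, midpoint_apply_plane]
  ring

theorem IsAff.continuous {g : Plane → ℝ} (hg : IsAff g) : Continuous g := by
  obtain ⟨p, q, r, hg⟩ := hg
  rw [funext hg]
  fun_prop

theorem IsAff.eq_bary {g : Plane → ℝ} (hg : IsAff g) {a b c : Plane} (h : crossArea a b c ≠ 0)
    (x : Plane) : g x = bary a b c x * g a + bary b c a x * g b + bary c a b x * g c := by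
  conv_lhs => rw [bary_repr h x]
  exact hg.comb3 (bary_sum h x) a b c

theorem mem_convexHull_of_isAff {g : Plane → ℝ} (hg : IsAff g) {s : Set Plane}
    (hs : ∀ v ∈ s, 0 ≤ g v) {x : Plane} (hx : x ∈ convexHull ℝ s) : 0 ≤ g x := by
  have : convexHull ℝ s ⊆ {y | 0 ≤ g y} := by
    apply convexHull_min hs
    intro y hy z hz s t hs ht hst
    have hy : 0 ≤ g y := hy
    have hz : 0 ≤ g z := hz
    change 0 ≤ g _
    rw [hg.comb hst]; positivity
  exact this hx

/-- The points of a convex hull on a supporting line are in the hull of the points on the line. -/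
theorem mem_convexHull_zeros {g : Plane → ℝ} (hg : IsAff g) {s : Set Plane}
    (hs : ∀ v ∈ s, 0 ≤ g v) {x : Plane} (hx : x ∈ convexHull ℝ s) (h0 : g x ≤ 0) :
    x ∈ convexHull ℝ {v ∈ s | g v = 0} := by
  have hz : ∀ v ∈ convexHull ℝ {v ∈ s | g v = 0}, g v = 0 := by
    intro v hv
    apply le_antisymm
    · have := mem_convexHull_of_isAff (hg.const_mul (-1)) (s := {v ∈ s | g v = 0})
        (fun v hv => by simp [hv.2]) hv
      linarith
    · exact mem_convexHull_of_isAff hg (fun v hv => hv.2.ge) hv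
  -- The union of the open half-plane and the hull of the zeros is convex and contains `s`.
  have : convexHull ℝ s ⊆ {y | 0 < g y} ∪ convexHull ℝ {v ∈ s | g v = 0} := by
    apply convexHull_min
    · intro v hv
      rcases (hs v hv).lt_or_eq with h | h
      · exact Or.inl h
      · exact Or.inr (subset_convexHull ℝ _ ⟨hv, h.symm⟩)
    · have nn : ∀ y ∈ {y | 0 < g y} ∪ convexHull ℝ {v ∈ s | g v = 0}, 0 ≤ g y := by
        rintro y (hy | hy)
        · exact le_of_lt hy
        · exact (hz y hy).ge
      intro y hy z hz' a b ha hb hab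
      rcases ha.eq_or_lt with rfl | ha
      · obtain rfl : b = 1 := by linarith
        simpa using hz'
      rcases hb.eq_or_lt with rfl | hb
      · obtain rfl : a = 1 := by linarith
        simpa using hy
      have h1 := nn y hy
      have h2 := nn z hz'
      rcases hy with hy | hy
      · left
        have hy : 0 < g y := hy
        change 0 < g _
        rw [hg.comb hab]; positivity
      rcases hz' with hz' | hz'
      · left
        have hz' : 0 < g z := hz'
        change 0 < g _
        rw [hg.comb hab]; positivity
      · exact Or.inr (convex_convexHull ℝ _ hy hz' ha.le hb.le hab)
  rcases this hx with h | h
  · exact absurd h0 (not_le.mpr h)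
  · exact h

theorem comb_mem_convexHull {s : Set Plane} {a b c : Plane} (ha : a ∈ convexHull ℝ s)
    (hb : b ∈ convexHull ℝ s) (hc : c ∈ convexHull ℝ s) {p q r : ℝ} (hp : 0 ≤ p) (hq : 0 ≤ q)
    (hr : 0 ≤ r) (h : p + q + r = 1) : p • a + q • b + r • c ∈ convexHull ℝ s := by
  have := (convex_convexHull ℝ s).sum_mem (t := Finset.univ) (w := ![p, q, r]) (z := ![a, b, c])
    (by intro i _; fin_cases i <;> assumption) (by simpa [Fin.sum_univ_three] using h)
    (by intro i _; fin_cases i <;> assumption)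
  simpa [Fin.sum_univ_three] using this

theorem mem_convexHull_triple {a b c : Plane} (h : crossArea a b c ≠ 0) (x : Plane) :
    x ∈ convexHull ℝ {a, b, c} ↔ 0 ≤ bary a b c x ∧ 0 ≤ bary b c a x ∧ 0 ≤ bary c a b x := by
  have h1 := crossArea_ne_zero_rotate h
  have h2 := crossArea_ne_zero_rotate h1
  constructor
  · intro hx
    refine ⟨mem_convexHull_of_isAff (isAff_bary _ _ _) ?_ hx,
      mem_convexHull_of_isAff (isAff_bary _ _ _) ?_ hx,
      mem_convexHull_of_isAff (isAff_bary _ _ _) ?_ hx⟩ <;>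
    · rintro v (rfl | rfl | rfl) <;> simp [bary_self, bary_fst, bary_snd, *]
  · rintro ⟨ha, hb, hc⟩
    rw [bary_repr h x]
    exact comb_mem_convexHull (subset_convexHull ℝ _ (by simp)) (subset_convexHull ℝ _ (by simp))
      (subset_convexHull ℝ _ (by simp)) ha hb hc (bary_sum h x)

theorem affineIndependent_of_crossArea {a b c : Plane} (h : crossArea a b c ≠ 0) :
    AffineIndependent ℝ ((↑) : ({a, b, c} : Set Plane) → Plane) := by
  have h1 : AffineIndependent ℝ ![a, b, c] := by
    rw [affineIndependent_iff_linearIndependent_vsub ℝ _ (0 : Fin 3)]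
    have e := LinearIndependent.pair_iff (R := ℝ) (x := b - a) (y := c - a)
    rw [← linearIndependent_equiv (finSuccAboveEquiv (0 : Fin 3))]
    have e2 : ((fun i : {x : Fin 3 // x ≠ 0} => ![a, b, c] ↑i -ᵥ ![a, b, c] 0) ∘
        ⇑(finSuccAboveEquiv (0 : Fin 3))) = ![b - a, c - a] := by
      funext i; fin_cases i <;> rfl
    rw [e2, e]
    intro s t hst
    have g0 := congrFun (congrArg WithLp.ofLp hst) 0
    have g1 := congrFun (congrArg WithLp.ofLp hst) 1
    simp at g0 g1
    unfold crossArea at h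
    constructor
    · have : s * ((b 0 - a 0) * (c 1 - a 1) - (b 1 - a 1) * (c 0 - a 0)) = 0 := by
        linear_combination (c 1 - a 1) * g0 - (c 0 - a 0) * g1
      exact (mul_eq_zero.mp this).resolve_right h
    · have : t * ((b 0 - a 0) * (c 1 - a 1) - (b 1 - a 1) * (c 0 - a 0)) = 0 := by
        linear_combination (b 0 - a 0) * g1 - (b 1 - a 1) * g0
      exact (mul_eq_zero.mp this).resolve_right h
  have h2 := h1.range
  have e : Set.range ![a, b, c] = {a, b, c} := by
    ext x; simp; tauto
  rwa [e] at h2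

theorem crossArea_of_affineIndependent {a b c : Plane} (hab : a ≠ b) (hbc : b ≠ c) (hac : a ≠ c)
    {s : Finset Plane} (hs : (s : Set Plane) = {a, b, c})
    (h : AffineIndependent ℝ ((↑) : s → Plane)) : crossArea a b c ≠ 0 := by
  intro h0
  have h' : AffineIndependent ℝ ((↑) : ({a, b, c} : Set Plane) → Plane) := by
    rw [← hs]; exact h
  have h1 : AffineIndependent ℝ ![a, b, c] := by
    have hm : ∀ i, ![a, b, c] i ∈ ({a, b, c} : Set Plane) := by
      intro i; fin_cases i <;> simp
    have := h'.comp_embedding (⟨fun i : Fin 3 => ⟨![a, b, c] i, hm i⟩, by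
      intro i j hij
      have hij' := congrArg Subtype.val hij
      fin_cases i <;> fin_cases j <;> simp_all⟩ : Fin 3 ↪ ({a, b, c} : Set Plane))
    exact this
  rw [affineIndependent_iff_linearIndependent_vsub ℝ _ (0 : Fin 3)] at h1
  rw [← linearIndependent_equiv (finSuccAboveEquiv (0 : Fin 3))] at h1
  have e2 : ((fun i : {x : Fin 3 // x ≠ 0} => ![a, b, c] ↑i -ᵥ ![a, b, c] 0) ∘
      ⇑(finSuccAboveEquiv (0 : Fin 3))) = ![b - a, c - a] := by
    funext i; fin_cases i <;> rfl
  rw [e2, LinearIndependent.pair_iff] at h1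
  unfold crossArea at h0
  have k1 := h1 (c 0 - a 0) (-(b 0 - a 0)) (by
    apply plane_ext
    · simp; ring
    · simp; linarith)
  have k2 := h1 (c 1 - a 1) (-(b 1 - a 1)) (by
    apply plane_ext
    · simp; linarith
    · simp; ring)
  exact hac (plane_ext (by linarith [k1.1]) (by linarith [k2.1]))

/-! ### Powers of points and circumscribed circles -/

theorem power_plane (S : Sphere Plane) (x : Plane) :
    S.power x = (x 0 - S.center 0) ^ 2 + (x 1 - S.center 1) ^ 2 - S.radius ^ 2 := by
  rw [Sphere.power, dist_sq_plane]

theorem power_of_mem {S : Sphere Plane} {x : Plane} (h : x ∈ S) : S.power x = 0 := by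
  rw [Sphere.power, mem_sphere.mp h, sub_self]

theorem radius_nonneg_of_mem {S : Sphere Plane} {x : Plane} (h : x ∈ S) : 0 ≤ S.radius := by
  rw [← mem_sphere.mp h]; exact dist_nonneg

theorem notMem_ball_iff_power {S : Sphere Plane} (h : 0 ≤ S.radius) (x : Plane) :
    x ∉ Metric.ball S.center S.radius ↔ 0 ≤ S.power x := by
  rw [Sphere.power_nonneg_iff_radius_le_dist_center h, Metric.mem_ball, not_lt]

/-- The power of a point of a circle's plane, from the powers of the vertices of a triangle. -/
theorem power_comb3 (S : Sphere Plane) {s t r : ℝ} (h : s + t + r = 1) (a b c : Plane) :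
    S.power (s • a + t • b + r • c) = s * S.power a + t * S.power b + r * S.power c -
      (s * t * dist a b ^ 2 + t * r * dist b c ^ 2 + r * s * dist c a ^ 2) := by
  obtain rfl : s = 1 - t - r := by linarith
  simp only [power_plane, dist_sq_plane, PiLp.add_apply, PiLp.smul_apply, smul_eq_mul]
  ring

/-- The correction term is that of `power_comb3`; the two identities are used together so that it
cancels. -/
theorem dist_sq_comb3 (x : Plane) {s t r : ℝ} (h : s + t + r = 1) (a b c : Plane) :
    dist (s • a + t • b + r • c) x ^ 2 =
      s * dist a x ^ 2 + t * dist b x ^ 2 + r * dist c x ^ 2 -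
      (s * t * dist a b ^ 2 + t * r * dist b c ^ 2 + r * s * dist c a ^ 2) := by
  obtain rfl : s = 1 - t - r := by linarith
  simp only [dist_sq_plane, PiLp.add_apply, PiLp.smul_apply, smul_eq_mul]
  ring

theorem power_midpoint (S : Sphere Plane) (a b : Plane) :
    S.power (midpoint ℝ a b) = (S.power a + S.power b) / 2 - dist a b ^ 2 / 4 := by
  simp only [power_plane, dist_sq_plane, midpoint_apply_plane]
  ring

theorem dist_sq_midpoint (x a b : Plane) :
    dist (midpoint ℝ a b) x ^ 2 = (dist a x ^ 2 + dist b x ^ 2) / 2 - dist a b ^ 2 / 4 := by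
  simp only [dist_sq_plane, midpoint_apply_plane]
  ring

/-- The quadratic parts cancel. The zero line is the radical axis, which passes through the common
points of the two circles. -/
theorem isAff_power_sub (S S' : Sphere Plane) : IsAff fun x => S.power x - S'.power x := by
  refine ⟨2 * (S'.center 0 - S.center 0), 2 * (S'.center 1 - S.center 1),
    S.center 0 ^ 2 + S.center 1 ^ 2 - S'.center 0 ^ 2 - S'.center 1 ^ 2 - S.radius ^ 2
      + S'.radius ^ 2, fun x => ?_⟩
  simp only [power_plane]
  ring

theorem exists_circumsphere {a b c : Plane} (h : crossArea a b c ≠ 0) :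
    ∃ S : Sphere Plane, a ∈ S ∧ b ∈ S ∧ c ∈ S := by
  set D := crossArea a b c with hD
  -- Cramer's rule for the perpendicular bisector equations `2⟨b - a, o - a⟩ = |ab|²` and `2⟨c - a,
  -- o - a⟩ = |ac|²`.
  set o : Plane := !₂[a 0 + ((c 1 - a 1) * dist a b ^ 2 - (b 1 - a 1) * dist a c ^ 2) / (2 * D),
    a 1 + ((b 0 - a 0) * dist a c ^ 2 - (c 0 - a 0) * dist a b ^ 2) / (2 * D)] with ho
  have key : ∀ x, dist x o ^ 2 = dist a o ^ 2 → x ∈ (⟨o, dist a o⟩ : Sphere Plane) := by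
    intro x hx
    rw [mem_sphere]
    exact (sq_eq_sq₀ dist_nonneg dist_nonneg).mp hx
  have h2 : (b 0 - a 0) * (c 1 - a 1) - (b 1 - a 1) * (c 0 - a 0) = D := rfl
  have o0 : o 0 = a 0 + ((c 1 - a 1) * dist a b ^ 2 - (b 1 - a 1) * dist a c ^ 2) / (2 * D) := rfl
  have o1 : o 1 = a 1 + ((b 0 - a 0) * dist a c ^ 2 - (c 0 - a 0) * dist a b ^ 2) / (2 * D) := rfl
  refine ⟨⟨o, dist a o⟩, key a rfl, key b ?_, key c ?_⟩
  · rw [dist_sq_plane b, dist_sq_plane a o, o0, o1]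
    have : 2 * (b 0 - a 0) * (((c 1 - a 1) * dist a b ^ 2 - (b 1 - a 1) * dist a c ^ 2) / (2 * D))
      + 2 * (b 1 - a 1) * (((b 0 - a 0) * dist a c ^ 2 - (c 0 - a 0) * dist a b ^ 2) / (2 * D))
      = dist a b ^ 2 := by
      field_simp
      rw [← h2]; ring
    rw [dist_sq_plane a b] at this ⊢
    linear_combination -this
  · rw [dist_sq_plane c, dist_sq_plane a o, o0, o1]
    have : 2 * (c 0 - a 0) * (((c 1 - a 1) * dist a b ^ 2 - (b 1 - a 1) * dist a c ^ 2) / (2 * D))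
      + 2 * (c 1 - a 1) * (((b 0 - a 0) * dist a c ^ 2 - (c 0 - a 0) * dist a b ^ 2) / (2 * D))
      = dist a c ^ 2 := by
      field_simp
      rw [← h2]; ring
    rw [dist_sq_plane a c] at this ⊢
    linear_combination -this

/-! ### Metric inequalities for sides at least `η` and circumradius at most `η` -/

/-- Scaled coordinates with origin `a` and first axis through `b`. -/
theorem exists_frame {η : ℝ} (hη : 0 < η) {a b : Plane} (hab : a ≠ b) :
    ∃ (X Y : Plane → ℝ) (l : ℝ), 0 < l ∧ X a = 0 ∧ Y a = 0 ∧ 0 < X b ∧ Y b = 0 ∧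
      (∀ x y, dist x y ^ 2 = η ^ 2 * ((X x - X y) ^ 2 + (Y x - Y y) ^ 2)) ∧
      ∀ x, crossArea a b x = l * Y x := by
  have hd : 0 < dist a b := dist_pos.mpr hab
  set L := dist a b with hL
  have hL2 : (a 0 - b 0) ^ 2 + (a 1 - b 1) ^ 2 = L ^ 2 := (dist_sq_plane a b).symm
  refine ⟨fun x => ((b 0 - a 0) * (x 0 - a 0) + (b 1 - a 1) * (x 1 - a 1)) / (L * η),
    fun x => ((b 0 - a 0) * (x 1 - a 1) - (b 1 - a 1) * (x 0 - a 0)) / (L * η), L * η,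
    by positivity, by simp, by simp, ?_, by simp; left; ring, ?_, ?_⟩
  · apply div_pos _ (by positivity)
    have : (b 0 - a 0) * (b 0 - a 0) + (b 1 - a 1) * (b 1 - a 1) = L ^ 2 := by
      rw [← hL2]; ring
    rw [this]; positivity
  · intro x y
    rw [dist_sq_plane]
    field_simp
    rw [← hL2]; ring
  · intro x
    field_simp
    unfold crossArea; ring

/-- In a triangle with sides at least `1` and circumradius at most `1`, in coordinates. -/
theorem sq_le_of_circumradius {b x y k : ℝ} (h : x ^ 2 + y ^ 2 = b * x + 2 * k * y)
    (hk : k ^ 2 + b ^ 2 / 4 ≤ 1) (hb : 1 ≤ b ^ 2) (h1 : 1 ≤ x ^ 2 + y ^ 2) :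
    0 ≤ x ^ 2 + y ^ 2 + 2 * b * x := by
  by_contra! hc
  set r := x ^ 2 + y ^ 2 with hr
  -- The vertices are `(0, 0)`, `(b, 0)`, `(x, y)` and the circumcentre is `(b/2, k)`. If the claim
  -- fails, both `x²` and `y²` are bounded below in terms of `r`. Adding the bounds with suitable
  -- weights replaces `x² + y²` by `r`, and `r ≥ 1` then leaves `(b² - 1)² < 0`.
  have e1 : 3 * r < 4 * (k * y) := by nlinarith
  have e2 : r ^ 2 < 4 * (b ^ 2 * x ^ 2) := by nlinarith
  have e3 : 9 * r ^ 2 < 16 * (k ^ 2 * y ^ 2) := by nlinarith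
  have e4 : 9 * r ^ 2 < 4 * (4 - b ^ 2) * y ^ 2 := by nlinarith [sq_nonneg y]
  have hw : 0 < 4 - b ^ 2 := by
    by_contra! hh
    nlinarith [sq_nonneg y, sq_nonneg r]
  have e5 : r ^ 2 * (4 - b ^ 2) < 4 * b ^ 2 * (4 - b ^ 2) * x ^ 2 := by nlinarith
  have e6 : 9 * r ^ 2 * b ^ 2 < 4 * b ^ 2 * (4 - b ^ 2) * y ^ 2 := by nlinarith
  have e7 : r ^ 2 * (4 + 8 * b ^ 2) < 4 * b ^ 2 * (4 - b ^ 2) * r := by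
    rw [hr] at *; nlinarith
  have e8 : r * (4 + 8 * b ^ 2) < 4 * b ^ 2 * (4 - b ^ 2) := by nlinarith
  nlinarith [sq_nonneg (b ^ 2 - 1)]

/-- The coordinate form of the local Delaunay condition at half an edge that faces an angle on one
side and a cut obtuse angle on the other. -/
theorem obtuse_flip_ineq {b k u v x y m : ℝ} (hb : 0 < b)
    (hc : x ^ 2 + y ^ 2 - b * x + 2 * k * y = 0) (hy : 0 < y) (hc1 : 1 ≤ x ^ 2 + y ^ 2)
    (hc2 : 1 ≤ (x - b) ^ 2 + y ^ 2) (hd : u ^ 2 + v ^ 2 + b * u = 2 * m * v) (hv : 0 < v)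
    (hu : 0 ≤ u) (hm : m ^ 2 + b ^ 2 / 4 ≤ 1) (hd1 : 1 ≤ u ^ 2 + v ^ 2) (hb1 : 1 ≤ b ^ 2) :
    0 ≤ u ^ 2 + v ^ 2 - b * u - 2 * k * v := by
  -- In coordinates `p = 0`, `q = (b, 0)`, `c = (x, y)`, `d = (-u, -v)`; the circumcentre of `pqc`
  -- is `(b/2, -k)`. The goal says that `q + d - p` is not inside the circumcircle of `pqc`. For `k
  -- ≤ 0` the centre is not beyond `pq` from `c`, and the preceding inequality suffices.
  rcases le_or_gt k 0 with hk | hk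
  · have := sq_le_of_circumradius (b := b) (x := -u) (y := v) (k := m) (by linarith) hm hb1
      (by linarith)
    nlinarith
  · have hb2 : b ^ 2 - 2 ≥ 4 * k * y := by nlinarith
    have hw2 : 0 ≤ 4 - b ^ 2 := by nlinarith [sq_nonneg m]
    -- Twice the largest possible distance from the edge of length `b` to the centre of a circle of
    -- radius `1` through its ends.
    set w := Real.sqrt (4 - b ^ 2) with hw
    have hww : w ^ 2 = 4 - b ^ 2 := Real.sq_sqrt hw2
    have hw0 : 0 ≤ w := Real.sqrt_nonneg _
    have hmw : 2 * m ≤ w := by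
      apply le_of_sq_le_sq _ hw0
      nlinarith
    have hD : u ^ 2 + v ^ 2 + b * u ≤ w * v := by
      rw [hd]; exact mul_le_mul_of_nonneg_right hmw hv.le
    have hbu : 0 ≤ b * u := by positivity
    have hw1 : 1 ≤ w := by
      have h1 : 1 ≤ w * v := by nlinarith
      have h2 : v ≤ w := by
        have : v * v ≤ w * v := by linarith [sq_nonneg u, sq v]
        exact le_of_mul_le_mul_right this hv
      have h3 : w * v ≤ w * w := mul_le_mul_of_nonneg_left h2 hw0
      by_contra! h4
      have : w * w < 1 * 1 := mul_self_lt_mul_self hw0 h4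
      linarith
    have hx : 0 < x := by
      have : 0 < b * x := by
        have e : b * x = x ^ 2 + y ^ 2 + 2 * k * y := by linarith
        rw [e]; positivity
      exact (mul_pos_iff_of_pos_left hb).mp this
    have hx' : 0 < b - x := by
      have : 0 < b * (b - x) := by
        have e : b * (b - x) = (b - x) ^ 2 + y ^ 2 + 2 * k * y := by linear_combination -hc
        rw [e]; positivity
      exact (mul_pos_iff_of_pos_left hb).mp this
    -- Weighting the two side bounds at `c` by `b - x` and `x` is Stewart's theorem for the foot of
    -- the altitude from `c`.
    have hy2 : 1 - x * (b - x) ≤ y ^ 2 := by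
      have : b * (1 - x * (b - x)) ≤ b * y ^ 2 := by
        have e1 := mul_le_mul_of_nonneg_left hc1 hx'.le
        have e2 := mul_le_mul_of_nonneg_left hc2 hx.le
        linear_combination e1 + e2
      exact le_of_mul_le_mul_left this hb
    have hyw : w ≤ 2 * y := by
      apply le_of_sq_le_sq _ (by positivity)
      nlinarith [sq_nonneg (b - 2 * x)]
    have hkw : 2 * k * w ≤ 2 - w ^ 2 := by
      have : 2 * k * w ≤ 2 * k * (2 * y) := mul_le_mul_of_nonneg_left hyw (by positivity)
      linarith
    have hv1 : v ≤ u ^ 2 + v ^ 2 := by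
      rcases le_or_gt v 1 with h | h
      · linarith
      · linarith [sq_nonneg u, mul_le_mul_of_nonneg_left h.le hv.le, sq v]
    -- After multiplication by `w`, `hkw` controls the term with `k` and `hD` the term `b * u`; what
    -- remains is `2 (w (u² + v²) - v) ≥ 0`.
    have : 0 ≤ w * (u ^ 2 + v ^ 2 - b * u - 2 * k * v) := by
      have e1 := mul_le_mul_of_nonneg_right hkw hv.le
      have e2 := mul_le_mul_of_nonneg_left hD hw0
      have e3 : v ≤ w * (u ^ 2 + v ^ 2) := by
        have := mul_le_mul_of_nonneg_right hw1 (by positivity : 0 ≤ u ^ 2 + v ^ 2)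
        linarith
      linarith
    exact nonneg_of_mul_nonneg_right this (by linarith)

/-- A triangle with sides at least `η` and circumradius at most `η` is far from degenerate. -/
theorem dist_sq_le_of_circumradius {η : ℝ} (hη : 0 < η) {a b c : Plane} {S : Sphere Plane}
    (ha : a ∈ S) (hb : b ∈ S) (hc : c ∈ S) (hr : S.radius ≤ η) (hab : η ≤ dist a b)
    (hac : η ≤ dist a c) : dist b c ^ 2 ≤ dist a b ^ 2 + 2 * dist a c ^ 2 := by
  have hne : a ≠ b := dist_pos.mp (hη.trans_le hab)
  obtain ⟨X, Y, l, hl, Xa, Ya, Xb, Yb, hd, -⟩ := exists_frame hη hne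
  have η2 : 0 < η ^ 2 := by positivity
  have pa := power_of_mem ha
  have pb := power_of_mem hb
  have pc := power_of_mem hc
  have r2 : S.radius ^ 2 ≤ η ^ 2 := pow_le_pow_left₀ (radius_nonneg_of_mem ha) hr 2
  have dab : η ^ 2 ≤ dist a b ^ 2 := pow_le_pow_left₀ hη.le hab 2
  have dac : η ^ 2 ≤ dist a c ^ 2 := pow_le_pow_left₀ hη.le hac 2
  simp only [Sphere.power, hd, Xa, Ya, Yb] at pa pb pc dab dac ⊢
  have e0 : S.radius ^ 2 = η ^ 2 * (X S.center ^ 2 + Y S.center ^ 2) := by linear_combination -pa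
  have e1 : X S.center = X b / 2 := by
    have : η ^ 2 * X b * (X b - 2 * X S.center) = 0 := by linear_combination pb - pa
    have := (mul_eq_zero.mp this).resolve_left (by positivity)
    linarith
  have e2 : X c ^ 2 + Y c ^ 2 = X b * X c + 2 * Y S.center * Y c := by
    have : η ^ 2 * (X c ^ 2 + Y c ^ 2 - X b * X c - 2 * Y S.center * Y c) = 0 := by
      rw [e1] at pa pc; linear_combination pc - pa
    have := (mul_eq_zero.mp this).resolve_left (by positivity)
    linarith
  have key := sq_le_of_circumradius (b := X b) (x := X c) (y := Y c) (k := Y S.center) e2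
    (le_of_mul_le_mul_left (by rw [e0, e1] at r2; linarith) η2)
    (le_of_mul_le_mul_left (by linarith) η2) (le_of_mul_le_mul_left (by linarith) η2)
  have := mul_nonneg η2.le key
  linarith

/-- The local Delaunay condition at half an edge `pq` where the angle at `p` is cut on the side of
`d` only. -/
theorem power_nonneg_of_cut {η : ℝ} (hη : 0 < η) {p q c d : Plane} {S' S : Sphere Plane}
    (hp' : p ∈ S') (hq' : q ∈ S') (hd' : d ∈ S') (hr : S'.radius ≤ η) (hpq : η ≤ dist p q)
    (hpc : η ≤ dist p c) (hqc : η ≤ dist q c) (hpd : η ≤ dist p d)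
    (hside : crossArea p q c * crossArea p q d < 0)
    (hobt : dist p q ^ 2 + dist p d ^ 2 ≤ dist q d ^ 2)
    (hp : p ∈ S) (hm : midpoint ℝ p q ∈ S) (hm' : midpoint ℝ p c ∈ S) :
    0 ≤ S.power (midpoint ℝ q d) := by
  have hne : p ≠ q := dist_pos.mp (hη.trans_le hpq)
  obtain ⟨X, Y, l, hl, Xp, Yp, Xq, Yq, hd, hY⟩ := exists_frame hη hne
  have η2 : 0 < η ^ 2 := by positivity
  have pp' := power_of_mem hp'
  have pq' := power_of_mem hq'
  have pd' := power_of_mem hd'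
  have r2 : S'.radius ^ 2 ≤ η ^ 2 := pow_le_pow_left₀ (radius_nonneg_of_mem hp') hr 2
  have dpq : η ^ 2 ≤ dist p q ^ 2 := pow_le_pow_left₀ hη.le hpq 2
  have dpc : η ^ 2 ≤ dist p c ^ 2 := pow_le_pow_left₀ hη.le hpc 2
  have dqc : η ^ 2 ≤ dist q c ^ 2 := pow_le_pow_left₀ hη.le hqc 2
  have dpd : η ^ 2 ≤ dist p d ^ 2 := pow_le_pow_left₀ hη.le hpd 2
  have pp := power_of_mem hp
  have pm := power_of_mem hm
  have pm' := power_of_mem hm'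
  rw [power_midpoint] at pm pm' ⊢
  simp only [Sphere.power, hd, Xp, Yp, Yq] at *
  have e0 : S'.radius ^ 2 = η ^ 2 * (X S'.center ^ 2 + Y S'.center ^ 2) := by
    linear_combination -pp'
  have e1 : X S'.center = X q / 2 := by
    have : η ^ 2 * X q * (X q - 2 * X S'.center) = 0 := by linear_combination pq' - pp'
    have := (mul_eq_zero.mp this).resolve_left (by positivity)
    linarith
  have e2 : X d ^ 2 + Y d ^ 2 - X q * X d - 2 * Y S'.center * Y d = 0 := by
    have : η ^ 2 * (X d ^ 2 + Y d ^ 2 - X q * X d - 2 * Y S'.center * Y d) = 0 := by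
      rw [e1] at pp' pd'; linear_combination pd' - pp'
    exact (mul_eq_zero.mp this).resolve_left (by positivity)
  have f0 : S.radius ^ 2 = η ^ 2 * (X S.center ^ 2 + Y S.center ^ 2) := by
    linear_combination -pp
  have f1 : X S.center = X q / 4 := by
    have : η ^ 2 * X q * (X q - 4 * X S.center) = 0 := by
      rw [f0] at pm; linear_combination 4 * pm
    have := (mul_eq_zero.mp this).resolve_left (by positivity)
    linarith
  have f2 : X c ^ 2 + Y c ^ 2 - X q * X c - 4 * Y S.center * Y c = 0 := by
    have : η ^ 2 * (X c ^ 2 + Y c ^ 2 - X q * X c - 4 * Y S.center * Y c) = 0 := by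
      rw [f0, f1] at pm'; linear_combination 4 * pm'
    exact (mul_eq_zero.mp this).resolve_left (by positivity)
  have hu : 0 ≤ -X d := by
    have : 0 ≤ 2 * η ^ 2 * X q * (-X d) := by linarith
    exact nonneg_of_mul_nonneg_right this (by positivity)
  have g1 : X S'.center ^ 2 + Y S'.center ^ 2 ≤ 1 :=
    le_of_mul_le_mul_left (by linarith) η2
  have g2 : 1 ≤ X d ^ 2 + Y d ^ 2 := le_of_mul_le_mul_left (by linarith) η2
  have g3 : 1 ≤ X c ^ 2 + Y c ^ 2 := le_of_mul_le_mul_left (by linarith) η2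
  have g4 : 1 ≤ (X c - X q) ^ 2 + Y c ^ 2 := le_of_mul_le_mul_left (by linarith) η2
  have g5 : 1 ≤ X q ^ 2 := le_of_mul_le_mul_left (by linarith) η2
  rw [e1] at g1
  have hYY : Y c * Y d < 0 := by
    have : l ^ 2 * (Y c * Y d) < 0 := by rw [hY, hY] at hside; linarith
    by_contra! hh
    have := mul_nonneg (sq_nonneg l) hh
    linarith
  -- Reflection in the line `pq` puts `c` above it. The factor `2` in `k` comes from doubling `S`
  -- from `p`, which gives the circumcircle of `pqc`.
  have key : 0 ≤ X d ^ 2 + Y d ^ 2 + X q * X d - 4 * Y S.center * Y d := by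
    rcases mul_neg_iff.mp hYY with ⟨h1, h2⟩ | ⟨h1, h2⟩
    · have := obtuse_flip_ineq (b := X q) (k := -2 * Y S.center) (u := -X d) (v := -Y d)
        (x := X c) (y := Y c) (m := -Y S'.center) Xq (by linarith) h1 g3 g4 (by linarith)
        (by linarith) hu (by linarith) (by linarith) g5
      linarith
    · have := obtuse_flip_ineq (b := X q) (k := 2 * Y S.center) (u := -X d) (v := Y d)
        (x := X c) (y := -Y c) (m := Y S'.center) Xq (by linarith) (by linarith) (by linarith)
        (by linarith) (by linarith) (by linarith) hu (by linarith) (by linarith) g5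
      linarith
  rw [f0, f1]
  have := mul_nonneg η2.le key
  linarith

/-- The local Delaunay condition at half an edge `pq` where the angle at `p` is cut on both
sides. -/
theorem power_nonneg_of_cut_cut {p q c d : Plane} {S : Sphere Plane} (hne : p ≠ q)
    (hside : crossArea p q c * crossArea p q d < 0)
    (hc : dist q c ^ 2 ≤ dist p q ^ 2 + 2 * dist p c ^ 2)
    (hd : dist q d ^ 2 ≤ dist p q ^ 2 + 2 * dist p d ^ 2)
    (hp : p ∈ S) (hm : midpoint ℝ p q ∈ S) (hm' : midpoint ℝ q c ∈ S) :
    0 ≤ S.power (midpoint ℝ q d) := by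
  obtain ⟨X, Y, l, hl, Xp, Yp, Xq, Yq, hD, hY⟩ := exists_frame one_pos hne
  have pp := power_of_mem hp
  have pm := power_of_mem hm
  have pm' := power_of_mem hm'
  rw [power_midpoint] at pm pm' ⊢
  simp only [Sphere.power, hD, Xp, Yp, Yq] at *
  have f0 : S.radius ^ 2 = X S.center ^ 2 + Y S.center ^ 2 := by
    linear_combination -pp
  have f1 : X S.center = X q / 4 := by
    have : X q * (X q - 4 * X S.center) = 0 := by
      rw [f0] at pm; linear_combination 4 * pm
    have := (mul_eq_zero.mp this).resolve_left (by positivity)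
    linarith
  rw [f0, f1] at pm'
  rw [f0, f1]
  have hYY : Y c * Y d < 0 := by
    have : l ^ 2 * (Y c * Y d) < 0 := by rw [hY, hY] at hside; linarith
    by_contra! hh
    have := mul_nonneg (sq_nonneg l) hh
    linarith
  -- By `pm'` the expression is `|pc|² + X q * X c`, nonnegative by `hc`. So the centre of `S` is
  -- not strictly across `pq` from `c`, hence not strictly on the side of `d`, and `hd` gives the
  -- claim in the same way.
  have h1 : 0 ≤ 4 * (Y S.center * Y c) := by nlinarith [sq_nonneg (X c), sq_nonneg (Y c)]
  have h2 : 0 ≤ - (Y S.center * Y d) := by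
    by_contra! h
    have : 0 < (Y S.center * Y d) * (Y S.center * Y c) ∨ Y S.center * Y c = 0 := by
      rcases h1.eq_or_lt with h1 | h1
      · right; linarith
      · left; exact mul_pos (by linarith) (by linarith)
    rcases this with h3 | h3
    · nlinarith [sq_nonneg (Y S.center)]
    · rcases mul_eq_zero.mp h3 with h4 | h4
      · rw [h4] at h; simp at h
      · rw [h4] at hYY; simp at hYY
  nlinarith [sq_nonneg (X d), sq_nonneg (Y d)]

/-- The local Delaunay condition at half an edge `pq` where the angle at `p` is cut on neither
side. -/
theorem power_nonneg_of_uncut {p q c d : Plane} {S : Sphere Plane}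
    (hemp : ∀ S' : Sphere Plane, p ∈ S' → q ∈ S' → c ∈ S' → 0 ≤ S'.power d)
    (hp : p ∈ S) (hm : midpoint ℝ p q ∈ S) (hm' : midpoint ℝ p c ∈ S) :
    0 ≤ S.power (midpoint ℝ p d) := by
  have hr := radius_nonneg_of_mem hp
  -- The homothety with centre `p` and ratio `2` carries `S` to a circle through `p`, `q`, `c` and
  -- the midpoint of `pd` to `d`.
  set o : Plane := S.center + (S.center - p) with ho
  have o0 : ∀ i, o i = S.center i + (S.center i - p i) := fun i => rfl
  have key : ∀ x, (⟨o, 2 * S.radius⟩ : Sphere Plane).power x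
      = 4 * S.power (midpoint ℝ p x) := by
    intro x
    simp only [power_plane, o0, midpoint_apply_plane]
    ring
  have mem : ∀ x, midpoint ℝ p x ∈ S → x ∈ (⟨o, 2 * S.radius⟩ : Sphere Plane) := by
    intro x hx
    rw [← Sphere.power_eq_zero_iff_mem_sphere (by simpa using hr), key, power_of_mem hx, mul_zero]
  have := hemp _ (mem p (by simpa using hp)) (mem q hm) (mem c hm')
  rw [key] at this
  linarith

/-- The weighted mean of the squared distances from the point `x` to the vertices is minus the power
of `x`, that is `R² - |x - o|² ≤ R²`, so the distances cannot all exceed `R`. -/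
theorem exists_dist_le_radius {S : Sphere Plane} {a b c : Plane} (ha : a ∈ S) (hb : b ∈ S)
    (hc : c ∈ S) {s t r : ℝ} (hs : 0 ≤ s) (ht : 0 ≤ t) (hr : 0 ≤ r) (h : s + t + r = 1) :
    ∃ v ∈ ({a, b, c} : Set Plane), dist (s • a + t • b + r • c) v ≤ S.radius := by
  set x := s • a + t • b + r • c with hx
  have h1 := power_comb3 S h a b c
  have h2 := dist_sq_comb3 x h a b c
  rw [← hx] at h1 h2
  rw [power_of_mem ha, power_of_mem hb, power_of_mem hc, Sphere.power] at h1
  rw [dist_self] at h2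
  by_contra! hcon
  have hr0 := radius_nonneg_of_mem ha
  have l : ∀ v ∈ ({a, b, c} : Set Plane), S.radius ^ 2 < dist v x ^ 2 := fun v hv => by
    rw [dist_comm v x]; exact pow_lt_pow_left₀ (hcon v hv) hr0 two_ne_zero
  have la := l a (by simp)
  have lb := l b (by simp)
  have lc := l c (by simp)
  have : S.radius ^ 2 < s * dist a x ^ 2 + t * dist b x ^ 2 + r * dist c x ^ 2 := by
    rcases hs.eq_or_lt with rfl | hs
    · rcases ht.eq_or_lt with rfl | ht
      · obtain rfl : r = 1 := by linarith
        linarith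
      · nlinarith
    · nlinarith
  nlinarith [sq_nonneg (dist x S.center)]

/-- Every point of a triangle is within half the circumradius of a vertex or an edge midpoint. -/
theorem exists_dist_le_half_radius {S : Sphere Plane} {a b c x : Plane}
    (h : crossArea a b c ≠ 0) (ha : a ∈ S) (hb : b ∈ S)
    (hc : c ∈ S) (hx : x ∈ convexHull ℝ {a, b, c}) :
    ∃ v ∈ ({a, b, c, midpoint ℝ a b, midpoint ℝ b c, midpoint ℝ c a} : Set Plane),
      dist x v ≤ S.radius / 2 := by
  have hr0 := radius_nonneg_of_mem ha
  have corner : ∀ a b c : Plane, a ∈ S → b ∈ S → c ∈ S → ∀ s t r : ℝ, 0 ≤ t → 0 ≤ r →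
      1 / 2 ≤ s → s + t + r = 1 → x = s • a + t • b + r • c →
      ∃ v ∈ ({a, midpoint ℝ a b, midpoint ℝ a c} : Set Plane), dist x v ≤ S.radius / 2 := by
    intro a b c ha hb hc s t r ht hr hs hsum hx
    -- A corner piece is the image of the triangle under the homothety with centre `a` and ratio
    -- `1/2`, so its circumradius is halved.
    set S' : Sphere Plane := ⟨midpoint ℝ a S.center, S.radius / 2⟩
    have mem : ∀ y ∈ S, midpoint ℝ a y ∈ S' := by
      intro y hy
      rw [← Sphere.power_eq_zero_iff_mem_sphere (by positivity)]
      have h1 := power_of_mem hy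
      simp only [power_plane, midpoint_apply_plane, S'] at h1 ⊢
      linear_combination h1 / 4
    obtain ⟨v, hv, hd⟩ := exists_dist_le_radius (by simpa using mem a ha) (mem b hb) (mem c hc)
      (s := 2 * s - 1) (t := 2 * t) (r := 2 * r) (by linarith) (by linarith) (by linarith)
      (by linarith)
    have e : (2 * s - 1) • a + (2 * t) • midpoint ℝ a b + (2 * r) • midpoint ℝ a c = x := by
      rw [hx]
      obtain rfl : s = 1 - t - r := by linarith
      apply plane_ext <;>
      · simp only [PiLp.add_apply, PiLp.smul_apply, smul_eq_mul, midpoint_apply_plane]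
        ring
    exact ⟨v, hv, by rwa [e] at hd⟩
  obtain ⟨h1, h2, h3⟩ := (mem_convexHull_triple h x).mp hx
  have hs := bary_sum h x
  have hrepr := bary_repr h x
  set s := bary a b c x
  set t := bary b c a x
  set r := bary c a b x
  by_cases ca : 1 / 2 ≤ s
  · obtain ⟨v, hv, hd⟩ := corner a b c ha hb hc s t r h2 h3 ca hs hrepr
    refine ⟨v, ?_, hd⟩
    rcases hv with rfl | rfl | rfl <;> simp [midpoint_comm]
  by_cases cb : 1 / 2 ≤ t
  · obtain ⟨v, hv, hd⟩ := corner b c a hb hc ha t r s h3 h1 cb (by linarith) (by rw [hrepr]; abel)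
    refine ⟨v, ?_, hd⟩
    rcases hv with rfl | rfl | rfl <;> simp [midpoint_comm]
  by_cases cc : 1 / 2 ≤ r
  · obtain ⟨v, hv, hd⟩ := corner c a b hc ha hb r s t h1 h2 cc (by linarith) (by rw [hrepr]; abel)
    refine ⟨v, ?_, hd⟩
    rcases hv with rfl | rfl | rfl <;> simp [midpoint_comm]
  -- In the medial triangle the circumcircle is the nine-point circle, with centre `(a + b + c - o)
  -- / 2` and radius `R / 2`.
  · set o : Plane := (1 / 2 : ℝ) • (a + b + c - S.center)
    set S' : Sphere Plane := ⟨o, S.radius / 2⟩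
    have o0 : ∀ i, o i = (1 / 2 : ℝ) * (a i + b i + c i - S.center i) := fun i => rfl
    have pa := power_of_mem ha
    have pb := power_of_mem hb
    have pc := power_of_mem hc
    simp only [power_plane] at pa pb pc
    have m1 : midpoint ℝ a b ∈ S' := by
      rw [← Sphere.power_eq_zero_iff_mem_sphere (by positivity)]
      simp only [power_plane, midpoint_apply_plane, S', o0]
      linear_combination pc / 4
    have m2 : midpoint ℝ b c ∈ S' := by
      rw [← Sphere.power_eq_zero_iff_mem_sphere (by positivity)]
      simp only [power_plane, midpoint_apply_plane, S', o0]
      linear_combination pa / 4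
    have m3 : midpoint ℝ c a ∈ S' := by
      rw [← Sphere.power_eq_zero_iff_mem_sphere (by positivity)]
      simp only [power_plane, midpoint_apply_plane, S', o0]
      linear_combination pb / 4
    obtain ⟨v, hv, hd⟩ := exists_dist_le_radius m1 m2 m3
      (s := 1 - 2 * r) (t := 1 - 2 * s) (r := 1 - 2 * t) (by linarith) (by linarith)
      (by linarith) (by linarith)
    have e : (1 - 2 * r) • midpoint ℝ a b + (1 - 2 * s) • midpoint ℝ b c
        + (1 - 2 * t) • midpoint ℝ c a = x := by
      rw [hrepr]
      obtain h1 : s = 1 - t - r := by linarith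
      rw [h1]
      apply plane_ext <;>
      · simp only [PiLp.add_apply, PiLp.smul_apply, smul_eq_mul, midpoint_apply_plane]
        ring
    rw [e] at hd
    exact ⟨v, by rcases hv with rfl | rfl | rfl <;> simp, hd⟩

/-- By the law of sines `|ac| = 2R sin b`, and `|ac| ≥ R` gives `sin b ≥ 1/2`. The proof works with
the equivalent `cos² ≤ 3/4`. -/
theorem angle_ge_of_circumradius {η : ℝ} {a b c : Plane} (h : crossArea a b c ≠ 0)
    {S : Sphere Plane} (ha : a ∈ S) (hb : b ∈ S) (hc : c ∈ S) (hr : S.radius ≤ η)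
    (hac : η ≤ dist a c) : Real.pi / 6 ≤ EuclideanGeometry.angle a b c := by
  have hba : b ≠ a := (crossArea_ne h).symm
  have hbc : b ≠ c := crossArea_ne (crossArea_ne_zero_rotate h)
  obtain ⟨X, Y, l, hl, Xp, Yp, Xq, Yq, hD, hY⟩ := exists_frame one_pos hba
  have pa := power_of_mem ha
  have pb := power_of_mem hb
  have pc := power_of_mem hc
  have hR : S.radius ^ 2 ≤ dist a c ^ 2 :=
    pow_le_pow_left₀ (radius_nonneg_of_mem ha) (hr.trans hac) 2
  have law := EuclideanGeometry.law_cos a b c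
  have hab0 : 0 < dist a b := dist_pos.mpr hba.symm
  have hcb0 : 0 < dist c b := dist_pos.mpr hbc.symm
  set C := Real.cos (EuclideanGeometry.angle a b c) with hC
  have hab2 : dist a b ^ 2 = X a ^ 2 := by rw [hD, Xp, Yp, Yq]; ring
  have hcb2 : dist c b ^ 2 = X c ^ 2 + Y c ^ 2 := by rw [hD, Xp, Yp]; ring
  have hac2 : dist a c ^ 2 = (X a - X c) ^ 2 + Y c ^ 2 := by rw [hD, Yq]; ring
  simp only [Sphere.power, hD, Xp, Yp, Yq] at pa pb pc hR
  have e0 : S.radius ^ 2 = X S.center ^ 2 + Y S.center ^ 2 := by linear_combination -pb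
  have e1 : X S.center = X a / 2 := by
    have : X a * (X a - 2 * X S.center) = 0 := by linear_combination pa - pb
    have := (mul_eq_zero.mp this).resolve_left (by positivity)
    linarith
  rw [e0, e1] at pc hR
  have e2 : X c ^ 2 + Y c ^ 2 = X a * X c + 2 * Y S.center * Y c := by linear_combination pc
  set A := X a
  set x := X c
  set y := Y c
  set k := Y S.center
  have hcos : dist a b * dist c b * C = A * x := by
    linear_combination (1 / 2) * law + hab2 / 2 + hcb2 / 2 - hac2 / 2
  -- With `b` at the origin and `a = (A, 0)`, this is `|bc| |ac| = 2R |y|` squared: the product of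
  -- two sides is the diameter times the altitude on the third.
  have e3 : (x ^ 2 + y ^ 2) * ((A - x) ^ 2 + y ^ 2) = (A ^ 2 + 4 * k ^ 2) * y ^ 2 := by
    linear_combination ((A - x) ^ 2 + y ^ 2) * e2 + (A * x + 2 * k * y) * e2 - A ^ 2 * e2
  have e4 : (x ^ 2 + y ^ 2) * (A ^ 2 / 4 + k ^ 2) ≤ (A ^ 2 / 4 + k ^ 2) * (4 * y ^ 2) := by
    have := mul_le_mul_of_nonneg_left hR (by positivity : 0 ≤ x ^ 2 + y ^ 2)
    linarith
  have e5 : x ^ 2 + y ^ 2 ≤ 4 * y ^ 2 := by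
    rw [mul_comm] at e4
    exact le_of_mul_le_mul_left e4 (by positivity)
  have e6 : C ^ 2 ≤ 3 / 4 := by
    have h4 : (A ^ 2 * (x ^ 2 + y ^ 2)) * C ^ 2 = A ^ 2 * x ^ 2 := by
      have : (dist a b * dist c b * C) ^ 2 = (A * x) ^ 2 := by rw [hcos]
      rw [mul_pow, mul_pow, hab2, hcb2] at this
      linear_combination this
    have h5 : 0 < x ^ 2 + y ^ 2 := by
      have : 0 < dist c b ^ 2 := by positivity
      rw [hcb2] at this; linarith
    have h6 : A ^ 2 * x ^ 2 ≤ (A ^ 2 * (x ^ 2 + y ^ 2)) * (3 / 4) := by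
      have := mul_le_mul_of_nonneg_left e5 (sq_nonneg A)
      linarith
    rw [← h4] at h6
    exact le_of_mul_le_mul_left h6 (by positivity)
  by_contra! hlt
  have h7 := Real.cos_lt_cos_of_nonneg_of_le_pi (EuclideanGeometry.angle_nonneg a b c)
    (by linarith [Real.pi_pos]) hlt
  rw [Real.cos_pi_div_six, ← hC] at h7
  have h8 : Real.sqrt 3 ^ 2 = 3 := Real.sq_sqrt (by norm_num)
  nlinarith [Real.sqrt_nonneg 3]

/-! ### Triangles in a triangulation of the plane -/

/-- `abc` is a nondegenerate triangle of `K`. -/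
def IsTri (K : PlaneComplex) (a b c : Plane) : Prop :=
  crossArea a b c ≠ 0 ∧ ∃ s ∈ K.faces, (s : Set Plane) = {a, b, c}

theorem IsTri.rotate {K : PlaneComplex} {a b c : Plane} (h : IsTri K a b c) : IsTri K b c a := by
  obtain ⟨h0, s, hs, e⟩ := h
  refine ⟨crossArea_ne_zero_rotate h0, s, hs, ?_⟩
  rw [e]
  ext; simp; tauto

theorem IsTri.swap {K : PlaneComplex} {a b c : Plane} (h : IsTri K a b c) : IsTri K b a c := by
  obtain ⟨h0, s, hs, e⟩ := h
  exact ⟨crossArea_ne_zero_swap h0, s, hs, by rw [e, Set.insert_comm]⟩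

theorem hasTriangle_iff {K : PlaneComplex} {a b c : Plane} :
    HasTriangle K a b c ↔ IsTri K a b c := by
  constructor
  · rintro ⟨hab, hbc, hac, s, hs, e⟩
    exact ⟨crossArea_of_affineIndependent hab hbc hac e (K.indep hs), s, hs, e⟩
  · rintro ⟨h, hs⟩
    exact ⟨crossArea_ne h, crossArea_ne (crossArea_ne_zero_rotate h),
      (crossArea_ne (crossArea_ne_zero_rotate (crossArea_ne_zero_rotate h))).symm, hs⟩

theorem IsTri.hull_inter {K : PlaneComplex} {a b c : Plane} (h : IsTri K a b c) {t : Finset Plane}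
    (ht : t ∈ K.faces) {x : Plane} (hx : x ∈ convexHull ℝ {a, b, c})
    (hxt : x ∈ convexHull ℝ (t : Set Plane)) :
    x ∈ convexHull ℝ ({a, b, c} ∩ (t : Set Plane)) := by
  obtain ⟨-, s, hs, e⟩ := h
  rw [← e] at hx ⊢
  exact K.inter_subset_convexHull hs ht ⟨hx, hxt⟩

theorem IsTri.mem_of_mem_hull {K : PlaneComplex} {a b c : Plane} (h : IsTri K a b c) {v : Plane}
    (hv : v ∈ K.vertices) (hx : v ∈ convexHull ℝ {a, b, c}) : v ∈ ({a, b, c} : Set Plane) := by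
  obtain ⟨-, s, hs, e⟩ := h
  rw [← e] at hx ⊢
  exact (K.vertex_mem_convexHull_iff hv hs).mp hx

theorem IsTri.mem_vertices {K : PlaneComplex} {a b c : Plane} (h : IsTri K a b c) :
    a ∈ K.vertices := by
  obtain ⟨-, s, hs, e⟩ := h
  refine K.down_closed hs (Finset.singleton_subset_iff.mpr ?_) (Finset.singleton_nonempty a)
  rw [← Finset.mem_coe, e]; simp

/-- From every point one can move a little in every direction within some face. -/
theorem exists_face_dir {K : PlaneComplex}
    (hlf : LocallyFinite fun s : K.faces => convexHull ℝ ((s : Finset Plane) : Set Plane))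
    (huniv : K.space = Set.univ) (x v : Plane) {δ : ℝ} (hδ : 0 < δ) :
    ∃ s ∈ K.faces, ∃ ε, 0 < ε ∧ ε < δ ∧ x ∈ convexHull ℝ (s : Set Plane) ∧
      x + ε • v ∈ convexHull ℝ (s : Set Plane) := by
  -- Since the hulls are closed and locally finite, every face that meets a small enough
  -- neighbourhood of `x` contains `x`.
  have h1 := hlf.eventually_subset (fun s => (s : Finset Plane).finite_toSet.isClosed_convexHull ℝ) x
  have h2 : Filter.Tendsto (fun ε : ℝ => x + ε • v) (nhdsWithin 0 (Set.Ioi 0)) (nhds x) := by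
    have : Continuous (fun ε : ℝ => x + ε • v) := by fun_prop
    have := (this.tendsto 0).mono_left (nhdsWithin_le_nhds (s := Set.Ioi 0))
    simpa using this
  have h3 : ∀ᶠ ε : ℝ in nhdsWithin 0 (Set.Ioi 0), 0 < ε ∧ ε < δ := by
    have := Ioo_mem_nhdsGT hδ
    exact this
  obtain ⟨ε, h4, h5, h6⟩ := ((h2.eventually h1).and h3).exists
  have : x + ε • v ∈ K.space := huniv ▸ Set.mem_univ _
  obtain ⟨s, hs, hxs⟩ := K.mem_space_iff.mp this
  exact ⟨s, hs, ε, h5, h6, h4 (a := ⟨s, hs⟩) hxs, hxs⟩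

theorem isAff_crossArea (a b : Plane) : IsAff (crossArea a b) :=
  ⟨-(b 1 - a 1), b 0 - a 0, (b 1 - a 1) * a 0 - (b 0 - a 0) * a 1, fun x => by
    unfold crossArea; ring⟩

theorem exists_crossArea_ne_zero {a b : Plane} (h : a ≠ b) : ∃ c, crossArea a b c ≠ 0 := by
  refine ⟨!₂[a 0 - (b 1 - a 1), a 1 + (b 0 - a 0)], fun h0 => h ?_⟩
  unfold crossArea at h0
  simp at h0
  have e : (b 0 - a 0) ^ 2 + (b 1 - a 1) ^ 2 = 0 := by linear_combination h0
  refine plane_ext ?_ ?_ <;>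
  · nlinarith [sq_nonneg (b 0 - a 0), sq_nonneg (b 1 - a 1)]

/-- Moving off the line `ab` from the midpoint leads into a face. It contains `a` and `b`, since
faces meet in common faces, and has a vertex off the line, since otherwise its hull would stay on
the line. -/
theorem exists_isTri_of_pair {K : PlaneComplex}
    (hlf : LocallyFinite fun s : K.faces => convexHull ℝ ((s : Finset Plane) : Set Plane))
    (huniv : K.space = Set.univ) {s : Finset Plane} (hs : s ∈ K.faces) {a b : Plane} (hab : a ≠ b)
    (e : (s : Set Plane) = {a, b}) : ∃ c, IsTri K a b c := by
  classical
  obtain ⟨c, hc⟩ := exists_crossArea_ne_zero hab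
  obtain ⟨t, ht, ε, hε, -, h1, h2⟩ :=
    exists_face_dir hlf huniv (midpoint ℝ a b) (c - midpoint ℝ a b) one_pos
  have haff := isAff_crossArea a b
  have ca : crossArea a b a = 0 := by unfold crossArea; ring
  have cb : crossArea a b b = 0 := by unfold crossArea; ring
  have hm : midpoint ℝ a b ∈ convexHull ℝ (s : Set Plane) := by
    rw [e, convexHull_pair]; exact midpoint_mem_segment a b
  have h3 := K.inter_subset_convexHull hs ht ⟨hm, h1⟩
  have hat : a ∈ t := by
    by_contra h
    have : (s : Set Plane) ∩ t ⊆ {b} := by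
      rw [e]; rintro x ⟨rfl | rfl, hx⟩
      · exact absurd hx h
      · rfl
    have := convexHull_mono this h3
    rw [convexHull_singleton, Set.mem_singleton_iff, midpoint_eq_right_iff] at this
    exact hab this
  have hbt : b ∈ t := by
    by_contra h
    have : (s : Set Plane) ∩ t ⊆ {a} := by
      rw [e]; rintro x ⟨rfl | rfl, hx⟩
      · rfl
      · exact absurd hx h
    have := convexHull_mono this h3
    rw [convexHull_singleton, Set.mem_singleton_iff, midpoint_eq_left_iff] at this
    exact hab this
  have : ∃ d ∈ t, crossArea a b d ≠ 0 := by
    by_contra! h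
    have k1 := mem_convexHull_of_isAff haff (fun v hv => (h v hv).ge) h2
    have k2 := mem_convexHull_of_isAff (haff.const_mul (-1))
      (fun v hv => by simp [h v hv]) h2
    have k3 := haff.add_smul_sub (midpoint ℝ a b) c ε
    rw [haff.midpoint, ca, cb] at k3
    have : ε * crossArea a b c = 0 := by linarith
    exact (mul_ne_zero hε.ne' hc) this
  obtain ⟨d, hd, hd0⟩ := this
  refine ⟨d, hd0, {a, b, d}, K.down_closed ht ?_ (by simp), by simp⟩
  intro x hx
  simp only [Finset.mem_insert, Finset.mem_singleton] at hx
  rcases hx with rfl | rfl | rfl <;> assumption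

/-- Every face of a triangulation of the plane is contained in a triangle. -/
theorem exists_isTri_of_face {K : PlaneComplex}
    (hlf : LocallyFinite fun s : K.faces => convexHull ℝ ((s : Finset Plane) : Set Plane))
    (huniv : K.space = Set.univ) {s : Finset Plane} (hs : s ∈ K.faces) :
    ∃ a b c, IsTri K a b c ∧ (s : Set Plane) ⊆ {a, b, c} := by
  classical
  have hcard : s.card ≤ 3 := by
    have h := (K.indep hs).card_le_finrank_succ
    have h2 := Submodule.finrank_le (vectorSpan ℝ (Set.range ((↑) : s → Plane)))
    rw [finrank_euclideanSpace_fin] at h2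
    rw [Fintype.card_coe] at h
    omega
  have hpos := (K.nonempty_of_mem_faces hs).card_pos
  have pair : ∀ a b : Plane, a ≠ b → {a, b} ∈ K.faces → ∃ c, IsTri K a b c := fun a b hab h =>
    exists_isTri_of_pair hlf huniv h hab (by simp)
  have h123 : s.card = 1 ∨ s.card = 2 ∨ s.card = 3 := by omega
  rcases h123 with h | h | h
  · obtain ⟨a, rfl⟩ := Finset.card_eq_one.mp h
    obtain ⟨b, hb⟩ := exists_ne (0 : Plane)
    obtain ⟨t, ht, ε, hε, -, h1, h2⟩ := exists_face_dir hlf huniv a b one_pos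
    have hat : a ∈ t := (K.vertex_mem_convexHull_iff hs ht).mp h1
    have : ∃ d ∈ t, d ≠ a := by
      by_contra! hh
      have : (t : Set Plane) ⊆ {a} := fun x hx => hh x hx
      have := convexHull_mono this h2
      rw [convexHull_singleton, Set.mem_singleton_iff, add_eq_left, smul_eq_zero] at this
      exact this.elim hε.ne' hb
    obtain ⟨d, hd, hda⟩ := this
    obtain ⟨c, hc⟩ := pair a d hda.symm (K.down_closed ht (by
      intro x hx
      simp only [Finset.mem_insert, Finset.mem_singleton] at hx
      rcases hx with rfl | rfl <;> assumption) (by simp))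
    exact ⟨a, d, c, hc, by simp⟩
  · obtain ⟨a, b, hab, rfl⟩ := Finset.card_eq_two.mp h
    obtain ⟨c, hc⟩ := pair a b hab hs
    exact ⟨a, b, c, hc, by simp [Set.insert_subset_iff]⟩
  · obtain ⟨a, b, c, hab, hac, hbc, rfl⟩ := Finset.card_eq_three.mp h
    exact ⟨a, b, c, hasTriangle_iff.mp ⟨hab, hbc, hac, _, hs, by simp⟩, by simp⟩

/-- Two triangles with a common edge lie on opposite sides of it. -/
theorem IsTri.opposite {K : PlaneComplex} {a b x y : Plane} (hx : IsTri K a b x)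
    (hy : IsTri K a b y) (hxy : x ≠ y) : crossArea a b x * crossArea a b y < 0 := by
  by_contra! hcon
  have hx0 := hx.1
  have hy0 := hy.1
  have hx1 := crossArea_ne_zero_rotate hx0
  have hx2 := crossArea_ne_zero_rotate hx1
  have hμ : 0 < bary x a b y := by
    rw [bary, ← crossArea_rotate x a b, ← crossArea_rotate y a b]
    have : 0 < crossArea a b x * crossArea a b y := hcon.lt_of_ne (mul_ne_zero hx0 hy0).symm
    rw [← mul_div_mul_left _ _ hx0]
    exact div_pos this (mul_self_pos.mpr hx0)
  set m := midpoint ℝ a b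
  set A := bary a b x y with hA
  set B := bary b x a y with hB
  -- If `x` and `y` were on the same side, a point slightly beyond the midpoint towards `y` would
  -- lie in both triangles but off `ab`. This `ε` changes the coordinates at `a` and `b`, which are
  -- `1/2` at the midpoint, by at most `1/2`.
  set ε := 1 / (2 * (1 + |A| + |B|)) with hε
  have hpos : 0 < 1 + |A| + |B| := by positivity
  have ε0 : 0 < ε := by positivity
  have ε1 : ε ≤ 1 := by
    rw [hε, div_le_one (by positivity)]
    linarith [abs_nonneg A, abs_nonneg B]
  have εb : ε * (1 + |A| + |B|) = 1 / 2 := by rw [hε]; field_simp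
  have bound : ∀ t : ℝ, |t| ≤ |A| + |B| → 0 ≤ 1 / 2 + ε * (t - 1 / 2) := by
    intro t ht
    have := neg_abs_le t
    nlinarith
  set z := m + ε • (y - m) with hz
  have ma : bary a b x m = 1 / 2 := by
    rw [(isAff_bary a b x).midpoint, bary_self hx0, bary_fst]; norm_num
  have mb : bary b x a m = 1 / 2 := by
    rw [(isAff_bary b x a).midpoint, bary_self hx1, bary_snd]; norm_num
  have mx : bary x a b m = 0 := by
    rw [(isAff_bary x a b).midpoint, bary_fst, bary_snd]; norm_num
  have zx : bary x a b z = ε * bary x a b y := by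
    rw [hz, (isAff_bary x a b).add_smul_sub, mx]; ring
  have h1 : z ∈ convexHull ℝ {a, b, x} := by
    rw [mem_convexHull_triple hx0]
    refine ⟨?_, ?_, ?_⟩
    · rw [hz, (isAff_bary a b x).add_smul_sub, ma]
      exact bound _ (by linarith [abs_nonneg B])
    · rw [hz, (isAff_bary b x a).add_smul_sub, mb]
      exact bound _ (by linarith [abs_nonneg A])
    · rw [zx]; positivity
  have h2 : z ∈ convexHull ℝ {a, b, y} := by
    have hm : m ∈ convexHull ℝ {a, b, y} :=
      convexHull_mono (by simp [Set.insert_subset_iff]) (by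
        rw [convexHull_pair]; exact midpoint_mem_segment a b : m ∈ convexHull ℝ {a, b})
    exact (convex_convexHull ℝ _).add_smul_sub_mem hm
      (subset_convexHull ℝ _ (by simp)) ⟨ε0.le, ε1⟩
  obtain ⟨-, t, ht, e⟩ := hy
  have h3 := hx.hull_inter ht h1 (by rwa [e])
  have h4 := mem_convexHull_of_isAff ((isAff_bary x a b).const_mul (-1)) (by
    rintro v ⟨hv, hv'⟩
    rw [e] at hv'
    rcases hv with rfl | rfl | rfl
    · simp [bary_fst]
    · simp [bary_snd]
    · rcases hv' with rfl | rfl | rfl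
      · simp [bary_fst]
      · simp [bary_snd]
      · exact absurd rfl hxy) h3
  rw [zx] at h4
  nlinarith [mul_pos ε0 hμ]

theorem IsTri.bary_neg {K : PlaneComplex} {a b x y : Plane} (hx : IsTri K a b x)
    (hy : IsTri K a b y) (hxy : x ≠ y) : bary x a b y < 0 := by
  have h := hx.opposite hy hxy
  have hx0 := hx.1
  rw [bary, ← crossArea_rotate x a b, ← crossArea_rotate y a b, ← mul_div_mul_left _ _ hx0]
  exact div_neg_of_neg_of_pos h (mul_self_pos.mpr hx0)

theorem IsTri.exists_third {K : PlaneComplex} {a b d e f : Plane} (h : IsTri K d e f)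
    (hab : a ≠ b) (ha : a ∈ ({d, e, f} : Set Plane)) (hb : b ∈ ({d, e, f} : Set Plane)) :
    ∃ y, IsTri K a b y ∧ ({d, e, f} : Set Plane) = {a, b, y} := by
  rcases ha with rfl | rfl | rfl <;> rcases hb with rfl | rfl | rfl
  · exact absurd rfl hab
  · exact ⟨f, h, rfl⟩
  · exact ⟨e, h.rotate.rotate.swap, by ext; simp; tauto⟩
  · exact ⟨f, h.swap, by ext; simp; tauto⟩
  · exact absurd rfl hab
  · exact ⟨d, h.rotate, by ext; simp; tauto⟩
  · exact ⟨e, h.rotate.rotate, by ext; simp; tauto⟩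
  · exact ⟨d, h.rotate.swap, by ext; simp; tauto⟩
  · exact absurd rfl hab

/-! ### Delaunay's lemma -/

/-- Crossing an edge that satisfies the local Delaunay condition does not increase the power of a
point beyond the edge. -/
theorem IsTri.power_le_of_local {K : PlaneComplex} {a b x y m : Plane} {S S' : Sphere Plane}
    (hx : IsTri K a b x) (hy : IsTri K a b y) (hxy : x ≠ y) (ha : a ∈ S) (hb : b ∈ S) (hxS : x ∈ S)
    (ha' : a ∈ S') (hb' : b ∈ S') (hy' : y ∈ S') (hloc : 0 ≤ S.power y ∨ 0 ≤ S'.power x)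
    (hm : bary x a b m ≤ 0) : S'.power m ≤ S.power m := by
  -- The difference of powers vanishes at `a` and `b`, so it is `S'.power x` times the barycentric
  -- coordinate at `x`. That coordinate is negative at `y`, so either alternative in `hloc` yields
  -- `0 ≤ S'.power x`.
  have h := isAff_power_sub S' S
  have hk := h.eq_bary (a := x) (b := a) (c := b) hx.rotate.rotate.1
  have hneg := hx.bary_neg hy hxy
  have key : 0 ≤ S'.power x := by
    rcases hloc with h1 | h1
    · have h2 := hk y
      simp only [power_of_mem ha, power_of_mem hb, power_of_mem hxS, power_of_mem ha',
        power_of_mem hb', power_of_mem hy'] at h2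
      by_contra! h3
      nlinarith [mul_pos_of_neg_of_neg hneg h3]
    · exact h1
  have h2 := hk m
  simp only [power_of_mem ha, power_of_mem hb, power_of_mem hxS, power_of_mem ha',
    power_of_mem hb'] at h2
  nlinarith [mul_nonneg (neg_nonneg.mpr hm) key]

theorem countable_vertices {K : PlaneComplex}
    (hlf : LocallyFinite fun s : K.faces => convexHull ℝ ((s : Finset Plane) : Set Plane)) :
    K.vertices.Countable := by
  have h := hlf.countable_univ (fun s => by
    rw [convexHull_nonempty_iff]; exact K.nonempty_of_mem_faces s.2)
  rw [K.vertices_eq]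
  refine Set.Countable.biUnion ?_ (fun s _ => s.countable_toSet)
  have := h.image (fun s : K.faces => (s : Finset Plane))
  simpa using this

theorem affineSpan_pair_ne_top (w m : Plane) : line[ℝ, w, m] ≠ ⊤ := by
  intro h
  have h1 := collinear_iff_finrank_le_one.mp (collinear_pair ℝ w m)
  rw [← direction_affineSpan, h, AffineSubspace.direction_top, finrank_top,
    finrank_euclideanSpace_fin] at h1
  omega

/-- A triangle has a point on no line through a given point and one of countably many others. -/
theorem exists_generic_point {a b c : Plane} (h : crossArea a b c ≠ 0) {V : Set Plane}
    (hV : V.Countable) (m : Plane) :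
    ∃ x ∈ convexHull ℝ {a, b, c}, ∀ w ∈ V, x ∉ line[ℝ, w, m] := by
  set U : Set Plane := {x | 0 < bary a b c x} ∩ {x | 0 < bary b c a x} ∩ {x | 0 < bary c a b x}
    with hU
  have hopen : IsOpen U :=
    ((isOpen_lt continuous_const (isAff_bary a b c).continuous).inter
      (isOpen_lt continuous_const (isAff_bary b c a).continuous)).inter
      (isOpen_lt continuous_const (isAff_bary c a b).continuous)
  have hne : U.Nonempty := by
    have h1 := crossArea_ne_zero_rotate h
    have h2 := crossArea_ne_zero_rotate h1
    have e : ∀ g : Plane → ℝ, IsAff g →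
        g ((1 / 3 : ℝ) • a + (1 / 3 : ℝ) • b + (1 / 3 : ℝ) • c) = (g a + g b + g c) / 3 := by
      intro g hg
      rw [hg.comb3 (by norm_num)]; ring
    refine ⟨(1 / 3 : ℝ) • a + (1 / 3 : ℝ) • b + (1 / 3 : ℝ) • c, ⟨?_, ?_⟩, ?_⟩
    · change 0 < bary a b c _
      rw [e _ (isAff_bary _ _ _), bary_self h, bary_fst, bary_snd]; norm_num
    · change 0 < bary b c a _
      rw [e _ (isAff_bary _ _ _), bary_self h1, bary_fst, bary_snd]; norm_num
    · change 0 < bary c a b _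
      rw [e _ (isAff_bary _ _ _), bary_self h2, bary_fst, bary_snd]; norm_num
  have hpos := hopen.measure_pos MeasureTheory.volume hne
  have hnull : MeasureTheory.volume (⋃ w ∈ V, (line[ℝ, w, m] : Set Plane)) = 0 :=
    (MeasureTheory.measure_biUnion_null_iff hV).mpr fun w _ =>
      MeasureTheory.Measure.addHaar_affineSubspace _ _ (affineSpan_pair_ne_top w m)
  have hns : ¬ U ⊆ ⋃ w ∈ V, (line[ℝ, w, m] : Set Plane) := fun hs =>
    hpos.ne' (MeasureTheory.measure_mono_null hs hnull)
  obtain ⟨x, hx, hx'⟩ := Set.not_subset.mp hns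
  refine ⟨x, (mem_convexHull_triple h x).mpr ⟨?_, ?_, ?_⟩, fun w hw hh => hx' ?_⟩
  · exact le_of_lt hx.1.1
  · exact le_of_lt hx.1.2
  · exact le_of_lt hx.2
  · exact Set.mem_biUnion hw hh

/-- **Delaunay's lemma**: a triangulation of the plane that satisfies the empty circle condition
across every edge satisfies it globally. -/
theorem power_nonneg_of_local {K : PlaneComplex}
    (hlf : LocallyFinite fun s : K.faces => convexHull ℝ ((s : Finset Plane) : Set Plane))
    (huniv : K.space = Set.univ)
    (hloc : ∀ a b x y, IsTri K a b x → IsTri K a b y → x ≠ y → ∀ S S' : Sphere Plane,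
      a ∈ S → b ∈ S → x ∈ S → a ∈ S' → b ∈ S' → y ∈ S' → 0 ≤ S.power y ∨ 0 ≤ S'.power x)
    {a b c : Plane} (h : IsTri K a b c) {S : Sphere Plane} (ha : a ∈ S) (hb : b ∈ S) (hc : c ∈ S)
    {m : Plane} (hm : m ∈ K.vertices) : 0 ≤ S.power m := by
  obtain ⟨x₀, hx₀, hgen⟩ := exists_generic_point h.1 (countable_vertices hlf) m
  -- Walking from `x₀` straight to `m`, the power of `m` should not increase from triangle to
  -- triangle and ends at `0`. Instead of enumerating the triangles crossed, the proof takes the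
  -- last time at which the segment is in a good triangle; it exists because `Z` is closed.
  set Good : K.faces → Prop := fun s => ∃ a b c, ∃ S' : Sphere Plane, IsTri K a b c ∧
    a ∈ S' ∧ b ∈ S' ∧ c ∈ S' ∧ S'.power m ≤ S.power m ∧
      ((s : Finset Plane) : Set Plane) = {a, b, c} with hGood
  set Z : Set Plane := ⋃ s : {s : K.faces // Good s}, convexHull ℝ ((s : Finset Plane) : Set Plane)
    with hZ
  have Zclosed : IsClosed Z :=
    (hlf.comp_injective Subtype.val_injective).isClosed_iUnion fun s =>
      (s.1 : Finset Plane).finite_toSet.isClosed_convexHull ℝ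
  have memZ : ∀ {a b c : Plane} {S' : Sphere Plane}, IsTri K a b c → a ∈ S' → b ∈ S' → c ∈ S' →
      S'.power m ≤ S.power m → convexHull ℝ {a, b, c} ⊆ Z := by
    intro a b c S' ht ha hb hc hp x hx
    have ht' := ht
    obtain ⟨-, s, hs, e⟩ := ht'
    rw [← e] at hx
    exact Set.mem_iUnion.mpr ⟨⟨⟨s, hs⟩, a, b, c, S', ht, ha, hb, hc, hp, e⟩, hx⟩
  set γ : ℝ → Plane := fun τ => x₀ + τ • (m - x₀) with hγ
  have γcont : Continuous γ := by fun_prop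
  have hcomp : IsCompact (Set.Icc 0 1 ∩ γ ⁻¹' Z) :=
    isCompact_Icc.inter_right (Zclosed.preimage γcont)
  have hne : (Set.Icc 0 1 ∩ γ ⁻¹' Z).Nonempty := by
    refine ⟨0, ⟨le_rfl, zero_le_one⟩, ?_⟩
    have : γ 0 = x₀ := by simp [hγ]
    rw [Set.mem_preimage, this]
    exact memZ h ha hb hc le_rfl hx₀
  obtain ⟨τ, ⟨⟨hτ0, hτ1⟩, hτZ⟩, hmax⟩ := hcomp.exists_isGreatest hne
  obtain ⟨⟨s, a', b', c', S', ht, ha', hb', hc', hp, e⟩, hz⟩ := Set.mem_iUnion.mp hτZ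
  simp only [e] at hz
  rcases hτ1.eq_or_lt with rfl | hτ1
  · have e1 : γ 1 = m := by simp [hγ]
    rw [e1] at hz
    have : S'.power m = 0 := by
      rcases ht.mem_of_mem_hull hm hz with h | h | h <;> rw [h] <;> exact power_of_mem ‹_›
    linarith
  exfalso
  set z := γ τ with hzdef
  -- Genericity of `x₀`: a vertex `z` before `m` on the segment would put `x₀` on the line through
  -- `z` and `m`. So triangles are only left through edges.
  have hzv : z ∉ K.vertices := by
    intro hzv
    apply hgen z hzv
    have h1 : 1 - τ ≠ 0 := by linarith
    have e1 : x₀ = AffineMap.lineMap m z (1 / (1 - τ)) := by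
      rw [AffineMap.lineMap_apply_module', hzdef]
      apply plane_ext <;>
      · simp only [hγ, PiLp.add_apply, PiLp.sub_apply, PiLp.smul_apply, smul_eq_mul]
        field_simp
        ring
    rw [Set.pair_comm, e1]
    exact AffineMap.lineMap_mem_affineSpan_pair _ _ _
  -- The triangle `dfg` into which the segment continues after `z`. If it is good, this contradicts
  -- the maximality of `τ`.
  obtain ⟨t, htf, ε, hε, hε1, h1, h2⟩ := exists_face_dir hlf huniv z (m - z) one_pos
  obtain ⟨d, f, g, hdfg, hsub⟩ := exists_isTri_of_face hlf huniv htf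
  replace h1 := convexHull_mono hsub h1
  replace h2 := convexHull_mono hsub h2
  have hnext : z + ε • (m - z) = γ (τ + ε * (1 - τ)) := by
    rw [hzdef]
    apply plane_ext <;>
    · simp only [hγ, PiLp.add_apply, PiLp.sub_apply, PiLp.smul_apply, smul_eq_mul]
      ring
  have contra : ∀ {S'' : Sphere Plane}, d ∈ S'' → f ∈ S'' → g ∈ S'' →
      S''.power m ≤ S.power m → False := by
    intro S'' hd hf hg hp'
    have h3 := memZ hdfg hd hf hg hp' h2
    rw [hnext] at h3
    have h4 : 0 < ε * (1 - τ) := mul_pos hε (by linarith)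
    have h5 := hmax ⟨⟨by linarith, by nlinarith⟩, h3⟩
    linarith
  have hI : z ∈ convexHull ℝ (({a', b', c'} : Set Plane) ∩ {d, f, g}) := by
    obtain ⟨-, u, hu, eu⟩ := hdfg
    rw [← eu] at h1 ⊢
    exact ht.hull_inter hu hz h1
  have step : ∀ {p q r : Plane}, IsTri K p q r → p ∈ S' → q ∈ S' → r ∈ S' →
      z ∈ convexHull ℝ (({p, q, r} : Set Plane) ∩ {d, f, g}) →
      p ∈ ({d, f, g} : Set Plane) → q ∈ ({d, f, g} : Set Plane) → False := by
    intro p q r hpqr hpS hqS hrS hI hpd hqd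
    obtain ⟨y, hy, ey⟩ := hdfg.exists_third (crossArea_ne hpqr.1) hpd hqd
    by_cases hry : r = y
    · subst hry
      have hS : ∀ v ∈ ({d, f, g} : Set Plane), v ∈ S' := by
        rw [ey]; rintro v (rfl | rfl | rfl) <;> assumption
      exact contra (hS d (by simp)) (hS f (by simp)) (hS g (by simp)) hp
    · obtain ⟨S'', hpS'', hqS'', hyS''⟩ := exists_circumsphere hy.1
      have hS : ∀ v ∈ ({d, f, g} : Set Plane), v ∈ S'' := by
        rw [ey]; rintro v (rfl | rfl | rfl) <;> assumption
      have haff := isAff_bary r p q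
      have hneg := hpqr.bary_neg hy hry
      have hz0 : 0 ≤ bary r p q z := mem_convexHull_of_isAff haff (by
        rintro v ⟨hv, -⟩
        rcases hv with rfl | rfl | rfl
        · rw [bary_fst]
        · rw [bary_snd]
        · rw [bary_self hpqr.rotate.rotate.1]; norm_num) hI
      have h3 := mem_convexHull_of_isAff (haff.const_mul (-1)) (by
        rw [ey]
        rintro v (rfl | rfl | rfl)
        · simp [bary_fst]
        · simp [bary_snd]
        · linarith) h2
      rw [haff.add_smul_sub] at h3
      -- The coordinate at `r` is affine along the segment, nonnegative at `z` and nonpositive a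
      -- little later, so it is nonpositive at `m`.
      have hm0 : bary r p q m ≤ 0 := by
        by_contra! h4
        have : ε * bary r p q z ≤ 1 * bary r p q z := mul_le_mul_of_nonneg_right hε1.le hz0
        nlinarith [mul_pos hε h4]
      exact contra (hS d (by simp)) (hS f (by simp)) (hS g (by simp))
        ((hpqr.power_le_of_local hy hry hpS hqS hrS hpS'' hqS'' hyS''
          (hloc p q r y hpqr hy hry S' S'' hpS hqS hrS hpS'' hqS'' hyS'') hm0).trans hp)
  have single : ∀ p : Plane, p ∈ K.vertices →
      ({a', b', c'} : Set Plane) ∩ {d, f, g} ⊆ {p} → False := by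
    intro p hpv hs
    have := convexHull_mono hs hI
    rw [convexHull_singleton, Set.mem_singleton_iff] at this
    exact hzv (this ▸ hpv)
  by_cases hA : a' ∈ ({d, f, g} : Set Plane)
  · by_cases hB : b' ∈ ({d, f, g} : Set Plane)
    · exact step ht ha' hb' hc' hI hA hB
    by_cases hC : c' ∈ ({d, f, g} : Set Plane)
    · refine step ht.rotate.rotate hc' ha' hb' ?_ hC hA
      have : ({c', a', b'} : Set Plane) = {a', b', c'} := by ext; simp; tauto
      rwa [this]
    · apply single a' ht.mem_vertices
      rintro v ⟨rfl | rfl | rfl, hv⟩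
      · rfl
      · exact absurd hv hB
      · exact absurd hv hC
  · by_cases hC : c' ∈ ({d, f, g} : Set Plane)
    · by_cases hB : b' ∈ ({d, f, g} : Set Plane)
      · refine step ht.rotate hb' hc' ha' ?_ hB hC
        have : ({b', c', a'} : Set Plane) = {a', b', c'} := by ext; simp; tauto
        rwa [this]
      · apply single c' ht.rotate.rotate.mem_vertices
        rintro v ⟨rfl | rfl | rfl, hv⟩
        · exact absurd hv hA
        · exact absurd hv hB
        · rfl
    · apply single b' ht.rotate.mem_vertices
      rintro v ⟨rfl | rfl | rfl, hv⟩
      · exact absurd hv hA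
      · rfl
      · exact absurd hv hC

/-! ### Separation of vertices and local finiteness -/

/-- The vertices of a Delaunay triangulation of the plane are as far apart as its edges are
long. -/
theorem etaSeparated_vertices {K : PlaneComplex}
    (hlf : LocallyFinite fun s : K.faces => convexHull ℝ ((s : Finset Plane) : Set Plane))
    (huniv : K.space = Set.univ)
    (hemp : ∀ a b c, IsTri K a b c → ∀ S : Sphere Plane, a ∈ S → b ∈ S → c ∈ S →
      ∀ p ∈ K.vertices, 0 ≤ S.power p)
    {δ : ℝ} (hδ : 0 ≤ δ) (hedge : ∀ a b c, IsTri K a b c → δ ≤ dist a b) :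
    EtaSeparated δ K.vertices := by
  intro x hx y hy hxy
  -- The triangle at `x` into which the segment to `y` starts: `y` lies in its cone at `x`, so the
  -- coordinates at the other two vertices are nonnegative.
  obtain ⟨t, htf, ε, hε, hε1, h1, h2⟩ := exists_face_dir hlf huniv x (y - x) one_pos
  obtain ⟨d, f, g, hdfg, hsub⟩ := exists_isTri_of_face hlf huniv htf
  replace h1 := convexHull_mono hsub h1
  replace h2 := convexHull_mono hsub h2
  obtain ⟨b, c, ht, e⟩ : ∃ b c, IsTri K x b c ∧ ({d, f, g} : Set Plane) = {x, b, c} := by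
    rcases hdfg.mem_of_mem_hull hx h1 with rfl | rfl | rfl
    · exact ⟨_, _, hdfg, rfl⟩
    · exact ⟨_, _, hdfg.rotate, by ext; simp; tauto⟩
    · exact ⟨_, _, hdfg.rotate.rotate, by ext; simp; tauto⟩
  rw [e, mem_convexHull_triple ht.1] at h2
  obtain ⟨-, hb, hc⟩ := h2
  rw [(isAff_bary b c x).add_smul_sub, bary_snd, zero_add, sub_zero] at hb
  rw [(isAff_bary c x b).add_smul_sub, bary_fst, zero_add, sub_zero] at hc
  replace hb := nonneg_of_mul_nonneg_right hb hε
  replace hc := nonneg_of_mul_nonneg_right hc hε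
  have dxb := hedge _ _ _ ht
  have dxc : δ ≤ dist x c := hedge _ _ _ ht.rotate.rotate.swap
  by_cases ha : 0 ≤ bary x b c y
  · have hmem := ht.mem_of_mem_hull hy ((mem_convexHull_triple ht.1 y).mpr ⟨ha, hb, hc⟩)
    rcases hmem with rfl | rfl | rfl
    · exact absurd rfl hxy
    · exact dxb
    · exact dxc
  push Not at ha
  obtain ⟨S, hxS, hbS, hcS⟩ := exists_circumsphere ht.1
  have hsum := bary_sum ht.1 y
  have hrep := bary_repr ht.1 y
  set α := bary x b c y
  set β := bary b c x y
  set κ := bary c x b y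
  have hp := hemp _ _ _ ht S hxS hbS hcS y hy
  -- Together these give `|xy|² = β |xb|² + κ |xc|² + S.power y`. The power is nonnegative, and `β +
  -- κ = 1 - α > 1`.
  have h3 := power_comb3 S hsum x b c
  have h4 := dist_sq_comb3 x hsum x b c
  rw [← hrep] at h3 h4
  rw [power_of_mem hxS, power_of_mem hbS, power_of_mem hcS] at h3
  rw [dist_self, dist_comm b x] at h4
  have d1 : δ ^ 2 ≤ dist x b ^ 2 := pow_le_pow_left₀ hδ dxb 2
  have d2 : δ ^ 2 ≤ dist c x ^ 2 := by
    rw [dist_comm]; exact pow_le_pow_left₀ hδ dxc 2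
  rw [dist_comm]
  apply le_of_sq_le_sq _ dist_nonneg
  have e1 := mul_le_mul_of_nonneg_left d1 hb
  have e2 := mul_le_mul_of_nonneg_left d2 hc
  have e3 : δ ^ 2 * 1 ≤ δ ^ 2 * (β + κ) := mul_le_mul_of_nonneg_left (by linarith) (sq_nonneg δ)
  linarith

theorem finite_of_etaSeparated {η : ℝ} (hη : 0 < η) {V : Set Plane} (hV : EtaSeparated η V)
    (x : Plane) (r : ℝ) : (V ∩ Metric.closedBall x r).Finite := by
  obtain ⟨t, -, htfin, hcov⟩ :=
    finite_cover_balls_of_compact (isCompact_closedBall x r) (half_pos hη)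
  have : ∀ v ∈ V ∩ Metric.closedBall x r, ∃ y ∈ t, dist v y < η / 2 := by
    intro v hv
    simpa using hcov hv.2
  choose! φ hφ hφd using this
  apply Set.Finite.of_finite_image (f := φ) (htfin.subset (Set.image_subset_iff.mpr hφ))
  intro v hv w hw hvw
  by_contra hne
  have h1 := hV hv.1 hw.1 hne
  have h2 := hφd v hv
  have h3 := hφd w hw
  rw [← hvw] at h3
  linarith [dist_triangle_right v w (φ v)]

theorem locallyFinite_of_etaSeparated {K : PlaneComplex} {η D : ℝ} (hη : 0 < η)
    (hV : EtaSeparated η K.vertices) (hD : ∀ s ∈ K.faces, ∀ u ∈ s, ∀ v ∈ s, dist u v ≤ D) :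
    LocallyFinite fun s : K.faces => convexHull ℝ ((s : Finset Plane) : Set Plane) := by
  intro x
  refine ⟨Metric.ball x 1, Metric.ball_mem_nhds x one_pos, ?_⟩
  have hfin := (finite_of_etaSeparated hη hV x (1 + D)).finite_subsets
  refine (hfin.preimage (f := fun s : K.faces => ((s : Finset Plane) : Set Plane))
    (fun s _ t _ h => Subtype.ext (Finset.coe_injective h))).subset ?_
  rintro ⟨s, hs⟩ ⟨y, hy, hyx⟩ v hv
  refine ⟨?_, ?_⟩
  · rw [K.vertices_eq]; exact Set.mem_biUnion hs hv
  · have h1 : convexHull ℝ (s : Set Plane) ⊆ Metric.closedBall v D :=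
      convexHull_min (fun u hu => hD s hs u hu v hv) (convex_closedBall v D)
    have h2 : dist y v ≤ D := h1 hy
    have h3 : dist y x < 1 := hyx
    change dist v x ≤ 1 + D
    linarith [dist_triangle_left v x y]

/-! ### Cutting a triangle into four -/

/-- The angle at `a` of the triangle `abc` is obtuse. -/
def Obt (a b c : Plane) : Prop := dist a b ^ 2 + dist a c ^ 2 < dist b c ^ 2

/-- The triangles with vertex `a` into which `abc` is cut. -/
def CutAt (a b c : Plane) (u : Set Plane) : Prop :=
  (¬ Obt a b c ∧ u = {a, midpoint ℝ a b, midpoint ℝ a c}) ∨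
  (Obt a b c ∧ u = {a, midpoint ℝ a b, midpoint ℝ b c}) ∨
  (Obt a b c ∧ u = {a, midpoint ℝ a c, midpoint ℝ b c})

/-- The triangles into which `abc` is cut: four similar ones, except that in an obtuse triangle
the parallelogram at the obtuse angle is divided by its short diagonal. -/
def Cut (a b c : Plane) (u : Set Plane) : Prop :=
  CutAt a b c u ∨ CutAt b c a u ∨ CutAt c a b u ∨
  (¬ Obt a b c ∧ ¬ Obt b c a ∧ ¬ Obt c a b ∧ u = {midpoint ℝ a b, midpoint ℝ b c, midpoint ℝ c a})

/-- The points of `T` and the midpoints of pairs of points of `T`. -/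
def Six (T : Set Plane) : Set Plane := {v | ∃ p ∈ T, ∃ q ∈ T, v = midpoint ℝ p q}

theorem mem_six {a b c v : Plane} : v ∈ Six {a, b, c} ↔ v = a ∨ v = b ∨ v = c ∨
    v = midpoint ℝ a b ∨ v = midpoint ℝ b c ∨ v = midpoint ℝ c a := by
  constructor
  · rintro ⟨p, rfl | rfl | rfl, q, rfl | rfl | rfl, rfl⟩ <;>
      first | (simp; done) | (rw [midpoint_comm]; simp)
  · rintro (rfl | rfl | rfl | rfl | rfl | rfl)
    · exact ⟨v, by simp, v, by simp, by simp⟩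
    · exact ⟨v, by simp, v, by simp, by simp⟩
    · exact ⟨v, by simp, v, by simp, by simp⟩
    · exact ⟨a, by simp, b, by simp, rfl⟩
    · exact ⟨b, by simp, c, by simp, rfl⟩
    · exact ⟨c, by simp, a, by simp, rfl⟩

theorem obt_swap {a b c : Plane} : Obt a c b ↔ Obt a b c := by
  unfold Obt
  rw [add_comm, dist_comm c b]

theorem Obt.not_obt {a b c : Plane} (h : Obt a b c) : ¬ Obt b c a ∧ ¬ Obt c a b := by
  unfold Obt at *
  rw [dist_comm b a, dist_comm c b, dist_comm c a]
  constructor <;> nlinarith [sq_nonneg (dist a b), sq_nonneg (dist a c)]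

theorem CutAt.swap {a b c : Plane} {u : Set Plane} (h : CutAt a b c u) : CutAt a c b u := by
  unfold CutAt at *
  rw [obt_swap, midpoint_comm c b]
  rcases h with ⟨h1, rfl⟩ | h | h
  · exact Or.inl ⟨h1, by rw [Set.pair_comm]⟩
  · exact Or.inr (Or.inr h)
  · exact Or.inr (Or.inl h)

theorem Cut.rotate {a b c : Plane} {u : Set Plane} (h : Cut a b c u) : Cut b c a u := by
  unfold Cut at *
  rcases h with h | h | h | ⟨h1, h2, h3, rfl⟩
  · exact Or.inr (Or.inr (Or.inl h))
  · exact Or.inl h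
  · exact Or.inr (Or.inl h)
  · exact Or.inr (Or.inr (Or.inr ⟨h2, h3, h1, by ext; simp; tauto⟩))

theorem Cut.swap {a b c : Plane} {u : Set Plane} (h : Cut a b c u) : Cut b a c u := by
  unfold Cut at *
  rcases h with h | h | h | ⟨h1, h2, h3, rfl⟩
  · exact Or.inr (Or.inl h.swap)
  · exact Or.inl h.swap
  · exact Or.inr (Or.inr (Or.inl h.swap))
  · refine Or.inr (Or.inr (Or.inr ⟨obt_swap.not.mpr h2, obt_swap.not.mpr h1, obt_swap.not.mpr h3, ?_⟩))
    rw [midpoint_comm a b, midpoint_comm b c, midpoint_comm c a]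
    ext; simp; tauto

/-- Two labellings of the same triangle differ by a permutation. -/
theorem labels_eq {P : Plane → Plane → Plane → Prop} (hrot : ∀ a b c, P a b c → P b c a)
    (hswap : ∀ a b c, P a b c → P b a c) {a b c x y z : Plane} (h : crossArea a b c ≠ 0)
    (hx : crossArea x y z ≠ 0) (e : ({x, y, z} : Set Plane) = {a, b, c}) (hP : P x y z) :
    P a b c := by
  have nab := crossArea_ne h
  have nbc := crossArea_ne (crossArea_ne_zero_rotate h)
  have nca := crossArea_ne (crossArea_ne_zero_rotate (crossArea_ne_zero_rotate h))
  have ha : a ∈ ({x, y, z} : Set Plane) := by rw [e]; simp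
  have hb : b ∈ ({x, y, z} : Set Plane) := by rw [e]; simp
  have hc : c ∈ ({x, y, z} : Set Plane) := by rw [e]; simp
  have p1 := hrot _ _ _ hP
  have p2 := hrot _ _ _ p1
  rcases ha with rfl | rfl | rfl <;> rcases hb with rfl | rfl | rfl <;>
    rcases hc with rfl | rfl | rfl <;> first | contradiction | assumption | (apply hswap; assumption)

theorem Cut.congr {a b c x y z : Plane} {u : Set Plane} (h : crossArea a b c ≠ 0)
    (hx : crossArea x y z ≠ 0) (e : ({x, y, z} : Set Plane) = {a, b, c}) (hu : Cut x y z u) :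
    Cut a b c u :=
  labels_eq (P := fun a b c => Cut a b c u) (fun _ _ _ h => h.rotate) (fun _ _ _ h => h.swap)
    h hx e hu

theorem CutAt.subset_six {a b c : Plane} {u : Set Plane} (h : CutAt a b c u) :
    u ⊆ Six {a, b, c} := by
  intro v hv
  rw [mem_six, midpoint_comm c a]
  rcases h with ⟨-, rfl⟩ | ⟨-, rfl⟩ | ⟨-, rfl⟩ <;> rcases hv with rfl | rfl | rfl <;> simp

theorem Cut.subset_six {a b c : Plane} {u : Set Plane} (h : Cut a b c u) :
    u ⊆ Six {a, b, c} := by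
  have e1 : ({b, c, a} : Set Plane) = {a, b, c} := by ext; simp; tauto
  have e2 : ({c, a, b} : Set Plane) = {a, b, c} := by ext; simp; tauto
  rcases h with h | h | h | ⟨-, -, -, rfl⟩
  · exact h.subset_six
  · exact e1 ▸ h.subset_six
  · exact e2 ▸ h.subset_six
  · rintro v (rfl | rfl | rfl) <;> rw [mem_six] <;> simp

theorem six_subset_hull (T : Set Plane) : Six T ⊆ convexHull ℝ T := by
  rintro v ⟨p, hp, q, hq, rfl⟩
  exact (convex_convexHull ℝ T).midpoint_mem (subset_convexHull ℝ _ hp) (subset_convexHull ℝ _ hq)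

theorem crossArea_cut (a b c : Plane) :
    crossArea a (midpoint ℝ a b) (midpoint ℝ a c) = crossArea a b c / 4 ∧
    crossArea a (midpoint ℝ a b) (midpoint ℝ b c) = crossArea a b c / 4 ∧
    crossArea a (midpoint ℝ a c) (midpoint ℝ b c) = - (crossArea a b c / 4) ∧
    crossArea (midpoint ℝ a b) (midpoint ℝ b c) (midpoint ℝ c a) = crossArea a b c / 4 := by
  simp only [crossArea, midpoint_apply_plane]
  refine ⟨?_, ?_, ?_, ?_⟩ <;> ring

theorem CutAt.exists_triple {a b c : Plane} {u : Set Plane} (h0 : crossArea a b c ≠ 0)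
    (h : CutAt a b c u) : ∃ p q r, crossArea p q r ≠ 0 ∧ u = {p, q, r} := by
  have e := crossArea_cut a b c
  rcases h with ⟨-, rfl⟩ | ⟨-, rfl⟩ | ⟨-, rfl⟩
  · exact ⟨_, _, _, by rw [e.1]; simpa using h0, rfl⟩
  · exact ⟨_, _, _, by rw [e.2.1]; simpa using h0, rfl⟩
  · exact ⟨_, _, _, by rw [e.2.2.1]; simpa using h0, rfl⟩

theorem Cut.exists_triple {a b c : Plane} {u : Set Plane} (h0 : crossArea a b c ≠ 0)
    (h : Cut a b c u) : ∃ p q r, crossArea p q r ≠ 0 ∧ u = {p, q, r} := by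
  rcases h with h | h | h | ⟨-, -, -, rfl⟩
  · exact h.exists_triple h0
  · exact h.exists_triple (crossArea_ne_zero_rotate h0)
  · exact h.exists_triple (crossArea_ne_zero_rotate (crossArea_ne_zero_rotate h0))
  · exact ⟨_, _, _, by rw [(crossArea_cut a b c).2.2.2]; simpa using h0, rfl⟩

/-- The circle of a piece of a cut triangle has none of the six points in its interior. -/
theorem CutAt.power_nonneg {a b c : Plane} {u : Set Plane} (h : CutAt a b c u) {S : Sphere Plane}
    (hS : ∀ v ∈ u, v ∈ S) {v : Plane} (hv : v ∈ Six {a, b, c}) : 0 ≤ S.power v := by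
  have hP : ∀ v ∈ u, S.power v = 0 := fun v hv => power_of_mem (hS v hv)
  have mab := power_midpoint S a b
  have mbc := power_midpoint S b c
  have mca := power_midpoint S a c
  have dab := sq_nonneg (dist a b)
  have dbc := sq_nonneg (dist b c)
  have dca := sq_nonneg (dist a c)
  rw [mem_six, midpoint_comm c a] at hv
  unfold CutAt Obt at h
  -- By `power_midpoint` all six powers are linear in the squared sides, so every case is linear;
  -- the sign in `Obt` decides the vertex of the parallelogram opposite the piece.
  rcases h with ⟨ho, rfl⟩ | ⟨ho, rfl⟩ | ⟨ho, rfl⟩ <;>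
  · have h1 := hP _ (Or.inl rfl)
    have h2 := hP _ (Or.inr (Or.inl rfl))
    have h3 := hP _ (Or.inr (Or.inr rfl))
    rcases hv with rfl | rfl | rfl | rfl | rfl | rfl <;> linarith

theorem Cut.power_nonneg {a b c : Plane} {u : Set Plane} (h : Cut a b c u) {S : Sphere Plane}
    (hS : ∀ v ∈ u, v ∈ S) {v : Plane} (hv : v ∈ Six {a, b, c}) : 0 ≤ S.power v := by
  have e1 : ({b, c, a} : Set Plane) = {a, b, c} := by ext; simp; tauto
  have e2 : ({c, a, b} : Set Plane) = {a, b, c} := by ext; simp; tauto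
  rcases h with h | h | h | ⟨h1, h2, h3, rfl⟩
  · exact h.power_nonneg hS hv
  · exact h.power_nonneg hS (e1 ▸ hv)
  · exact h.power_nonneg hS (e2 ▸ hv)
  · have k1 := power_of_mem (hS _ (Or.inl rfl))
    have k2 := power_of_mem (hS _ (Or.inr (Or.inl rfl)))
    have k3 := power_of_mem (hS _ (Or.inr (Or.inr rfl)))
    have mab := power_midpoint S a b
    have mbc := power_midpoint S b c
    have mca := power_midpoint S c a
    unfold Obt at h1 h2 h3
    rw [dist_comm a c] at h1
    rw [dist_comm b a] at h2
    rw [dist_comm c b] at h3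
    rw [mem_six] at hv
    rcases hv with rfl | rfl | rfl | rfl | rfl | rfl <;> linarith

/-- Distinct points of a piece of a cut triangle are far apart. -/
theorem CutAt.le_dist {η : ℝ} (hη : 0 < η) {a b c : Plane} {u : Set Plane} (h : CutAt a b c u)
    (hab : η ≤ dist a b) (hbc : η ≤ dist b c) (hac : η ≤ dist a c)
    (hmed : dist b c ^ 2 ≤ dist a b ^ 2 + 2 * dist a c ^ 2) {p q : Plane} (hp : p ∈ u) (hq : q ∈ u)
    (hpq : p ≠ q) : η / 2 ≤ dist p q := by
  apply le_of_sq_le_sq _ dist_nonneg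
  have dab := pow_le_pow_left₀ hη.le hab 2
  have dbc := pow_le_pow_left₀ hη.le hbc 2
  have dac := pow_le_pow_left₀ hη.le hac 2
  have key : ∀ x y z : Plane, η ^ 2 ≤ dist x z ^ 2 →
      (η / 2) ^ 2 ≤ dist (midpoint ℝ x y) (midpoint ℝ y z) ^ 2 := by
    intro x y z h
    simp only [dist_sq_plane, midpoint_apply_plane] at h ⊢
    nlinarith
  have k1 := key b a c dbc
  rw [midpoint_comm b a] at k1
  have k2 := key a b c dac
  have k3 := key a c b dab
  rw [midpoint_comm c b] at k3
  have m1 := dist_sq_midpoint a a b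
  have m2 := dist_sq_midpoint a a c
  have m3 := dist_sq_midpoint a b c
  rw [dist_self, dist_comm b a] at m1
  rw [dist_self, dist_comm c a] at m2
  rw [dist_comm b a, dist_comm c a] at m3
  have l1 : (η / 2) ^ 2 ≤ dist (midpoint ℝ a b) a ^ 2 := by linarith
  have l2 : (η / 2) ^ 2 ≤ dist (midpoint ℝ a c) a ^ 2 := by linarith
  -- `hmed` says exactly that the median from `a` is at least half of `ab`.
  have l3 : (η / 2) ^ 2 ≤ dist (midpoint ℝ b c) a ^ 2 := by linarith
  have flip : ∀ {x y : Plane}, (η / 2) ^ 2 ≤ dist x y ^ 2 → (η / 2) ^ 2 ≤ dist y x ^ 2 := by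
    intro x y h; rwa [dist_comm]
  rcases h with ⟨-, rfl⟩ | ⟨-, rfl⟩ | ⟨-, rfl⟩ <;> rcases hp with rfl | rfl | rfl <;>
    rcases hq with rfl | rfl | rfl <;>
    first | exact absurd rfl hpq | assumption | (apply flip; assumption)

/-- Values at the vertices may be prescribed. The function supports the triangle along the face
spanned by its vertices in `F`. -/
theorem exists_indicator {a b c : Plane} (h : crossArea a b c ≠ 0) (F : Set Plane) :
    ∃ g : Plane → ℝ, IsAff g ∧ ∀ v ∈ ({a, b, c} : Set Plane), (v ∈ F → g v = 0) ∧
      (v ∉ F → g v = 1) := by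
  classical
  have h1 := crossArea_ne_zero_rotate h
  have h2 := crossArea_ne_zero_rotate h1
  refine ⟨fun x => (if a ∈ F then 0 else 1) * bary a b c x + (if b ∈ F then 0 else 1) * bary b c a x
    + (if c ∈ F then 0 else 1) * bary c a b x,
    (((isAff_bary _ _ _).const_mul _).add ((isAff_bary _ _ _).const_mul _)).add
      ((isAff_bary _ _ _).const_mul _), ?_⟩
  rintro v (rfl | rfl | rfl) <;> beta_reduce
  · rw [bary_self h, bary_snd, bary_fst]; constructor <;> intro h <;> simp [h]
  · rw [bary_self h1, bary_fst, bary_snd]; constructor <;> intro h <;> simp [h]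
  · rw [bary_self h2, bary_fst, bary_snd]; constructor <;> intro h <;> simp [h]

/-- Faces of a triangle meet in their common face. -/
theorem hull_inter_of_subset {a b c : Plane} (h : crossArea a b c ≠ 0) {s t : Set Plane}
    (hs : s ⊆ {a, b, c}) (ht : t ⊆ {a, b, c}) {x : Plane} (hxs : x ∈ convexHull ℝ s)
    (hxt : x ∈ convexHull ℝ t) : x ∈ convexHull ℝ (s ∩ t) := by
  obtain ⟨g, hg, hgv⟩ := exists_indicator h s
  have h1 : g x ≤ 0 := by
    have := mem_convexHull_of_isAff (hg.const_mul (-1)) (fun v hv => by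
      simp [(hgv v (hs hv)).1 hv]) hxs
    linarith
  have h2 := mem_convexHull_zeros hg (fun v hv => by
    by_cases hvs : v ∈ s
    · exact ((hgv v (ht hv)).1 hvs).ge
    · rw [(hgv v (ht hv)).2 hvs]; norm_num) hxt h1
  refine convexHull_mono ?_ h2
  rintro v ⟨hv, hv0⟩
  refine ⟨?_, hv⟩
  by_contra hvs
  rw [(hgv v (ht hv)).2 hvs] at hv0
  norm_num at hv0

/-- A point of a face of a triangle that lies in the hull of points of the triangle lies in the hull
of those among them that are on the face. -/
theorem mem_hull_face {a b c : Plane} (h : crossArea a b c ≠ 0) {F s : Set Plane}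
    (hF : F ⊆ {a, b, c}) (hs : s ⊆ convexHull ℝ {a, b, c}) {x : Plane} (hxs : x ∈ convexHull ℝ s)
    (hxF : x ∈ convexHull ℝ F) : x ∈ convexHull ℝ {v ∈ s | v ∈ convexHull ℝ F} := by
  obtain ⟨g, hg, hgv⟩ := exists_indicator h F
  have h1 : g x ≤ 0 := by
    have := mem_convexHull_of_isAff (hg.const_mul (-1)) (fun v hv => by
      simp [(hgv v (hF hv)).1 hv]) hxF
    linarith
  have hT : ∀ v ∈ ({a, b, c} : Set Plane), 0 ≤ g v := by
    intro v hv
    by_cases hvF : v ∈ F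
    · exact ((hgv v hv).1 hvF).ge
    · rw [(hgv v hv).2 hvF]; norm_num
  have h2 := mem_convexHull_zeros hg (fun v hv => mem_convexHull_of_isAff hg hT (hs hv)) hxs h1
  refine convexHull_mono ?_ h2
  rintro v ⟨hv, hv0⟩
  refine ⟨hv, convexHull_mono ?_ (mem_convexHull_zeros hg hT (hs hv) hv0.le)⟩
  rintro w ⟨hw, hw0⟩
  by_contra hwF
  rw [(hgv w hw).2 hwF] at hw0
  norm_num at hw0

/-- The hulls meet only on the line `g = 0`, where the points of `s` are vertices of the triangle.
This reduces the claim to two faces of one triangle. -/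
theorem hull_inter_of_separator {u s t : Set Plane} {a b c : Plane} (h : crossArea a b c ≠ 0)
    {g : Plane → ℝ} (hg : IsAff g) (h1 : ∀ v ∈ u, 0 ≤ g v)
    (h2 : ∀ v ∈ ({a, b, c} : Set Plane), g v ≤ 0)
    (h3 : ∀ v ∈ u, g v = 0 → v ∈ ({a, b, c} : Set Plane)) (hs : s ⊆ u) (ht : t ⊆ {a, b, c}) {x : Plane}
    (hxs : x ∈ convexHull ℝ s) (hxt : x ∈ convexHull ℝ t) : x ∈ convexHull ℝ (s ∩ t) := by
  have k1 : g x ≤ 0 := by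
    have := mem_convexHull_of_isAff (hg.const_mul (-1)) (fun v hv => by
      have := h2 v (ht hv)
      linarith) hxt
    linarith
  have k2 := mem_convexHull_zeros hg (fun v hv => h1 v (hs hv)) hxs k1
  have k3 := hull_inter_of_subset h (fun v hv => h3 v (hs hv.1) hv.2) ht k2 hxt
  exact convexHull_mono (Set.inter_subset_inter_left _ fun v hv => hv.1) k3

/-! ### The cut as a regular subdivision -/

/-- The pieces of a cut triangle are the domains of linearity of a convex function. -/
def HasHeights (a b c : Plane) : Prop :=
  ∃ w : Plane → ℝ, ∀ u, Cut a b c u → ∃ l : Plane → ℝ, IsAff l ∧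
    (∀ v ∈ Six {a, b, c}, l v ≤ w v ∧ (l v = w v → v ∈ u)) ∧ ∀ v ∈ u, l v = w v

theorem HasHeights.rotate {a b c : Plane} (h : HasHeights a b c) : HasHeights b c a := by
  obtain ⟨w, hw⟩ := h
  have e : ({b, c, a} : Set Plane) = {a, b, c} := by ext; simp; tauto
  exact ⟨w, fun u hu => by rw [e]; exact hw u hu.rotate.rotate⟩

theorem bary_values {a b c : Plane} (h : crossArea a b c ≠ 0) :
    bary a b c a = 1 ∧ bary a b c b = 0 ∧ bary a b c c = 0 ∧
    bary a b c (midpoint ℝ a b) = 1 / 2 ∧ bary a b c (midpoint ℝ b c) = 0 ∧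
    bary a b c (midpoint ℝ c a) = 1 / 2 := by
  refine ⟨bary_self h, bary_fst _ _ _, bary_snd _ _ _, ?_, ?_, ?_⟩ <;>
  · rw [(isAff_bary a b c).midpoint]
    simp [bary_self h, bary_fst, bary_snd]

theorem hasHeights_of_obt {a b c : Plane} (h : crossArea a b c ≠ 0) (ho : Obt a b c) :
    HasHeights a b c := by
  obtain ⟨A1, A2, A3, A4, A5, A6⟩ := bary_values h
  obtain ⟨B1, B2, B3, B4, B5, B6⟩ := bary_values (crossArea_ne_zero_rotate h)
  obtain ⟨C1, C2, C3, C4, C5, C6⟩ :=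
    bary_values (crossArea_ne_zero_rotate (crossArea_ne_zero_rotate h))
  have hA := isAff_bary a b c
  have hB := isAff_bary b c a
  have hC := isAff_bary c a b
  set A := bary a b c
  set B := bary b c a
  set C := bary c a b
  -- The creases of the maximum are the cuts: `l3 = l4` on the median `B = C`, `l1 = l3` on the
  -- midline `B = 1/2`, and `l2 = l4` on the midline `C = 1/2`.
  set l1 : Plane → ℝ := fun v => 2 * B v - 2 * C v - A v
  set l2 : Plane → ℝ := fun v => 2 * C v - 2 * B v - A v
  set l3 : Plane → ℝ := fun v => B v - C v
  set l4 : Plane → ℝ := fun v => C v - B v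
  have hl1 : IsAff l1 := ((hB.const_mul 2).sub (hC.const_mul 2)).sub hA
  have hl2 : IsAff l2 := ((hC.const_mul 2).sub (hB.const_mul 2)).sub hA
  have hl3 : IsAff l3 := hB.sub hC
  have hl4 : IsAff l4 := hC.sub hB
  refine ⟨fun v => max (max (l1 v) (l2 v)) (max (l3 v) (l4 v)), ?_⟩
  have key : ∀ l : Plane → ℝ, IsAff l →
      (∀ v, l v ≤ max (max (l1 v) (l2 v)) (max (l3 v) (l4 v))) → ∀ u : Set Plane,
      (∀ v ∈ Six {a, b, c}, l v = max (max (l1 v) (l2 v)) (max (l3 v) (l4 v)) → v ∈ u) →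
      (∀ v ∈ u, l v = max (max (l1 v) (l2 v)) (max (l3 v) (l4 v))) →
      ∃ l : Plane → ℝ, IsAff l ∧
      (∀ v ∈ Six {a, b, c}, l v ≤ max (max (l1 v) (l2 v)) (max (l3 v) (l4 v)) ∧
        (l v = max (max (l1 v) (l2 v)) (max (l3 v) (l4 v)) → v ∈ u)) ∧
        ∀ v ∈ u, l v = max (max (l1 v) (l2 v)) (max (l3 v) (l4 v)) :=
    fun l h1 h2 u h3 h4 => ⟨l, h1, fun v hv => ⟨h2 v, h3 v hv⟩, h4⟩
  obtain ⟨hob, hoc⟩ := ho.not_obt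
  intro u hu
  simp only [Cut, CutAt, ho, hob, hoc, true_and, false_and, not_true, not_false_eq_true,
    or_false, false_or] at hu
  rcases hu with (rfl | rfl) | rfl | rfl
  · apply key l3 hl3 (fun v => by simp)
    · intro v hv
      rw [mem_six] at hv
      rcases hv with rfl | rfl | rfl | rfl | rfl | rfl <;>
        norm_num [l1, l2, l3, l4, *]
    · rintro v (rfl | rfl | rfl) <;> norm_num [l1, l2, l3, l4, *]
  · rw [midpoint_comm a c]
    apply key l4 hl4 (fun v => by simp)
    · intro v hv
      rw [mem_six] at hv
      rcases hv with rfl | rfl | rfl | rfl | rfl | rfl <;>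
        norm_num [l1, l2, l3, l4, *]
    · rintro v (rfl | rfl | rfl) <;> norm_num [l1, l2, l3, l4, *]
  · rw [midpoint_comm b a]
    apply key l1 hl1 (fun v => by simp)
    · intro v hv
      rw [mem_six] at hv
      rcases hv with rfl | rfl | rfl | rfl | rfl | rfl <;>
        norm_num [l1, l2, l3, l4, *]
    · rintro v (rfl | rfl | rfl) <;> norm_num [l1, l2, l3, l4, *]
  · rw [midpoint_comm c b]
    apply key l2 hl2 (fun v => by simp)
    · intro v hv
      rw [mem_six] at hv
      rcases hv with rfl | rfl | rfl | rfl | rfl | rfl <;>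
        norm_num [l1, l2, l3, l4, *]
    · rintro v (rfl | rfl | rfl) <;> norm_num [l1, l2, l3, l4, *]

theorem hasHeights_of_not_obt {a b c : Plane} (h : crossArea a b c ≠ 0) (hoa : ¬ Obt a b c)
    (hob : ¬ Obt b c a) (hoc : ¬ Obt c a b) : HasHeights a b c := by
  obtain ⟨A1, A2, A3, A4, A5, A6⟩ := bary_values h
  obtain ⟨B1, B2, B3, B4, B5, B6⟩ := bary_values (crossArea_ne_zero_rotate h)
  obtain ⟨C1, C2, C3, C4, C5, C6⟩ :=
    bary_values (crossArea_ne_zero_rotate (crossArea_ne_zero_rotate h))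
  have hA := isAff_bary a b c
  have hB := isAff_bary b c a
  have hC := isAff_bary c a b
  set A := bary a b c
  set B := bary b c a
  set C := bary c a b
  -- The creases against `l4 = 0` are the three midlines.
  set l1 : Plane → ℝ := fun v => 2 * A v - 1
  set l2 : Plane → ℝ := fun v => 2 * B v - 1
  set l3 : Plane → ℝ := fun v => 2 * C v - 1
  set l4 : Plane → ℝ := fun _ => 0
  have hl1 : IsAff l1 := (hA.const_mul 2).sub (isAff_const 1)
  have hl2 : IsAff l2 := (hB.const_mul 2).sub (isAff_const 1)
  have hl3 : IsAff l3 := (hC.const_mul 2).sub (isAff_const 1)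
  have hl4 : IsAff l4 := isAff_const 0
  refine ⟨fun v => max (max (l1 v) (l2 v)) (max (l3 v) (l4 v)), ?_⟩
  have key : ∀ l : Plane → ℝ, IsAff l →
      (∀ v, l v ≤ max (max (l1 v) (l2 v)) (max (l3 v) (l4 v))) → ∀ u : Set Plane,
      (∀ v ∈ Six {a, b, c}, l v = max (max (l1 v) (l2 v)) (max (l3 v) (l4 v)) → v ∈ u) →
      (∀ v ∈ u, l v = max (max (l1 v) (l2 v)) (max (l3 v) (l4 v))) →
      ∃ l : Plane → ℝ, IsAff l ∧
      (∀ v ∈ Six {a, b, c}, l v ≤ max (max (l1 v) (l2 v)) (max (l3 v) (l4 v)) ∧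
        (l v = max (max (l1 v) (l2 v)) (max (l3 v) (l4 v)) → v ∈ u)) ∧
        ∀ v ∈ u, l v = max (max (l1 v) (l2 v)) (max (l3 v) (l4 v)) :=
    fun l h1 h2 u h3 h4 => ⟨l, h1, fun v hv => ⟨h2 v, h3 v hv⟩, h4⟩
  intro u hu
  simp only [Cut, CutAt, hoa, hob, hoc, true_and, false_and, not_false_eq_true,
    or_false] at hu
  rcases hu with rfl | rfl | rfl | rfl
  · rw [midpoint_comm a c]
    apply key l1 hl1 (fun v => by simp)
    · intro v hv
      rw [mem_six] at hv
      rcases hv with rfl | rfl | rfl | rfl | rfl | rfl <;>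
        norm_num [l1, l2, l3, l4, *]
    · rintro v (rfl | rfl | rfl) <;> norm_num [l1, l2, l3, l4, *]
  · rw [midpoint_comm b a]
    apply key l2 hl2 (fun v => by simp)
    · intro v hv
      rw [mem_six] at hv
      rcases hv with rfl | rfl | rfl | rfl | rfl | rfl <;>
        norm_num [l1, l2, l3, l4, *]
    · rintro v (rfl | rfl | rfl) <;> norm_num [l1, l2, l3, l4, *]
  · rw [midpoint_comm c b]
    apply key l3 hl3 (fun v => by simp)
    · intro v hv
      rw [mem_six] at hv
      rcases hv with rfl | rfl | rfl | rfl | rfl | rfl <;>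
        norm_num [l1, l2, l3, l4, *]
    · rintro v (rfl | rfl | rfl) <;> norm_num [l1, l2, l3, l4, *]
  · apply key l4 hl4 (fun v => by simp)
    · intro v hv
      rw [mem_six] at hv
      rcases hv with rfl | rfl | rfl | rfl | rfl | rfl <;>
        norm_num [l1, l2, l3, l4, *]
    · rintro v (rfl | rfl | rfl) <;> norm_num [l1, l2, l3, l4, *]

theorem hasHeights {a b c : Plane} (h : crossArea a b c ≠ 0) : HasHeights a b c := by
  by_cases hoa : Obt a b c
  · exact hasHeights_of_obt h hoa
  by_cases hob : Obt b c a
  · exact (hasHeights_of_obt (crossArea_ne_zero_rotate h) hob).rotate.rotate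
  by_cases hoc : Obt c a b
  · exact (hasHeights_of_obt (crossArea_ne_zero_rotate (crossArea_ne_zero_rotate h)) hoc).rotate
  exact hasHeights_of_not_obt h hoa hob hoc

/-- The pieces of a cut triangle meet properly. -/
theorem Cut.hull_inter {a b c : Plane} (h : crossArea a b c ≠ 0) {u u' s t : Set Plane}
    (hu : Cut a b c u) (hu' : Cut a b c u') (hs : s ⊆ u) (ht : t ⊆ u') {x : Plane}
    (hxs : x ∈ convexHull ℝ s) (hxt : x ∈ convexHull ℝ t) : x ∈ convexHull ℝ (s ∩ t) := by
  obtain ⟨w, hw⟩ := hasHeights h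
  obtain ⟨l, hl, hl6, hlu⟩ := hw u hu
  obtain ⟨l', hl', hl6', hlu'⟩ := hw u' hu'
  obtain ⟨p, q, r, h0, rfl⟩ := hu'.exists_triple h
  -- Both pieces carry the height `w` by their own affine function, and the other one is at most
  -- `w`; so `l - l'` separates them.
  refine hull_inter_of_separator h0 (hl.sub hl') (u := u) ?_ ?_ ?_ hs ht hxs hxt
  · intro v hv
    have := (hl6' v (hu.subset_six hv)).1
    have := hlu v hv
    linarith
  · intro v hv
    have := (hl6 v (hu'.subset_six hv)).1
    have := hlu' v hv
    linarith
  · intro v hv hv0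
    have := hlu v hv
    exact (hl6' v (hu.subset_six hv)).2 (by linarith)

/-- The pieces of a cut triangle cover it. -/
theorem exists_cut_of_mem_hull {a b c x : Plane} (h : crossArea a b c ≠ 0)
    (hx : x ∈ convexHull ℝ {a, b, c}) : ∃ u, Cut a b c u ∧ x ∈ convexHull ℝ u := by
  have corner : ∀ a b c : Plane, ∀ s t r : ℝ, 0 ≤ t → 0 ≤ r →
      1 / 2 ≤ s → s + t + r = 1 → x = s • a + t • b + r • c →
      x ∈ convexHull ℝ {a, midpoint ℝ a b, midpoint ℝ a c} := by
    intro a b c s t r ht hr hs hsum hx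
    have e : (2 * s - 1) • a + (2 * t) • midpoint ℝ a b + (2 * r) • midpoint ℝ a c = x := by
      rw [hx]
      obtain rfl : s = 1 - t - r := by linarith
      apply plane_ext <;>
      · simp only [PiLp.add_apply, PiLp.smul_apply, smul_eq_mul, midpoint_apply_plane]
        ring
    rw [← e]
    exact comb_mem_convexHull (subset_convexHull ℝ _ (by simp)) (subset_convexHull ℝ _ (by simp))
      (subset_convexHull ℝ _ (by simp)) (by linarith) (by linarith) (by linarith) (by linarith)
  have obt : ∀ a b c : Plane, Obt a b c → crossArea a b c ≠ 0 → x ∈ convexHull ℝ {a, b, c} →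
      ∃ u, Cut a b c u ∧ x ∈ convexHull ℝ u := by
    intro a b c ho h hx
    obtain ⟨hob, hoc⟩ := ho.not_obt
    obtain ⟨h1, h2, h3⟩ := (mem_convexHull_triple h x).mp hx
    have hs := bary_sum h x
    have hrepr := bary_repr h x
    set s := bary a b c x
    set t := bary b c a x
    set r := bary c a b x
    by_cases cb : 1 / 2 ≤ t
    · exact ⟨_, Or.inr (Or.inl (Or.inl ⟨hob, rfl⟩)),
        corner b c a t r s h3 h1 cb (by linarith) (by rw [hrepr]; abel)⟩
    by_cases cc : 1 / 2 ≤ r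
    · exact ⟨_, Or.inr (Or.inr (Or.inl (Or.inl ⟨hoc, rfl⟩))),
        corner c a b r s t h1 h2 cc (by linarith) (by rw [hrepr]; abel)⟩
    rcases le_total r t with hrt | hrt
    · refine ⟨_, Or.inl (Or.inr (Or.inl ⟨ho, rfl⟩)), ?_⟩
      have e : (1 - 2 * t) • a + (2 * (t - r)) • midpoint ℝ a b + (2 * r) • midpoint ℝ b c = x := by
        rw [hrepr]
        have h1 : s = 1 - t - r := by linarith
        rw [h1]
        apply plane_ext <;>
        · simp only [PiLp.add_apply, PiLp.smul_apply, smul_eq_mul, midpoint_apply_plane]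
          ring
      rw [← e]
      exact comb_mem_convexHull (subset_convexHull ℝ _ (by simp)) (subset_convexHull ℝ _ (by simp))
        (subset_convexHull ℝ _ (by simp)) (by linarith) (by linarith) (by linarith) (by linarith)
    · refine ⟨_, Or.inl (Or.inr (Or.inr ⟨ho, rfl⟩)), ?_⟩
      have e : (1 - 2 * r) • a + (2 * (r - t)) • midpoint ℝ a c + (2 * t) • midpoint ℝ b c = x := by
        rw [hrepr]
        have h1 : s = 1 - t - r := by linarith
        rw [h1]
        apply plane_ext <;>
        · simp only [PiLp.add_apply, PiLp.smul_apply, smul_eq_mul, midpoint_apply_plane]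
          ring
      rw [← e]
      exact comb_mem_convexHull (subset_convexHull ℝ _ (by simp)) (subset_convexHull ℝ _ (by simp))
        (subset_convexHull ℝ _ (by simp)) (by linarith) (by linarith) (by linarith) (by linarith)
  by_cases hoa : Obt a b c
  · exact obt a b c hoa h hx
  by_cases hob : Obt b c a
  · have e1 : ({a, b, c} : Set Plane) = {b, c, a} := by ext; simp; tauto
    obtain ⟨u, hu, hxu⟩ := obt b c a hob (crossArea_ne_zero_rotate h) (e1 ▸ hx)
    exact ⟨u, hu.rotate.rotate, hxu⟩
  by_cases hoc : Obt c a b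
  · have e2 : ({a, b, c} : Set Plane) = {c, a, b} := by ext; simp; tauto
    obtain ⟨u, hu, hxu⟩ :=
      obt c a b hoc (crossArea_ne_zero_rotate (crossArea_ne_zero_rotate h)) (e2 ▸ hx)
    exact ⟨u, hu.rotate, hxu⟩
  obtain ⟨h1, h2, h3⟩ := (mem_convexHull_triple h x).mp hx
  have hs := bary_sum h x
  have hrepr := bary_repr h x
  set s := bary a b c x
  set t := bary b c a x
  set r := bary c a b x
  by_cases ca : 1 / 2 ≤ s
  · exact ⟨_, Or.inl (Or.inl ⟨hoa, rfl⟩), corner a b c s t r h2 h3 ca hs hrepr⟩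
  by_cases cb : 1 / 2 ≤ t
  · exact ⟨_, Or.inr (Or.inl (Or.inl ⟨hob, rfl⟩)),
      corner b c a t r s h3 h1 cb (by linarith) (by rw [hrepr]; abel)⟩
  by_cases cc : 1 / 2 ≤ r
  · exact ⟨_, Or.inr (Or.inr (Or.inl (Or.inl ⟨hoc, rfl⟩))),
      corner c a b r s t h1 h2 cc (by linarith) (by rw [hrepr]; abel)⟩
  refine ⟨_, Or.inr (Or.inr (Or.inr ⟨hoa, hob, hoc, rfl⟩)), ?_⟩
  have e : (1 - 2 * r) • midpoint ℝ a b + (1 - 2 * s) • midpoint ℝ b c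
      + (1 - 2 * t) • midpoint ℝ c a = x := by
    rw [hrepr]
    have h1 : s = 1 - t - r := by linarith
    rw [h1]
    apply plane_ext <;>
    · simp only [PiLp.add_apply, PiLp.smul_apply, smul_eq_mul, midpoint_apply_plane]
      ring
  rw [← e]
  exact comb_mem_convexHull (subset_convexHull ℝ _ (by simp)) (subset_convexHull ℝ _ (by simp))
    (subset_convexHull ℝ _ (by simp)) (by linarith) (by linarith) (by linarith) (by linarith)

/-- Every edge is halved. Thus a piece meets an edge of the triangle only in points of one half of
it. -/
theorem Cut.vertex_unique {a b c : Plane} (h : crossArea a b c ≠ 0) {u : Set Plane}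
    (hu : Cut a b c u) (ha : a ∈ u) (hb : b ∈ u) : False := by
  obtain ⟨A1, A2, A3, A4, A5, A6⟩ := bary_values h
  obtain ⟨B1, B2, B3, B4, B5, B6⟩ := bary_values (crossArea_ne_zero_rotate h)
  obtain ⟨C1, C2, C3, C4, C5, C6⟩ :=
    bary_values (crossArea_ne_zero_rotate (crossArea_ne_zero_rotate h))
  simp only [Cut, CutAt, midpoint_comm b a, midpoint_comm c b, midpoint_comm a c] at hu
  rcases hu with (⟨-, rfl⟩ | ⟨-, rfl⟩ | ⟨-, rfl⟩) | (⟨-, rfl⟩ | ⟨-, rfl⟩ | ⟨-, rfl⟩) |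
    (⟨-, rfl⟩ | ⟨-, rfl⟩ | ⟨-, rfl⟩) | ⟨-, -, -, rfl⟩ <;>
  rcases ha with e1 | e1 | e1 <;> rcases hb with e2 | e2 | e2 <;>
  linarith [congrArg (bary a b c) e1, congrArg (bary b c a) e1, congrArg (bary c a b) e1,
    congrArg (bary a b c) e2, congrArg (bary b c a) e2, congrArg (bary c a b) e2]

/-- The piece of a cut triangle along half an edge. -/
theorem Cut.eq_of_mem {a b c : Plane} (h : crossArea a b c ≠ 0) {u : Set Plane}
    (hu : Cut a b c u) (ha : a ∈ u) (hm : midpoint ℝ a b ∈ u) :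
    (¬ Obt a b c ∧ u = {a, midpoint ℝ a b, midpoint ℝ a c}) ∨
      (Obt a b c ∧ u = {a, midpoint ℝ a b, midpoint ℝ b c}) := by
  obtain ⟨A1, A2, A3, A4, A5, A6⟩ := bary_values h
  obtain ⟨B1, B2, B3, B4, B5, B6⟩ := bary_values (crossArea_ne_zero_rotate h)
  obtain ⟨C1, C2, C3, C4, C5, C6⟩ :=
    bary_values (crossArea_ne_zero_rotate (crossArea_ne_zero_rotate h))
  simp only [Cut, CutAt, midpoint_comm b a, midpoint_comm c b, midpoint_comm a c] at hu ⊢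
  rcases hu with (⟨ho, rfl⟩ | ⟨ho, rfl⟩ | ⟨-, rfl⟩) | (⟨-, rfl⟩ | ⟨-, rfl⟩ | ⟨-, rfl⟩) |
    (⟨-, rfl⟩ | ⟨-, rfl⟩ | ⟨-, rfl⟩) | ⟨-, -, -, rfl⟩
  · exact Or.inl ⟨ho, rfl⟩
  · exact Or.inr ⟨ho, rfl⟩
  all_goals
    exfalso
    rcases ha with e1 | e1 | e1 <;> rcases hm with e2 | e2 | e2 <;>
    linarith [congrArg (bary a b c) e1, congrArg (bary b c a) e1, congrArg (bary c a b) e1,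
      congrArg (bary a b c) e2, congrArg (bary b c a) e2, congrArg (bary c a b) e2]

theorem exists_cut_half (a b c : Plane) :
    ∃ u, Cut a b c u ∧ a ∈ u ∧ midpoint ℝ a b ∈ u := by
  by_cases ho : Obt a b c
  · exact ⟨_, Or.inl (Or.inr (Or.inl ⟨ho, rfl⟩)), by simp, by simp⟩
  · exact ⟨_, Or.inl (Or.inl ⟨ho, rfl⟩), by simp, by simp⟩

theorem six_inter_edge {a b c v : Plane} (h : crossArea a b c ≠ 0) (hv : v ∈ Six {a, b, c})
    (hvF : v ∈ convexHull ℝ {a, b}) : v = a ∨ v = b ∨ v = midpoint ℝ a b := by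
  have h2 := mem_convexHull_of_isAff ((isAff_bary c a b).const_mul (-1)) (by
    rintro w (rfl | rfl)
    · simp [bary_fst]
    · simp [bary_snd]) hvF
  obtain ⟨C1, C2, C3, C4, C5, C6⟩ :=
    bary_values (crossArea_ne_zero_rotate (crossArea_ne_zero_rotate h))
  rw [mem_six] at hv
  rcases hv with rfl | rfl | rfl | rfl | rfl | rfl
  · exact Or.inl rfl
  · exact Or.inr (Or.inl rfl)
  · rw [C1] at h2; norm_num at h2
  · exact Or.inr (Or.inr rfl)
  · rw [C6] at h2; norm_num at h2
  · rw [C4] at h2; norm_num at h2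

/-! ### The cut complex -/

/-- Two triangles of a complex are equal, share an edge, or share at most a vertex. -/
theorem IsTri.inter_cases {K : PlaneComplex} {a b c d e f : Plane} (h : IsTri K a b c)
    (h' : IsTri K d e f) {P : Plane → Plane → Plane → Prop} {Q : Prop}
    (hrot : ∀ a b c, P a b c → P b c a) (hP : P a b c)
    (hempty : ({a, b, c} : Set Plane) ∩ {d, e, f} = ∅ → Q)
    (hsingle : ∀ x y z, IsTri K x y z → P x y z → ({a, b, c} : Set Plane) ∩ {d, e, f} = {x} → Q)
    (heq : ({a, b, c} : Set Plane) = {d, e, f} → Q)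
    (hedge : ∀ x y z w, IsTri K x y z → P x y z → IsTri K x y w → z ≠ w →
      ({d, e, f} : Set Plane) = {x, y, w} → ({a, b, c} : Set Plane) ∩ {d, e, f} = {x, y} → Q) :
    Q := by
  have pair : ∀ x y z, IsTri K x y z → P x y z → ({x, y, z} : Set Plane) = {a, b, c} →
      x ∈ ({d, e, f} : Set Plane) → y ∈ ({d, e, f} : Set Plane) → Q := by
    intro x y z hxyz hPx e1 hx hy
    obtain ⟨w, hw, ew⟩ := h'.exists_third (crossArea_ne hxyz.1) hx hy
    by_cases hzw : z = w
    · subst hzw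
      exact heq (by rw [← e1, ew])
    · refine hedge x y z w hxyz hPx hw hzw ew ?_
      rw [← e1, ew]
      have hz1 := crossArea_ne (crossArea_ne_zero_rotate hxyz.1)
      have hz2 := crossArea_ne (crossArea_ne_zero_rotate (crossArea_ne_zero_rotate hxyz.1))
      ext v
      simp only [Set.mem_inter_iff, Set.mem_insert_iff, Set.mem_singleton_iff]
      constructor
      · rintro ⟨rfl | rfl | rfl, h1⟩
        · exact Or.inl rfl
        · exact Or.inr rfl
        · rcases h1 with h1 | h1 | h1
          · exact absurd h1 hz2
          · exact absurd h1.symm hz1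
          · exact absurd h1 hzw
      · rintro (rfl | rfl) <;> simp
  have e1 : ({b, c, a} : Set Plane) = {a, b, c} := by ext; simp; tauto
  have e2 : ({c, a, b} : Set Plane) = {a, b, c} := by ext; simp; tauto
  have inter_single : ∀ x y z, ({x, y, z} : Set Plane) = {a, b, c} → x ∈ ({d, e, f} : Set Plane) →
      y ∉ ({d, e, f} : Set Plane) → z ∉ ({d, e, f} : Set Plane) →
      ({a, b, c} : Set Plane) ∩ {d, e, f} = {x} := by
    intro x y z e hx hy hz
    rw [← e]
    ext v
    simp only [Set.mem_inter_iff, Set.mem_singleton_iff]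
    constructor
    · rintro ⟨rfl | rfl | rfl, h1⟩
      · rfl
      · exact absurd h1 hy
      · exact absurd h1 hz
    · rintro rfl
      exact ⟨by simp, hx⟩
  by_cases hA : a ∈ ({d, e, f} : Set Plane) <;> by_cases hB : b ∈ ({d, e, f} : Set Plane) <;>
    by_cases hC : c ∈ ({d, e, f} : Set Plane)
  · exact pair a b c h hP rfl hA hB
  · exact pair a b c h hP rfl hA hB
  · exact pair c a b h.rotate.rotate (hrot _ _ _ (hrot _ _ _ hP)) e2 hC hA
  · exact hsingle a b c h hP (inter_single a b c rfl hA hB hC)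
  · exact pair b c a h.rotate (hrot _ _ _ hP) e1 hB hC
  · exact hsingle b c a h.rotate (hrot _ _ _ hP) (inter_single b c a e1 hB hC hA)
  · exact hsingle c a b h.rotate.rotate (hrot _ _ _ (hrot _ _ _ hP))
      (inter_single c a b e2 hC hA hB)
  · apply hempty
    rw [Set.eq_empty_iff_forall_notMem]
    rintro v ⟨rfl | rfl | rfl, h1⟩ <;> contradiction

/-- The part of a cut triangle on its intersection with another triangle belongs to the cut of the
latter. -/
theorem Cut.exists_superset {K : PlaneComplex} {a b c d e f : Plane} (h : IsTri K a b c)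
    (h' : IsTri K d e f) {u : Set Plane} (hu : Cut d e f u) :
    ∃ u', Cut a b c u' ∧ {v ∈ u | v ∈ convexHull ℝ (({a, b, c} : Set Plane) ∩ {d, e, f})} ⊆ u' := by
  refine h.inter_cases h' (P := fun x y z => ∀ u', Cut x y z u' → Cut a b c u')
    (fun x y z hP u' hu' => hP u' hu'.rotate.rotate) (fun u' hu' => hu') ?_ ?_ ?_ ?_
  · intro he
    obtain ⟨u', hu', -⟩ := exists_cut_half a b c
    refine ⟨u', hu', ?_⟩
    rw [he, convexHull_empty]
    rintro v ⟨-, hv⟩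
    exact hv.elim
  · intro x y z hx hP he
    obtain ⟨u', hu', hxu, -⟩ := exists_cut_half x y z
    refine ⟨u', hP u' hu', ?_⟩
    rw [he, convexHull_singleton]
    rintro v ⟨-, hv⟩
    rw [Set.mem_singleton_iff.mp hv]; exact hxu
  · intro he
    exact ⟨u, hu.congr h.1 h'.1 he.symm, fun v hv => hv.1⟩
  · intro x y z w hx hP hw hzw e1 e2
    rw [e2]
    have hu2 := hu.congr hw.1 h'.1 e1
    -- As `u` contains at most one end of the common edge, its points there lie on one half. The
    -- other triangle also has a piece along that half, whatever its angles, because the cut of an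
    -- edge does not depend on the triangle.
    by_cases hyu : y ∈ u
    · obtain ⟨u', hu', hyu', hm⟩ := exists_cut_half y x z
      refine ⟨u', hP u' hu'.swap, ?_⟩
      rintro v ⟨hv, hvF⟩
      rcases six_inter_edge hw.1 (hu2.subset_six hv) hvF with rfl | rfl | rfl
      · exact (hu2.vertex_unique hw.1 hv hyu).elim
      · exact hyu'
      · rwa [midpoint_comm]
    · obtain ⟨u', hu', hxu', hm⟩ := exists_cut_half x y z
      refine ⟨u', hP u' hu', ?_⟩
      rintro v ⟨hv, hvF⟩
      rcases six_inter_edge hw.1 (hu2.subset_six hv) hvF with rfl | rfl | rfl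
      · exact hxu'
      · exact absurd hv hyu
      · exact hm

theorem Cut.subset_hull {a b c : Plane} {u : Set Plane} (hu : Cut a b c u) :
    u ⊆ convexHull ℝ {a, b, c} :=
  hu.subset_six.trans (six_subset_hull _)

/-- A point in a face of `K` and in the hull of part of a cut triangle lies in the hull of the
points of that part in the face. -/
theorem IsTri.mem_hull_restrict {K : PlaneComplex} {a b c : Plane} (h : IsTri K a b c)
    {t : Finset Plane} (ht : t ∈ K.faces) {s : Set Plane} (hs : s ⊆ convexHull ℝ {a, b, c})
    {x : Plane} (hxs : x ∈ convexHull ℝ s) (hxt : x ∈ convexHull ℝ (t : Set Plane)) :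
    x ∈ convexHull ℝ {v ∈ s | v ∈ convexHull ℝ (({a, b, c} : Set Plane) ∩ t)} :=
  mem_hull_face h.1 Set.inter_subset_left hs hxs
    (h.hull_inter ht (convexHull_min hs (convex_convexHull ℝ _) hxs) hxt)

/-- The complex obtained from the triangles of `K` by cutting each of them into four. -/
def cutComplex (K : PlaneComplex) : PlaneComplex where
  faces := {t | t.Nonempty ∧ ∃ a b c u, IsTri K a b c ∧ Cut a b c u ∧ (t : Set Plane) ⊆ u}
  isRelLowerSet_faces := by
    rintro t ⟨hne, a, b, c, u, h, hu, ht⟩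
    refine ⟨hne, fun s hst hs => ⟨hs, a, b, c, u, h, hu, subset_trans (Finset.coe_subset.mpr hst) ht⟩⟩
  indep := by
    rintro t ⟨-, a, b, c, u, h, hu, ht⟩
    obtain ⟨p, q, r, h0, rfl⟩ := hu.exists_triple h.1
    exact (affineIndependent_of_crossArea h0).mono ht
  inter_subset_convexHull := by
    rintro s t ⟨-, a, b, c, u, h, hu, hs⟩ ⟨-, d, e, f, u', h', hu', ht⟩ x ⟨hxs, hxt⟩
    have hsT := hs.trans hu.subset_hull
    have htT := ht.trans hu'.subset_hull
    obtain ⟨-, s₁, hs₁, e₁⟩ := id h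
    obtain ⟨-, t₁, ht₁, f₁⟩ := id h'
    have hx1 : x ∈ convexHull ℝ (t₁ : Set Plane) := by
      rw [f₁]; exact convexHull_min htT (convex_convexHull ℝ _) hxt
    have hx2 : x ∈ convexHull ℝ (s₁ : Set Plane) := by
      rw [e₁]; exact convexHull_min hsT (convex_convexHull ℝ _) hxs
    -- Only the points of `s` and `t` on the common face of the two triangles matter. Those of `t`
    -- also belong to a piece of the first triangle, so both lie in pieces of one triangle.
    have k1 := h.mem_hull_restrict ht₁ hsT hxs hx1
    have k2 := h'.mem_hull_restrict hs₁ htT hxt hx2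
    rw [f₁] at k1
    rw [e₁, Set.inter_comm] at k2
    obtain ⟨u'', hu'', hsub⟩ := Cut.exists_superset h h' hu'
    have := hu.hull_inter h.1 hu'' (fun v hv => hs hv.1)
      (fun v hv => hsub ⟨ht hv.1, hv.2⟩) k1 k2
    exact convexHull_mono (Set.inter_subset_inter (fun v hv => hv.1) (fun v hv => hv.1)) this

theorem exists_finset_of_cut {a b c : Plane} (h : crossArea a b c ≠ 0) {u : Set Plane}
    (hu : Cut a b c u) : ∃ t : Finset Plane, t.Nonempty ∧ (t : Set Plane) = u := by
  classical
  obtain ⟨p, q, r, -, rfl⟩ := hu.exists_triple h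
  exact ⟨{p, q, r}, by simp, by simp⟩

theorem triple_eq_of_subset {p q r x y z : Plane} (h0 : crossArea p q r ≠ 0)
    (hs : ({p, q, r} : Set Plane) ⊆ {x, y, z}) : ({p, q, r} : Set Plane) = {x, y, z} := by
  have nab := crossArea_ne h0
  have nbc := crossArea_ne (crossArea_ne_zero_rotate h0)
  have nca := crossArea_ne (crossArea_ne_zero_rotate (crossArea_ne_zero_rotate h0))
  have hp : p ∈ ({x, y, z} : Set Plane) := hs (by simp)
  have hq : q ∈ ({x, y, z} : Set Plane) := hs (by simp)
  have hr : r ∈ ({x, y, z} : Set Plane) := hs (by simp)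
  rcases hp with rfl | rfl | rfl <;> rcases hq with rfl | rfl | rfl <;>
    rcases hr with rfl | rfl | rfl <;>
    first | contradiction | (ext; simp; done) | (ext; simp; tauto)

theorem isTri_cutComplex {K : PlaneComplex} {p q r : Plane} (h : IsTri (cutComplex K) p q r) :
    ∃ a b c, IsTri K a b c ∧ Cut a b c {p, q, r} := by
  obtain ⟨h0, s, ⟨-, a, b, c, u, habc, hu, hs⟩, e⟩ := h
  refine ⟨a, b, c, habc, ?_⟩
  obtain ⟨x, y, z, h1, rfl⟩ := hu.exists_triple habc.1
  rwa [triple_eq_of_subset h0 (e ▸ hs)]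

/-! ### Gromov sets and their Delaunay triangulations -/

/-- The properties of a Delaunay triangulation of an `η`-Gromov subset of the plane that are passed
on to its cut complex. -/
structure IsGood (η : ℝ) (K : PlaneComplex) : Prop where
  lf : LocallyFinite fun s : K.faces => convexHull ℝ ((s : Finset Plane) : Set Plane)
  univ : K.space = Set.univ
  edge : ∀ a b c, IsTri K a b c → η ≤ dist a b
  radius : ∀ a b c, IsTri K a b c → ∀ S : Sphere Plane, a ∈ S → b ∈ S → c ∈ S → S.radius < η
  empty : ∀ a b c, IsTri K a b c → ∀ S : Sphere Plane, a ∈ S → b ∈ S → c ∈ S →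
    ∀ p ∈ K.vertices, 0 ≤ S.power p

section Gromov

variable {η : ℝ} {P : Set Plane}

/-- A point at distance at least `η` from all of `P` could be added to `P`. The strict inequality is
what makes circumradii less than `η`. -/
theorem IsGromovSet.exists_dist_lt (hη : 0 < η) (hP : IsGromovSet η P) (x : Plane) :
    ∃ p ∈ P, dist x p < η := by
  by_cases hx : x ∈ P
  · exact ⟨x, hx, by simpa⟩
  by_contra! h
  refine hx (hP.2 (y := insert x P) ?_ (Set.subset_insert x P) (Set.mem_insert x P))
  exact hP.1.insert fun y hy _ => ⟨h y hy, by rw [dist_comm]; exact h y hy⟩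

theorem isGromovSet_of_cover (hP : EtaSeparated η P) (h : ∀ x, ∃ p ∈ P, dist x p < η) :
    IsGromovSet η P := by
  refine ⟨hP, fun Q hQ hPQ x hx => ?_⟩
  obtain ⟨p, hp, hd⟩ := h x
  by_contra hxP
  have := hQ hx (hPQ hp) (by rintro rfl; exact hxP hp)
  linarith

/-- The convex hull of a relatively dense set is the plane. -/
theorem convexHull_eq_univ (h : ∀ x, ∃ p ∈ P, dist x p < η) : convexHull ℝ P = Set.univ := by
  rw [Set.eq_univ_iff_forall]
  intro x
  -- Three targets around `x`, one above and two diagonally below. At offset `4η`, errors below `η`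
  -- leave products above `9η²` against products below `5η²`, so the three signed areas at `x` stay
  -- positive.
  obtain ⟨p₀, hp₀, h₀⟩ := h (x + !₂[0, 4 * η])
  obtain ⟨p₁, hp₁, h₁⟩ := h (x + !₂[-(4 * η), -(4 * η)])
  obtain ⟨p₂, hp₂, h₂⟩ := h (x + !₂[4 * η, -(4 * η)])
  have coord : ∀ {y z : Plane}, dist y z < η → |y 0 - z 0| < η ∧ |y 1 - z 1| < η := by
    intro y z hyz
    have hd := dist_sq_plane y z
    have hη : 0 ≤ η := dist_nonneg.trans hyz.le
    have : dist y z ^ 2 < η ^ 2 := pow_lt_pow_left₀ hyz dist_nonneg two_ne_zero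
    constructor <;> apply abs_lt_of_sq_lt_sq _ hη <;>
      nlinarith [sq_nonneg (y 0 - z 0), sq_nonneg (y 1 - z 1)]
  have c0 := coord h₀
  have c1 := coord h₁
  have c2 := coord h₂
  simp only [PiLp.add_apply, Matrix.cons_val_zero, Matrix.cons_val_one, abs_lt]
    at c0 c1 c2
  have hη : 0 < η := dist_nonneg.trans_lt h₀
  have big : ∀ s t : ℝ, 3 * η < s → 3 * η < t → 9 * η ^ 2 < s * t := fun s t hs ht => by
    have := mul_lt_mul'' hs ht (by positivity) (by positivity)
    linarith
  have small : ∀ s t : ℝ, |s| < η → |t| < 5 * η → |s * t| < 5 * η ^ 2 := fun s t hs ht => by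
    have := mul_lt_mul'' hs ht (abs_nonneg s) (abs_nonneg t)
    rw [← abs_mul] at this
    linarith
  have A0 : 0 < crossArea x p₁ p₂ := by
    have := big (x 0 - p₁ 0) (x 1 - p₂ 1) (by linarith) (by linarith)
    have := big (x 1 - p₁ 1) (p₂ 0 - x 0) (by linarith) (by linarith)
    unfold crossArea
    nlinarith
  have A1 : 0 < crossArea x p₂ p₀ := by
    have := big (p₂ 0 - x 0) (p₀ 1 - x 1) (by linarith) (by linarith)
    have := abs_lt.mp (small (p₀ 0 - x 0) (p₂ 1 - x 1) (abs_lt.mpr ⟨by linarith, by linarith⟩)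
      (abs_lt.mpr ⟨by linarith, by linarith⟩))
    unfold crossArea
    nlinarith
  have A2 : 0 < crossArea x p₀ p₁ := by
    have := big (x 0 - p₁ 0) (p₀ 1 - x 1) (by linarith) (by linarith)
    have := abs_lt.mp (small (p₀ 0 - x 0) (p₁ 1 - x 1) (abs_lt.mpr ⟨by linarith, by linarith⟩)
      (abs_lt.mpr ⟨by linarith, by linarith⟩))
    unfold crossArea
    nlinarith
  have A : 0 < crossArea p₀ p₁ p₂ := by
    have : crossArea p₀ p₁ p₂ = crossArea x p₁ p₂ + crossArea x p₂ p₀ + crossArea x p₀ p₁ := by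
      unfold crossArea; ring
    rw [this]; positivity
  refine convexHull_mono (s := {p₀, p₁, p₂}) ?_ ((mem_convexHull_triple A.ne' x).mpr ⟨?_, ?_, ?_⟩)
  · rintro v (rfl | rfl | rfl) <;> assumption
  · exact (div_pos A0 A).le
  · exact (div_pos A1 (by rwa [crossArea_rotate])).le
  · exact (div_pos A2 (by rwa [crossArea_rotate, crossArea_rotate])).le

theorem IsDelaunayTriangulation.isGood (hη : 0 < η) (hP : IsGromovSet η P) {K : PlaneComplex}
    (hK : IsDelaunayTriangulation P K) : IsGood η K := by
  have hcov := hP.exists_dist_lt hη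
  have hemp : ∀ a b c, IsTri K a b c → ∀ S : Sphere Plane, a ∈ S → b ∈ S → c ∈ S →
      ∀ p ∈ P, p ∉ Metric.ball S.center S.radius := fun a b c h =>
    hK.empty_circumdisk a b c (hasTriangle_iff.mpr h)
  refine ⟨hK.triangulates.locallyFinite, ?_, ?_, ?_, ?_⟩
  · rw [hK.triangulates.space_eq, convexHull_eq_univ hcov]
  · intro a b c h
    exact hP.1 (hK.vertices_eq ▸ h.mem_vertices) (hK.vertices_eq ▸ h.rotate.mem_vertices)
      (crossArea_ne h.1)
  · intro a b c h S ha hb hc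
    obtain ⟨p, hp, hd⟩ := hcov S.center
    have := hemp a b c h S ha hb hc p hp
    rw [Metric.mem_ball, not_lt, dist_comm] at this
    linarith
  · intro a b c h S ha hb hc p hp
    rw [hK.vertices_eq] at hp
    exact (notMem_ball_iff_power (radius_nonneg_of_mem ha) p).mp (hemp a b c h S ha hb hc p hp)

end Gromov

theorem IsGood.isDelaunayTriangulation {η : ℝ} {K : PlaneComplex} (hK : IsGood η K)
    (hcov : ∀ x, ∃ p ∈ K.vertices, dist x p < η) : IsDelaunayTriangulation K.vertices K := by
  refine ⟨rfl, ⟨hK.lf, ?_⟩, fun a b c h S ha hb hc p hp => ?_⟩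
  · rw [hK.univ, convexHull_eq_univ hcov]
  · exact (notMem_ball_iff_power (radius_nonneg_of_mem ha) p).mpr
      (hK.empty a b c (hasTriangle_iff.mp h) S ha hb hc p hp)

theorem IsGood.dist_lt {η : ℝ} {K : PlaneComplex} (hK : IsGood η K) {a b c : Plane}
    (h : IsTri K a b c) : dist a b < 2 * η := by
  obtain ⟨S, ha, hb, hc⟩ := exists_circumsphere h.1
  have h1 := hK.radius a b c h S ha hb hc
  have h2 := dist_triangle_right a b S.center
  rw [mem_sphere.mp ha, mem_sphere.mp hb] at h2
  linarith

/-- Equivalently, the median from `a` is at least half as long as `ab`. -/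
theorem IsGood.median {η : ℝ} (hη : 0 < η) {K : PlaneComplex} (hK : IsGood η K) {a b c : Plane}
    (h : IsTri K a b c) : dist b c ^ 2 ≤ dist a b ^ 2 + 2 * dist a c ^ 2 := by
  obtain ⟨S, ha, hb, hc⟩ := exists_circumsphere h.1
  exact dist_sq_le_of_circumradius hη ha hb hc (hK.radius a b c h S ha hb hc).le
    (hK.edge _ _ _ h) (hK.edge _ _ _ h.rotate.rotate.swap)

/-! ### Empty circles and covering for the cut complex -/

section Cut

variable {η : ℝ} {K : PlaneComplex}

theorem Cut.le_dist (hη : 0 < η) (hK : IsGood η K) {a b c : Plane} (h : IsTri K a b c)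
    {u : Set Plane} (hu : Cut a b c u) {p q : Plane} (hp : p ∈ u) (hq : q ∈ u) (hpq : p ≠ q) :
    η / 2 ≤ dist p q := by
  have key : ∀ a b c, IsTri K a b c → CutAt a b c u → η / 2 ≤ dist p q := fun a b c h hu =>
    hu.le_dist hη (hK.edge _ _ _ h) (hK.edge _ _ _ h.rotate) (hK.edge _ _ _ h.rotate.rotate.swap)
      (hK.median hη h) hp hq hpq
  rcases hu with hu | hu | hu | ⟨-, -, -, rfl⟩
  · exact key _ _ _ h hu
  · exact key _ _ _ h.rotate hu
  · exact key _ _ _ h.rotate.rotate hu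
  · have mid : ∀ x y z : Plane, η ≤ dist x z →
        η / 2 ≤ dist (midpoint ℝ x y) (midpoint ℝ y z) := by
      intro x y z h
      apply le_of_sq_le_sq _ dist_nonneg
      have := pow_le_pow_left₀ hη.le h 2
      simp only [dist_sq_plane, midpoint_apply_plane] at this ⊢
      nlinarith
    have m1 := mid a b c (hK.edge _ _ _ h.rotate.rotate.swap)
    have m2 := mid b c a (hK.edge _ _ _ h.swap)
    have m3 := mid c a b (hK.edge _ _ _ h.rotate.swap)
    rcases hp with rfl | rfl | rfl <;> rcases hq with rfl | rfl | rfl <;>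
      first | exact absurd rfl hpq | assumption | (rw [dist_comm]; assumption)

theorem eq_third {a m x z : Plane} (hxa : x ≠ a) (hxm : x ≠ m) {u : Set Plane} (hx : x ∈ u)
    (hu : u = {a, m, z}) : x = z := by
  rw [hu] at hx
  rcases hx with h | h | h
  · exact absurd h hxa
  · exact absurd h hxm
  · exact h

/-- The local Delaunay condition at half an edge of `K`. -/
theorem local_of_half_edge (hη : 0 < η) (hK : IsGood η K) {a b c d : Plane} (hc : IsTri K a b c)
    (hd : IsTri K a b d) (hcd : c ≠ d) {u u' : Set Plane} (hu : Cut a b c u) (hu' : Cut a b d u')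
    (hau : a ∈ u) (hmu : midpoint ℝ a b ∈ u) (hau' : a ∈ u') (hmu' : midpoint ℝ a b ∈ u')
    {x y : Plane} (hx : x ∈ u) (hxa : x ≠ a) (hxm : x ≠ midpoint ℝ a b) (hy : y ∈ u') (hya : y ≠ a)
    (hym : y ≠ midpoint ℝ a b) {S S' : Sphere Plane} (hS : ∀ v ∈ u, v ∈ S)
    (hS' : ∀ v ∈ u', v ∈ S') : 0 ≤ S.power y ∨ 0 ≤ S'.power x := by
  have hside := hc.opposite hd hcd
  have hab := hK.edge _ _ _ hc
  have hac := hK.edge _ _ _ hc.rotate.rotate.swap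
  have hbc := hK.edge _ _ _ hc.rotate
  have had := hK.edge _ _ _ hd.rotate.rotate.swap
  have hbd := hK.edge _ _ _ hd.rotate
  have key : ∀ {c d : Plane} {S : Sphere Plane}, IsTri K a b c → IsTri K a b d →
      crossArea a b c * crossArea a b d < 0 → Obt a b d → a ∈ S → midpoint ℝ a b ∈ S →
      midpoint ℝ a c ∈ S → 0 ≤ S.power (midpoint ℝ b d) := by
    intro c d S hc hd hside ho h1 h2 h3
    obtain ⟨S₁, ha₁, hb₁, hd₁⟩ := exists_circumsphere hd.1
    exact power_nonneg_of_cut hη ha₁ hb₁ hd₁ (hK.radius _ _ _ hd S₁ ha₁ hb₁ hd₁).le hab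
      (hK.edge _ _ _ hc.rotate.rotate.swap) (hK.edge _ _ _ hc.rotate)
      (hK.edge _ _ _ hd.rotate.rotate.swap) hside ho.le h1 h2 h3
  -- The cases are whether the angle at `a` is obtuse in `abc` and in `abd`. If it is obtuse in
  -- `abc` only, the roles are exchanged and the other alternative is obtained.
  rcases hu.eq_of_mem hc.1 hau hmu with ⟨ho, e⟩ | ⟨ho, e⟩ <;>
    rcases hu'.eq_of_mem hd.1 hau' hmu' with ⟨ho', e'⟩ | ⟨ho', e'⟩ <;>
    obtain rfl := eq_third hxa hxm hx e <;> obtain rfl := eq_third hya hym hy e'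
  · left
    exact power_nonneg_of_uncut (fun S₁ h1 h2 h3 =>
      hK.empty _ _ _ hc S₁ h1 h2 h3 d hd.rotate.rotate.mem_vertices) (hS _ hau) (hS _ hmu) (hS _ hx)
  · left
    exact key hc hd hside ho' (hS _ hau) (hS _ hmu) (hS _ hx)
  · right
    exact key hd hc (by rwa [mul_comm]) ho (hS' _ hau') (hS' _ hmu') (hS' _ hy)
  · left
    exact power_nonneg_of_cut_cut (crossArea_ne hc.1) hside (hK.median hη hc) (hK.median hη hd)
      (hS _ hau) (hS _ hmu) (hS _ hx)

/-- The common edge `pq` of the two pieces lies in the intersection of their parent triangles.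
Either the parents coincide, and `Cut.power_nonneg` applies, or they share just an edge, and `pq` is
half of it. -/
theorem cutComplex_local (hη : 0 < η) (hK : IsGood η K) {p q x y : Plane}
    (hx : IsTri (cutComplex K) p q x) (hy : IsTri (cutComplex K) p q y) (hxy : x ≠ y)
    {S S' : Sphere Plane} (hp : p ∈ S) (hq : q ∈ S) (hxS : x ∈ S) (hp' : p ∈ S') (hq' : q ∈ S')
    (hyS : y ∈ S') : 0 ≤ S.power y ∨ 0 ≤ S'.power x := by
  have hpq := crossArea_ne hx.1
  have hxp := crossArea_ne hx.rotate.rotate.1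
  have hxq := (crossArea_ne hx.rotate.1).symm
  have hyp := crossArea_ne hy.rotate.rotate.1
  have hyq := (crossArea_ne hy.rotate.1).symm
  obtain ⟨a, b, c, habc, hu⟩ := isTri_cutComplex hx
  obtain ⟨d, e, f, hdef, hu'⟩ := isTri_cutComplex hy
  have hS : ∀ v ∈ ({p, q, x} : Set Plane), v ∈ S := by
    rintro v (rfl | rfl | rfl) <;> assumption
  have hS' : ∀ v ∈ ({p, q, y} : Set Plane), v ∈ S' := by
    rintro v (rfl | rfl | rfl) <;> assumption
  have hF : ∀ v, v ∈ ({p, q, x} : Set Plane) → v ∈ ({p, q, y} : Set Plane) →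
      v ∈ convexHull ℝ (({a, b, c} : Set Plane) ∩ {d, e, f}) := by
    intro v hv hv'
    obtain ⟨-, t, ht, et⟩ := id hdef
    rw [← et]
    refine habc.hull_inter ht (hu.subset_hull hv) ?_
    rw [et]; exact hu'.subset_hull hv'
  have hpF := hF p (by simp) (by simp)
  have hqF := hF q (by simp) (by simp)
  refine habc.inter_cases hdef (P := fun a b c => Cut a b c {p, q, x})
    (fun _ _ _ h => h.rotate) hu ?_ ?_ ?_ ?_
  · intro e1
    rw [e1, convexHull_empty] at hpF
    exact hpF.elim
  · intro a' b' c' _ _ e1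
    rw [e1, convexHull_singleton] at hpF hqF
    exact absurd (hpF.trans hqF.symm) hpq
  · intro e1
    left
    exact hu.power_nonneg hS (e1 ▸ hu'.subset_six (by simp))
  · intro a b c d hc hu hd hcd e1 e2
    rw [e2] at hpF hqF
    replace hu' := hu'.congr hd.1 hdef.1 e1
    have half : ∀ a b, IsTri K a b c → IsTri K a b d → Cut a b c {p, q, x} → Cut a b d {p, q, y} →
        a ∈ ({p, q} : Set Plane) → midpoint ℝ a b ∈ ({p, q} : Set Plane) →
        0 ≤ S.power y ∨ 0 ≤ S'.power x := by
      intro a b hc hd hu hu' ha hm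
      have s1 : ∀ {v z : Plane}, v ∈ ({p, q} : Set Plane) → v ∈ ({p, q, z} : Set Plane) := by
        rintro v z (rfl | rfl) <;> simp
      have s2 : ∀ {v : Plane}, v ∈ ({p, q} : Set Plane) → x ≠ v ∧ y ≠ v := by
        rintro v (rfl | rfl)
        · exact ⟨hxp, hyp⟩
        · exact ⟨hxq, hyq⟩
      exact local_of_half_edge hη hK hc hd hcd hu hu' (s1 ha) (s1 hm) (s1 ha) (s1 hm) (by simp)
        (s2 ha).1 (s2 hm).1 (by simp) (s2 ha).2 (s2 hm).2 hS hS'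
    rcases six_inter_edge hc.1 (hu.subset_six (by simp)) hpF with h1 | h1 | h1 <;>
      rcases six_inter_edge hc.1 (hu.subset_six (by simp)) hqF with h2 | h2 | h2
    · exact absurd (h1.trans h2.symm) hpq
    · exact (hu.vertex_unique hc.1 (by simp [h1]) (by simp [h2])).elim
    · exact half a b hc hd hu hu' (by simp [h1]) (by simp [h2])
    · exact (hu.vertex_unique hc.1 (by simp [h2]) (by simp [h1])).elim
    · exact absurd (h1.trans h2.symm) hpq
    · exact half b a hc.swap hd.swap hu.swap hu'.swap (by simp [h1])
        (by rw [midpoint_comm]; simp [h2])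
    · exact half a b hc hd hu hu' (by simp [h2]) (by simp [h1])
    · exact half b a hc.swap hd.swap hu.swap hu'.swap (by simp [h2])
        (by rw [midpoint_comm]; simp [h1])
    · exact absurd (h1.trans h2.symm) hpq

theorem cutComplex_space (hK : IsGood η K) : (cutComplex K).space = Set.univ := by
  rw [Set.eq_univ_iff_forall]
  intro x
  obtain ⟨s, hs, hxs⟩ := K.mem_space_iff.mp (hK.univ ▸ Set.mem_univ x)
  obtain ⟨a, b, c, h, hsub⟩ := exists_isTri_of_face hK.lf hK.univ hs
  obtain ⟨u, hu, hxu⟩ := exists_cut_of_mem_hull h.1 (convexHull_mono hsub hxs)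
  obtain ⟨t, ht, rfl⟩ := exists_finset_of_cut h.1 hu
  exact (cutComplex K).mem_space_iff.mpr ⟨t, ⟨ht, a, b, c, _, h, hu, subset_rfl⟩, hxu⟩

theorem six_subset_vertices {a b c : Plane} (h : IsTri K a b c) :
    Six {a, b, c} ⊆ (cutComplex K).vertices := by
  have key : ∀ a b c, IsTri K a b c → a ∈ (cutComplex K).vertices ∧
      midpoint ℝ a b ∈ (cutComplex K).vertices := by
    intro a b c h
    obtain ⟨u, hu, ha, hm⟩ := exists_cut_half a b c
    exact ⟨⟨by simp, a, b, c, u, h, hu, by simpa⟩, ⟨by simp, a, b, c, u, h, hu, by simpa⟩⟩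
  intro v hv
  rw [mem_six] at hv
  rcases hv with rfl | rfl | rfl | rfl | rfl | rfl
  · exact (key _ _ _ h).1
  · exact (key _ _ _ h.rotate).1
  · exact (key _ _ _ h.rotate.rotate).1
  · exact (key _ _ _ h).2
  · exact (key _ _ _ h.rotate).2
  · exact (key _ _ _ h.rotate.rotate).2

theorem cutComplex_cover (hK : IsGood η K) (x : Plane) :
    ∃ p ∈ (cutComplex K).vertices, dist x p < η / 2 := by
  obtain ⟨s, hs, hxs⟩ := K.mem_space_iff.mp (hK.univ ▸ Set.mem_univ x)
  obtain ⟨a, b, c, h, hsub⟩ := exists_isTri_of_face hK.lf hK.univ hs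
  obtain ⟨S, ha, hb, hc⟩ := exists_circumsphere h.1
  obtain ⟨v, hv, hd⟩ := exists_dist_le_half_radius h.1 ha hb hc (convexHull_mono hsub hxs)
  refine ⟨v, six_subset_vertices h (mem_six.mpr hv), ?_⟩
  linarith [hK.radius a b c h S ha hb hc]

end Cut

section CutGood

variable {η : ℝ} {K : PlaneComplex}

/-- A face of the cut complex is a set of vertices and midpoints of some triangle of `K` whose hull
contains it, and each triangle has finitely many such sets. -/
theorem cutComplex_locallyFinite
    (hlf : LocallyFinite fun s : K.faces => convexHull ℝ ((s : Finset Plane) : Set Plane)) :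
    LocallyFinite fun s : (cutComplex K).faces =>
      convexHull ℝ ((s : Finset Plane) : Set Plane) := by
  intro x
  obtain ⟨U, hU, hfin⟩ := hlf x
  refine ⟨U, hU, ?_⟩
  have hsix : ∀ s : Finset Plane, (Six (s : Set Plane)).Finite := fun s =>
    (s.finite_toSet.image2 (fun p q => midpoint ℝ p q) s.finite_toSet).subset <| by
      rintro v ⟨p, hp, q, hq, rfl⟩
      exact ⟨p, hp, q, hq, rfl⟩
  refine ((hfin.biUnion fun s _ => (hsix s).finite_subsets).preimage
    (f := fun t : (cutComplex K).faces => ((t : Finset Plane) : Set Plane))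
    ((Finset.coe_injective.comp Subtype.val_injective).injOn)).subset ?_
  rintro ⟨t, hne, a, b, c, u, ⟨h0, s, hs, e⟩, hu, ht⟩ ⟨y, hy, hyU⟩
  refine Set.mem_biUnion (x := (⟨s, hs⟩ : K.faces)) ⟨y, ?_, hyU⟩ ?_
  · change y ∈ convexHull ℝ (s : Set Plane)
    rw [e]
    exact convexHull_min (ht.trans hu.subset_hull) (convex_convexHull ℝ _) hy
  · change (t : Set Plane) ⊆ Six (s : Set Plane)
    rw [e]
    exact ht.trans hu.subset_six

/-- The circumradii of the pieces need no computation: their disks are empty by Delaunay's lemma,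
and every centre is closer than `η / 2` to a vertex. -/
theorem IsGood.cutComplex (hη : 0 < η) (hK : IsGood η K) : IsGood (η / 2) (cutComplex K) := by
  have hlf := cutComplex_locallyFinite hK.lf
  have huniv := cutComplex_space hK
  have hemp : ∀ a b c, IsTri (_root_.cutComplex K) a b c →
      ∀ S : Sphere Plane, a ∈ S → b ∈ S → c ∈ S → ∀ p ∈ (_root_.cutComplex K).vertices, 0 ≤ S.power p :=
    fun a b c h S ha hb hc p hp => power_nonneg_of_local hlf huniv
      (fun a b x y hx hy hxy S S' h1 h2 h3 h4 h5 h6 =>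
        cutComplex_local hη hK hx hy hxy h1 h2 h3 h4 h5 h6) h ha hb hc hp
  refine ⟨hlf, huniv, ?_, ?_, hemp⟩
  · intro p q r h
    obtain ⟨a, b, c, habc, hu⟩ := isTri_cutComplex h
    exact hu.le_dist hη hK habc (by simp) (by simp) (crossArea_ne h.1)
  · intro a b c h S ha hb hc
    obtain ⟨p, hp, hd⟩ := cutComplex_cover hK S.center
    have := (notMem_ball_iff_power (radius_nonneg_of_mem ha) p).mpr (hemp a b c h S ha hb hc p hp)
    rw [Metric.mem_ball, not_lt, dist_comm] at this
    linarith

theorem IsGood.isGromovSet_cutComplex (hη : 0 < η) (hK : IsGood η K) :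
    IsGromovSet (η / 2) (_root_.cutComplex K).vertices := by
  have h := hK.cutComplex hη
  exact isGromovSet_of_cover (etaSeparated_vertices h.lf h.univ h.empty (by positivity) h.edge)
    (cutComplex_cover hK)

end CutGood

/-! ### Subdividing a subcomplex, and the nondegeneracy theorem -/

section Restrict

/-- The faces of `L` that lie in faces of `T`. -/
def restrictComplex (L T : PlaneComplex) : PlaneComplex where
  faces := {s ∈ L.faces | ∃ s₀ ∈ T.faces,
    convexHull ℝ (s : Set Plane) ⊆ convexHull ℝ (s₀ : Set Plane)}
  isRelLowerSet_faces := by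
    rintro s ⟨hs, s₀, hs₀, h⟩
    exact ⟨L.nonempty_of_mem_faces hs, fun t hts ht => ⟨L.down_closed hs hts ht, s₀, hs₀,
      (convexHull_mono (Finset.coe_subset.mpr hts)).trans h⟩⟩
  indep hs := L.indep hs.1
  inter_subset_convexHull hs ht := L.inter_subset_convexHull hs.1 ht.1

theorem restrictComplex_le (L T : PlaneComplex) : restrictComplex L T ≤ L := fun _ hs => hs.1

/-- Faces of `T` of any dimension are covered: a point of such a face lies in a piece of a triangle
containing the face, and hence in the hull of those vertices of the piece that are on the face. -/
theorem restrictComplex_cutComplex_isSubdivision {η : ℝ} {K T : PlaneComplex} (hK : IsGood η K)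
    (hT : T ≤ K) : IsSubdivision (restrictComplex (cutComplex K) T) T := by
  classical
  refine ⟨subset_antisymm ?_ ?_, fun s hs => hs.2⟩
  · intro x hx
    obtain ⟨s, ⟨-, s₀, hs₀, h⟩, hxs⟩ := Geometry.SimplicialComplex.mem_space_iff.mp hx
    exact T.mem_space_iff.mpr ⟨s₀, hs₀, h hxs⟩
  · intro x hx
    obtain ⟨s₀, hs₀, hxs⟩ := T.mem_space_iff.mp hx
    have hs₀K := hT hs₀
    obtain ⟨a, b, c, h, hsub⟩ := exists_isTri_of_face hK.lf hK.univ hs₀K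
    obtain ⟨u, hu, hxu⟩ := exists_cut_of_mem_hull h.1 (convexHull_mono hsub hxs)
    obtain ⟨t, -, rfl⟩ := exists_finset_of_cut h.1 hu
    have hx' := h.mem_hull_restrict hs₀K hu.subset_hull hxu hxs
    set t' := t.filter fun v => v ∈ convexHull ℝ (({a, b, c} : Set Plane) ∩ s₀) with ht'
    have e : (t' : Set Plane) =
        {v ∈ (t : Set Plane) | v ∈ convexHull ℝ (({a, b, c} : Set Plane) ∩ s₀)} := by
      rw [ht', Finset.coe_filter]; rfl
    rw [← e] at hx'
    refine Geometry.SimplicialComplex.mem_space_iff.mpr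
      ⟨t', ⟨⟨?_, a, b, c, _, h, hu, ?_⟩, s₀, hs₀, ?_⟩, hx'⟩
    · exact Finset.coe_nonempty.mp (convexHull_nonempty_iff.mp ⟨x, hx'⟩)
    · exact Finset.coe_subset.mpr (Finset.filter_subset _ _)
    · refine convexHull_min ?_ (convex_convexHull ℝ _)
      rw [e]
      exact fun v hv => convexHull_mono Set.inter_subset_right hv.2

end Restrict

theorem IsSubdivision.refl (T : PlaneComplex) : IsSubdivision T T :=
  ⟨rfl, fun s hs => ⟨s, hs, subset_rfl⟩⟩

theorem IsSubdivision.trans {T T' T'' : PlaneComplex} (h : IsSubdivision T'' T')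
    (h' : IsSubdivision T' T) : IsSubdivision T'' T := by
  refine ⟨h.1.trans h'.1, fun s hs => ?_⟩
  obtain ⟨s', hs', h1⟩ := h.2 s hs
  obtain ⟨s₀, hs₀, h2⟩ := h'.2 s' hs'
  exact ⟨s₀, hs₀, h1.trans h2⟩

theorem IsCDG.exists_half {η : ℝ} (hη : 0 < η) {T : PlaneComplex} (hT : IsCDG η T) :
    ∃ T', IsCDG (η / 2) T' ∧ IsSubdivision T' T := by
  obtain ⟨P, K, hP, hK, hTK⟩ := hT
  have h := hK.isGood hη hP
  exact ⟨_, ⟨_, _, h.isGromovSet_cutComplex hη,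
    (h.cutComplex hη).isDelaunayTriangulation (cutComplex_cover h), restrictComplex_le _ T⟩,
    restrictComplex_cutComplex_isSubdivision h hTK⟩

theorem IsCDG.exists_subdivision {η : ℝ} (hη : 0 < η) {T : PlaneComplex} (hT : IsCDG η T)
    (k : ℕ) : ∃ T', IsCDG (η / 2 ^ k) T' ∧ IsSubdivision T' T := by
  induction k with
  | zero => exact ⟨T, by simpa using hT, .refl T⟩
  | succ k ih =>
    obtain ⟨T', h1, h2⟩ := ih
    obtain ⟨T'', h3, h4⟩ := h1.exists_half (by positivity)
    exact ⟨T'', by rwa [div_div, ← pow_succ] at h3, h4.trans h2⟩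

theorem IsCDG.dist_bounds {η : ℝ} (hη : 0 < η) {T : PlaneComplex} (hT : IsCDG η T) {a b : Plane}
    (h : HasEdge T a b) : η ≤ dist a b ∧ dist a b < 2 * η := by
  obtain ⟨P, K, hP, hK, hTK⟩ := hT
  obtain ⟨hab, s, hs, e⟩ := h
  have hg := hK.isGood hη hP
  obtain ⟨c, hc⟩ := exists_isTri_of_pair hg.lf hg.univ (hTK hs) hab e
  exact ⟨hg.edge _ _ _ hc, hg.dist_lt hc⟩

/-- CDGs form a nondegenerate, extendable and subdividable family of triangulations. -/
theorem isNondegExtSubdiv_cdgFamily : IsNondegExtSubdiv (Real.pi / 6) 2 cdgFamily where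
  triangulation := by
    rintro T ⟨η, -, P, K, -, hK, hTK⟩
    exact ⟨T.space, hK.triangulates.locallyFinite.comp_injective
      (g := fun s : T.faces => (⟨s, hTK s.2⟩ : K.faces))
      (fun s t h => Subtype.ext (congrArg (fun z : K.faces => (z : Finset Plane)) h)), rfl⟩
  angle_ge := by
    rintro T ⟨η, hη, P, K, hP, hK, hTK⟩ a b c ⟨hab, hbc, hac, s, hs, e⟩
    have hg := hK.isGood hη hP
    have h : IsTri K a b c := hasTriangle_iff.mp ⟨hab, hbc, hac, s, hTK hs, e⟩
    obtain ⟨S, ha, hb, hc⟩ := exists_circumsphere h.1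
    exact angle_ge_of_circumradius h.1 ha hb hc (hg.radius _ _ _ h S ha hb hc).le
      (hg.edge _ _ _ h.rotate.rotate.swap)
  ratio_le := by
    rintro T ⟨η, hη, hT⟩ a b c d hab hcd
    have h1 := (hT.dist_bounds hη hab).2
    have h2 := (hT.dist_bounds hη hcd).1
    rw [div_le_iff₀ (hη.trans_le h2)]
    linarith
  extendable := by
    rintro T ⟨η, hη, P, K, hP, hK, hTK⟩
    refine ⟨K, ⟨η, hη, P, K, hP, hK, le_rfl⟩, ?_, hTK⟩
    have := hK.triangulates
    rwa [convexHull_eq_univ (hP.exists_dist_lt hη)] at this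
  subdividable := by
    rintro ε hε T ⟨η, hη, hT⟩
    -- After `k` halvings all edges are shorter than `2η / 2^k`.
    obtain ⟨k, hk⟩ := pow_unbounded_of_one_lt (2 * η / ε) one_lt_two
    obtain ⟨T', h1, h2⟩ := hT.exists_subdivision hη k
    refine ⟨T', ⟨_, by positivity, h1⟩, h2, fun a b hab => ?_⟩
    have h3 := (h1.dist_bounds (by positivity) hab).2
    have h4 : 2 * (η / 2 ^ k) < ε := by
      rw [← mul_div_assoc, div_lt_iff₀ (by positivity)]
      rwa [div_lt_iff₀ hε, mul_comm _ ε] at hk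
    linarith

/-! ### The hexagonal lattice, for nonemptiness -/

/-- The points of the hexagonal lattice of minimal distance `1`. -/
def hexPoint (i j : ℤ) : Plane := !₂[i + j / 2, √3 / 2 * j]

/-- The vertex set of a triangle of the hexagonal lattice, for `σ = 1` or `σ = -1`. -/
def hexTriangle (i j σ : ℤ) : Set Plane := {hexPoint i j, hexPoint (i + σ) j, hexPoint i (j + σ)}

theorem hexPoint_zero (i j : ℤ) : hexPoint i j 0 = i + j / 2 := rfl

theorem hexPoint_one (i j : ℤ) : hexPoint i j 1 = √3 / 2 * j := rfl

theorem dist_sq_hexPoint (x : Plane) (i j : ℤ) (s t : ℝ) (h0 : x 0 = s + t / 2)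
    (h1 : x 1 = √3 / 2 * t) :
    dist x (hexPoint i j) ^ 2 = (s - i) ^ 2 + (s - i) * (t - j) + (t - j) ^ 2 := by
  have h3 : √3 ^ 2 = 3 := Real.sq_sqrt (by norm_num)
  rw [dist_sq_plane, hexPoint_zero, hexPoint_one, h0, h1]
  linear_combination (t - j) ^ 2 / 4 * h3

/-- Squared distances are values of the positive definite integral form `m² + mn + n²`, which is at
least `1` off the origin. -/
theorem one_le_dist_hexPoint {i j k l : ℤ} (h : hexPoint i j ≠ hexPoint k l) :
    1 ≤ dist (hexPoint i j) (hexPoint k l) := by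
  have e := dist_sq_hexPoint (hexPoint i j) k l i j rfl rfl
  have hZ : 1 ≤ (i - k) ^ 2 + (i - k) * (j - l) + (j - l) ^ 2 := by
    by_contra! hlt
    obtain rfl : j = l := by
      by_contra hne
      have : 1 ≤ (j - l) ^ 2 := by have := sq_pos_of_ne_zero (sub_ne_zero.mpr hne); omega
      nlinarith [sq_nonneg (2 * (i - k) + (j - l))]
    obtain rfl : i = k := by
      by_contra hne
      have : 1 ≤ (i - k) ^ 2 := by have := sq_pos_of_ne_zero (sub_ne_zero.mpr hne); omega
      simp only [sub_self] at hlt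
      linarith
    exact h rfl
  have hR : (1 : ℝ) ≤ (i - k) ^ 2 + (i - k) * (j - l) + (j - l) ^ 2 := by exact_mod_cast hZ
  apply le_of_sq_le_sq _ dist_nonneg
  rw [e]; linarith

theorem crossArea_hexTriangle (i j : ℤ) {σ : ℤ} (hσ : σ = 1 ∨ σ = -1) :
    crossArea (hexPoint i j) (hexPoint (i + σ) j) (hexPoint i (j + σ)) ≠ 0 := by
  have h : crossArea (hexPoint i j) (hexPoint (i + σ) j) (hexPoint i (j + σ)) = √3 / 2 := by
    simp only [crossArea, hexPoint_zero, hexPoint_one]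
    rcases hσ with rfl | rfl <;> push_cast <;> ring
  rw [h]; positivity

/-- In the coordinates `(a, b)` the triangle is `(0, 0)`, `(1, 0)`, `(0, 1)`. The power is the norm
form `a² + ab + b²` minus the affine function that agrees with it at these points. -/
theorem power_hexPoint {i j σ : ℤ} (hσ : σ = 1 ∨ σ = -1) {S : Sphere Plane}
    (hS : ∀ v ∈ hexTriangle i j σ, v ∈ S) (a b : ℤ) :
    S.power (hexPoint (i + σ * a) (j + σ * b)) = ((a ^ 2 + a * b + b ^ 2 - a - b : ℤ) : ℝ) := by
  have h3 : √3 ^ 2 = 3 := Real.sq_sqrt (by norm_num)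
  have p0 := power_of_mem (hS (hexPoint i j) (by simp [hexTriangle]))
  have p1 := power_of_mem (hS (hexPoint (i + σ) j) (by simp [hexTriangle]))
  have p2 := power_of_mem (hS (hexPoint i (j + σ)) (by simp [hexTriangle]))
  rw [power_plane, hexPoint_zero, hexPoint_one] at p0 p1 p2 ⊢
  rcases hσ with rfl | rfl <;> push_cast at p0 p1 p2 ⊢ <;>
    linear_combination (1 - a - b) * p0 + a * p1 + b * p2 + (b ^ 2 - b) / 4 * h3

theorem exists_hexPoint_eq {i j σ : ℤ} (hσ : σ = 1 ∨ σ = -1) (k l : ℤ) :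
    ∃ a b, hexPoint k l = hexPoint (i + σ * a) (j + σ * b) := by
  refine ⟨σ * (k - i), σ * (l - j), ?_⟩
  rcases hσ with rfl | rfl <;> congr 1 <;> ring

/-- Twice the power is `a(a-1) + b(b-1) + (a+b)(a+b-1)`, a sum of products of consecutive integers.
It vanishes only if `a`, `b` and `a + b` are all `0` or `1`, that is, at the vertices. -/
theorem power_hexPoint_nonneg {i j σ : ℤ} (hσ : σ = 1 ∨ σ = -1) {S : Sphere Plane}
    (hS : ∀ v ∈ hexTriangle i j σ, v ∈ S) (k l : ℤ) : 0 ≤ S.power (hexPoint k l) ∧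
      (S.power (hexPoint k l) = 0 → hexPoint k l ∈ hexTriangle i j σ) := by
  obtain ⟨a, b, e⟩ := exists_hexPoint_eq (i := i) (j := j) hσ k l
  rw [e, power_hexPoint hσ hS]
  have pos : ∀ n : ℤ, 0 ≤ n * (n - 1) := fun n => by
    rcases le_or_gt n 0 with h | h
    · exact mul_nonneg_of_nonpos_of_nonpos h (by omega)
    · exact mul_nonneg h.le (by omega)
  have ha := pos a
  have hb := pos b
  have hab := pos (a + b)
  refine ⟨?_, fun h => ?_⟩
  · have : 0 ≤ a ^ 2 + a * b + b ^ 2 - a - b := by linarith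
    exact_mod_cast this
  · have h0 : a ^ 2 + a * b + b ^ 2 - a - b = 0 := by exact_mod_cast h
    have za : a * (a - 1) = 0 := by linarith
    have zb : b * (b - 1) = 0 := by linarith
    have zab : (a + b) * (a + b - 1) = 0 := by linarith
    rcases mul_eq_zero.mp za with h1 | h1 <;> rcases mul_eq_zero.mp zb with h2 | h2
    · left; rw [h1, h2]; simp
    · right; right; rw [h1, sub_eq_zero.mp h2]; simp
    · right; left; rw [h2, sub_eq_zero.mp h1]; simp
    · rw [sub_eq_zero.mp h1, sub_eq_zero.mp h2] at zab
      norm_num at zab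

/-- The triangulation of the plane into the triangles of the hexagonal lattice. -/
def hexComplex : PlaneComplex where
  faces := {t | t.Nonempty ∧ ∃ i j σ, (σ = 1 ∨ σ = -1) ∧ (t : Set Plane) ⊆ hexTriangle i j σ}
  isRelLowerSet_faces := by
    rintro t ⟨hne, i, j, σ, hσ, ht⟩
    exact ⟨hne, fun s hst hs => ⟨hs, i, j, σ, hσ, subset_trans (Finset.coe_subset.mpr hst) ht⟩⟩
  indep := by
    rintro t ⟨-, i, j, σ, hσ, ht⟩
    exact (affineIndependent_of_crossArea (crossArea_hexTriangle i j hσ)).mono ht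
  inter_subset_convexHull := by
    rintro s t ⟨-, i, j, σ, hσ, hs⟩ ⟨-, i', j', σ', hσ', ht⟩ x ⟨hxs, hxt⟩
    have hp : ∀ {i j σ v}, v ∈ hexTriangle i j σ → ∃ k l, v = hexPoint k l := by
      rintro i j σ v (rfl | rfl | rfl) <;> exact ⟨_, _, rfl⟩
    have sphere : ∀ i j σ, (σ = 1 ∨ σ = -1) →
        ∃ S : Sphere Plane, ∀ v ∈ hexTriangle i j σ, v ∈ S := by
      intro i j σ hσ
      obtain ⟨S, h1, h2, h3⟩ := exists_circumsphere (crossArea_hexTriangle i j hσ)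
      exact ⟨S, by rintro v (rfl | rfl | rfl) <;> assumption⟩
    obtain ⟨S, hS⟩ := sphere i j σ hσ
    obtain ⟨S', hS'⟩ := sphere i' j' σ' hσ'
    -- The radical axis of the two circumcircles separates the triangles, since no lattice point is
    -- inside either circle.
    refine hull_inter_of_separator (crossArea_hexTriangle i' j' hσ') (isAff_power_sub S' S)
      (u := hexTriangle i j σ) ?_ ?_ ?_ hs ht hxs hxt
    · intro v hv
      obtain ⟨k, l, rfl⟩ := hp hv
      rw [power_of_mem (hS _ hv), sub_zero]
      exact (power_hexPoint_nonneg hσ' hS' k l).1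
    · intro v hv
      obtain ⟨k, l, rfl⟩ := hp (σ := σ') hv
      rw [power_of_mem (hS' _ hv), zero_sub, neg_nonpos]
      exact (power_hexPoint_nonneg hσ hS k l).1
    · intro v hv h0
      obtain ⟨k, l, rfl⟩ := hp hv
      rw [power_of_mem (hS _ hv), sub_zero] at h0
      exact (power_hexPoint_nonneg hσ' hS' k l).2 h0

theorem hexComplex_vertices : hexComplex.vertices = {v | ∃ i j, v = hexPoint i j} := by
  ext v
  constructor
  · rintro ⟨-, i, j, σ, -, h⟩
    have hv : v ∈ hexTriangle i j σ := h (by simp)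
    rcases hv with rfl | rfl | rfl <;> exact ⟨_, _, rfl⟩
  · rintro ⟨i, j, rfl⟩
    exact ⟨by simp, i, j, 1, Or.inl rfl, by simp [hexTriangle]⟩

theorem exists_hex_coords (x : Plane) : ∃ (i j : ℤ) (a b : ℝ), 0 ≤ a ∧ a < 1 ∧ 0 ≤ b ∧ b < 1 ∧
    x 0 = (i + a) + (j + b) / 2 ∧ x 1 = √3 / 2 * (j + b) := by
  set t := x 1 / (√3 / 2) with ht
  have h1 : x 1 = √3 / 2 * t := by rw [ht]; field_simp
  refine ⟨⌊x 0 - t / 2⌋, ⌊t⌋, Int.fract (x 0 - t / 2), Int.fract t, Int.fract_nonneg _,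
    Int.fract_lt_one _, Int.fract_nonneg _, Int.fract_lt_one _, ?_, ?_⟩
  · rw [Int.floor_add_fract, Int.floor_add_fract]; ring
  · rw [Int.floor_add_fract, h1]

theorem hexComplex_cover (x : Plane) : ∃ p ∈ hexComplex.vertices, dist x p < 1 := by
  obtain ⟨i, j, a, b, ha, ha', hb, hb', h0, h1⟩ := exists_hex_coords x
  have lt_one : ∀ {a b : ℝ}, 0 ≤ a → a < 1 → 0 ≤ b → b < 1 → a + b ≤ 1 →
      a ^ 2 + a * b + b ^ 2 < 1 := by
    intro a b ha ha' hb hb' h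
    rcases ha.eq_or_lt with rfl | ha
    · nlinarith
    · nlinarith
  have sq : ∀ {d : ℝ}, d ^ 2 < 1 → d < 1 := fun h => by nlinarith
  rw [hexComplex_vertices]
  -- The diagonal `a + b = 1` splits the fundamental parallelogram into two lattice triangles. The
  -- vertex of the triangle opposite the diagonal is close enough, as `a² + ab + b² < 1` there.
  rcases le_or_gt (a + b) 1 with hab | hab
  · refine ⟨_, ⟨i, j, rfl⟩, sq ?_⟩
    rw [dist_sq_hexPoint x i j _ _ h0 h1]
    linarith [lt_one ha ha' hb hb' hab]
  · refine ⟨_, ⟨i + 1, j + 1, rfl⟩, sq ?_⟩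
    rw [dist_sq_hexPoint x _ _ _ _ h0 h1]
    push_cast
    rcases hb.eq_or_lt with rfl | hb
    · linarith
    rcases ha.eq_or_lt with rfl | ha
    · linarith
    linarith [lt_one (sub_pos.mpr ha').le (sub_lt_self 1 ha) (sub_pos.mpr hb').le
      (sub_lt_self 1 hb) (by linarith)]

theorem hexComplex_space : hexComplex.space = Set.univ := by
  classical
  rw [Set.eq_univ_iff_forall]
  intro x
  have key : ∀ i j σ, (σ = 1 ∨ σ = -1) → ∀ p q r : ℝ, 0 ≤ p → 0 ≤ q → 0 ≤ r → p + q + r = 1 →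
      x = p • hexPoint i j + q • hexPoint (i + σ) j + r • hexPoint i (j + σ) →
      x ∈ hexComplex.space := by
    rintro i j σ hσ p q r hp hq hr h rfl
    refine hexComplex.mem_space_iff.mpr
      ⟨{hexPoint i j, hexPoint (i + σ) j, hexPoint i (j + σ)}, ⟨by simp, i, j, σ, hσ, ?_⟩, ?_⟩
    · simp [hexTriangle]
    · exact comb_mem_convexHull (subset_convexHull ℝ _ (by simp)) (subset_convexHull ℝ _ (by simp))
        (subset_convexHull ℝ _ (by simp)) hp hq hr h
  obtain ⟨i, j, a, b, ha, ha', hb, hb', h0, h1⟩ := exists_hex_coords x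
  rcases le_or_gt (a + b) 1 with hab | hab
  · refine key i j 1 (Or.inl rfl) (1 - a - b) a b (by linarith) ha hb (by ring) (plane_ext ?_ ?_) <;>
      simp only [h0, h1, PiLp.add_apply, PiLp.smul_apply, smul_eq_mul, hexPoint_zero,
        hexPoint_one] <;> push_cast <;> ring
  · refine key (i + 1) (j + 1) (-1) (Or.inr rfl) (a + b - 1) (1 - a) (1 - b) (by linarith)
      (by linarith) (by linarith) (by ring) (plane_ext ?_ ?_) <;>
      simp only [h0, h1, PiLp.add_apply, PiLp.smul_apply, smul_eq_mul, hexPoint_zero,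
        hexPoint_one] <;> push_cast <;> ring

theorem isGood_hexComplex : IsGood 1 hexComplex := by
  have hsep : EtaSeparated 1 hexComplex.vertices := by
    rw [hexComplex_vertices]
    rintro _ ⟨i, j, rfl⟩ _ ⟨k, l, rfl⟩ hne
    exact one_le_dist_hexPoint hne
  have hemp : ∀ a b c, IsTri hexComplex a b c → ∀ S : Sphere Plane, a ∈ S → b ∈ S → c ∈ S →
      ∀ p ∈ hexComplex.vertices, 0 ≤ S.power p := by
    rintro a b c ⟨h0, s, ⟨-, i, j, σ, hσ, hs⟩, e⟩ S ha hb hc p hp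
    rw [hexComplex_vertices] at hp
    obtain ⟨k, l, rfl⟩ := hp
    refine (power_hexPoint_nonneg (i := i) (j := j) hσ (S := S) ?_ k l).1
    rw [hexTriangle, ← triple_eq_of_subset h0 (e ▸ hs)]
    rintro v (rfl | rfl | rfl) <;> assumption
  refine ⟨locallyFinite_of_etaSeparated one_pos hsep (D := 2) ?_, hexComplex_space, ?_, ?_, hemp⟩
  · rintro s ⟨-, i, j, σ, hσ, hs⟩ u hu v hv
    have key : ∀ w ∈ s, dist w (hexPoint i j) ≤ 1 := by
      intro w hw
      apply le_of_sq_le_sq _ zero_le_one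
      rcases hs (Finset.mem_coe.mpr hw) with rfl | rfl | rfl <;>
        rw [dist_sq_hexPoint _ i j _ _ rfl rfl] <;> rcases hσ with rfl | rfl <;> norm_num
    linarith [dist_triangle_right u v (hexPoint i j), key u hu, key v hv]
  · exact fun a b c h => hsep h.mem_vertices h.rotate.mem_vertices (crossArea_ne h.1)
  · intro a b c h S ha hb hc
    obtain ⟨p, hp, hd⟩ := hexComplex_cover S.center
    have := (notMem_ball_iff_power (radius_nonneg_of_mem ha) p).mpr (hemp a b c h S ha hb hc p hp)
    rw [Metric.mem_ball, not_lt, dist_comm] at this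
    linarith

theorem cdgFamily_nonempty : cdgFamily.Nonempty :=
  ⟨hexComplex, 1, one_pos, hexComplex.vertices, hexComplex,
    isGromovSet_of_cover (etaSeparated_vertices isGood_hexComplex.lf isGood_hexComplex.univ
      isGood_hexComplex.empty zero_le_one isGood_hexComplex.edge) hexComplex_cover,
    isGood_hexComplex.isDelaunayTriangulation hexComplex_cover, le_rfl⟩

end

theorem mainTheorem1 :
    cdgFamily.Nonempty ∧ IsNondegExtSubdiv (Real.pi / 6) 2 cdgFamily :=
  ⟨cdgFamily_nonempty, isNondegExtSubdiv_cdgFamily⟩
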